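/- **Setting.** For $a_1,\dots,a_M>0$ and $\Re(w)>0$ let $$\zeta_M(s,w\,|\,a)=\frac1{\Gamma(s)}\int_0^\infty t^{s-1}e^{-wt}\prod_{j=1}^M(1-e^{-a_jt})^{-1}\,dt,\qquad \Re(s)>M,$$ let $L_M(w\,|\,a)=\partial_s\zeta_M(s,w\,|\,a)|_{s=0}$ (after analytic continuation in $s$), and for $b_0,b_1,\dots,b_N>0$ let $$(\mathcal S_NL_M)(q\,|\,a,b)=\sum_{p=0}^N(-1)^p\sum_{1\le k_1<\dots<k_p\le N}L_M(q+b_0+b_{k_1}+\dots+b_{k_p}\,|\,a).$$ The Barnes beta distribution $\beta_{M,N}(a,b)$ is the probability distribution on $(0,1]$ with $\mathbf E[\beta_{M,N}(a,b)^q]=\exp\big((\mathcal S_NL_M)(q\,|\,a,b)-(\mathcal S_NL_M)(0\,|\,a,b)\big)$ for $\Re(q)>-b_0$. For $\delta>0$ write $\beta_{00}(\delta)$ for $\beta_{0,0}$ with $b_0=\delta$; it has density $\delta x^{\delta-1}$ on $(0,1)$. For $\delta>0$ and an integer $M\ge1$ let $\beta_M(\delta)$ be the distribution $\beta_{2M,3M}$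 with parameters $$a^{(k)}_i=(2i-1)\tfrac{\pi^2}2,\quad b_0=\delta,\quad b^{(k)}_j=(4j-2)\tfrac{\pi^2}2,\quad b^{(3)}_j=2j\,\tfrac{\pi^2}2,\qquad k=1,2,\ i,j=1,\dots,M.$$ Let $T(\delta)$ be the distribution on $(0,\infty)$ for which $\beta_M(\delta)\to e^{-T(\delta)}$ in law as $M\to\infty$. Let $(\Gamma_{2,n})_{n\ge1}$ be i.i.d. with density $xe^{-x}$ on $(0,\infty)$, and put $$S_2=\frac2{\pi^2}\sum_{n\ge1}\frac{\Gamma_{2,n}}{n^2},\qquad S_2(\delta)=\sum_{n\ge1}\frac{\Gamma_{2,n}}{\pi^2n^2/2+\delta}.$$ Let $\theta(t)=1+2\sum_{n\ge1}e^{-\pi tn^2}$ for $t>0$, let $\xi(q)=\frac12q(q-1)\pi^{-q/2}\Gamma(q/2)\zeta(q)$ (an entire function, after removing its removable singularities), and let $c_\delta=\big(\sinh\sqrt{2\delta}/\sqrt{2\delta}\big)^2$. **Theorem.** The distributions $\beta_M(\delta)$ and $T(\delta)$ exist and are unique for all $\delta>0$ and $M\ge1$. The series $S_2$ and $S_2(\delta)$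 converge almost surely to positive limits. Moreover: 1. For every $\delta>0$, $S_2(\delta)$ is infinitely divisible and absolutely continuous. For $q>0$, $$\mathbf E[e^{-qS_2(\delta)}]=c_\delta\,\mathbf E[e^{-(q+\delta)S_2}]=\exp\Big(\int_0^\infty(e^{-qt}-1)e^{-\delta t}\big(\theta(\tfrac{\pi t}2)-1\big)\frac{dt}t\Big),$$ where the integral converges absolutely. $S_2$ has a density $f_{S_2}$ on $(0,\infty)$, and $S_2(\delta)$ has the density $f_{S_2(\delta)}(x)=c_\delta e^{-\delta x}f_{S_2}(x)$, $x>0$. If $\delta<\pi^2/2$, then for every $q\in\mathbb C$ the moment $\mathbf E[S_2(\delta)^q]$ exists and $$\mathbf E[S_2(\delta)^q]=c_\delta\Big(\frac2\pi\Big)^q\sum_{n=0}^\infty\frac1{n!}\Big(\frac{-2\delta}\pi\Big)^n2\xi(2q+2n),$$ where the series converges absolutely. 2. For every $\delta>0$, if $\beta_{00}(\delta)$ is independent of $(\Gamma_{2,n})_{n\ge1}$, then $$T(\delta)\overset{\text{law}}=S_2(\delta)+\big(-\log\beta_{00}(\delta)\big).$$ 3. For every $\delta>0$, $T(\delta)$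 has the density $f_{T(\delta)}(x)=\delta e^{-\delta x}\,c_\delta\,\mathbf P(S_2<x)$, $x>0$. 4. For every $\delta>0$, $\mathbf E[T(\delta)^q]$ exists for all $q\in\mathbb C$ and is an entire function of $q$. If $\delta<\pi^2/2$, then for every $q\in\mathbb C$ $$\mathbf E[T(\delta)^q]-\frac q\delta\,\mathbf E[T(\delta)^{q-1}]=c_\delta\Big(\frac2\pi\Big)^q\sum_{n=0}^\infty\frac1{n!}\Big(\frac{-2\delta}\pi\Big)^n2\xi(2q+2n),$$ where the series converges absolutely. 5. For every $q\in\mathbb C$, $$\lim_{\delta\downarrow0}\Big[\mathbf E[T(\delta)^q]-\frac q\delta\,\mathbf E[T(\delta)^{q-1}]\Big]=\Big(\frac2\pi\Big)^q2\xi(2q).$$ -/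

import Mathlib

open MeasureTheory ProbabilityTheory Set Filter Topology

noncomputable section

/-! ### Barnes multiple zeta and log-gamma functions -/

/-- The Barnes multiple zeta function `ζ_M(s, w | a)` (with `M` the number of parameters `a j`) in
the half-plane `Re s > M`, for `Re w > 0`:
`Γ(s)⁻¹ ∫_0^∞ t^{s-1} e^{-wt} f(t) t^{-M} dt` with `f(t) = t^M ∏_j (1 - e^{-a_j t})⁻¹`. -/
def barnesZetaIntegral {ι : Type*} [Fintype ι] (a : ι → ℝ) (s w : ℂ) : ℂ :=
  (Complex.Gamma s)⁻¹ * ∫ t in Ioi (0 : ℝ),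
    (t : ℂ) ^ (s - 1) * Complex.exp (-w * t) *
      ((∏ j, (1 - Real.exp (-(a j) * t))⁻¹ : ℝ) : ℂ)

/-- `Z` is the analytic continuation of `s ↦ ζ_M(s, w | a)` from `Re s > M` to
`{Re s > -1} ∖ {1, …, M}`, a connected open set that contains `0`. -/
def IsBarnesZetaContinuation {ι : Type*} [Fintype ι] (a : ι → ℝ) (w : ℂ) (Z : ℂ → ℂ) : Prop :=
  DifferentiableOn ℂ Z
      {s : ℂ | -1 < s.re ∧ ∀ m : ℕ, 1 ≤ m → m ≤ Fintype.card ι → s ≠ (m : ℂ)} ∧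
    ∀ s : ℂ, (Fintype.card ι : ℝ) < s.re → Z s = barnesZetaIntegral a s w

/-- The Barnes log-gamma function `L_M(w | a) = ∂_s ζ_M(s, w | a)` at `s = 0`, for `Re w > 0`,
where `ζ_M` is continued analytically to a neighbourhood of `0`. -/
def barnesLogGamma {ι : Type*} [Fintype ι] (a : ι → ℝ) (w : ℂ) : ℂ :=
  deriv (Classical.epsilon (IsBarnesZetaContinuation a w)) 0

/-! ### Barnes beta distributions -/

/-- `(S_N h)(q | b) = ∑_p (-1)^p ∑_{k_1 < ⋯ < k_p} h(q + b_0 + b_{k_1} + ⋯ + b_{k_p})`. -/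
def barnesS {κ : Type*} [Fintype κ] (h : ℂ → ℂ) (b₀ : ℝ) (b : κ → ℝ) (q : ℂ) : ℂ :=
  ∑ s : Finset κ, (-1) ^ s.card * h (q + b₀ + ∑ j ∈ s, (b j : ℂ))

/-- `η_{M,N}(q | a, b) = exp((S_N L_M)(q | a, b) - (S_N L_M)(0 | a, b))`. -/
def barnesEta {ι κ : Type*} [Fintype ι] [Fintype κ] (a : ι → ℝ) (b₀ : ℝ) (b : κ → ℝ) (q : ℂ) : ℂ :=
  Complex.exp (barnesS (barnesLogGamma a) b₀ b q - barnesS (barnesLogGamma a) b₀ b 0)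

/-- `μ` is the Barnes beta distribution `β_{M,N}(a, b)`: the probability distribution on `(0, 1]`
whose Mellin transform is `η_{M,N}(q | a, b)` for `Re q > -b_0`. -/
def IsBarnesBeta {ι κ : Type*} [Fintype ι] [Fintype κ] (a : ι → ℝ) (b₀ : ℝ) (b : κ → ℝ)
    (μ : ProbabilityMeasure ℝ) : Prop :=
  (μ : Measure ℝ) (Ioc 0 1)ᶜ = 0 ∧
    ∀ q : ℂ, -b₀ < q.re →
      Integrable (fun x : ℝ => (x : ℂ) ^ q) (μ : Measure ℝ) ∧
        ∫ x : ℝ, (x : ℂ) ^ q ∂(μ : Measure ℝ) = barnesEta a b₀ b q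

/-- The `2M` parameters `a^{(k)}_i = (2i-1)π²/2`, `k = 1, 2`, `i = 1, …, M`. -/
def aParam (M : ℕ) : Fin 2 × Fin M → ℝ :=
  fun p => (2 * ((p.2 : ℕ) + 1 : ℝ) - 1) * (Real.pi ^ 2 / 2)

/-- The `3M` parameters `b^{(k)}_j = (4j-2)π²/2` for `k = 1, 2` and `b^{(3)}_j = 2jπ²/2`,
`j = 1, …, M`. -/
def bParam (M : ℕ) : Fin 3 × Fin M → ℝ :=
  fun p => if p.1 = 2 then 2 * ((p.2 : ℕ) + 1 : ℝ) * (Real.pi ^ 2 / 2)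
    else (4 * ((p.2 : ℕ) + 1 : ℝ) - 2) * (Real.pi ^ 2 / 2)

/-- `μ` is the distribution `β_M(δ) = β_{2M,3M}`, with `b_0 = δ`. -/
def IsBetaM (M : ℕ) (δ : ℝ) (μ : ProbabilityMeasure ℝ) : Prop :=
  IsBarnesBeta (aParam M) δ (bParam M) μ

/-- `μ` is the distribution `β_{0,0}(b_0 = δ)`. -/
def IsBeta00 (δ : ℝ) (μ : ProbabilityMeasure ℝ) : Prop :=
  IsBarnesBeta (Fin.elim0 : Fin 0 → ℝ) δ (Fin.elim0 : Fin 0 → ℝ) μ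

/-- The law of `exp(-X)` when `X` has law `τ`. -/
def expNegLaw (τ : ProbabilityMeasure ℝ) : ProbabilityMeasure ℝ :=
  τ.map (f := fun x : ℝ => Real.exp (-x)) (by fun_prop)

/-- `τ` is the law of `T(δ)`: a probability distribution on `(0, ∞)` such that `β_M(δ)` converges
in law to `exp(-T(δ))` as `M → ∞`. -/
def IsLawT (δ : ℝ) (τ : ProbabilityMeasure ℝ) : Prop :=
  (τ : Measure ℝ) (Ioi 0)ᶜ = 0 ∧
    ∃ β : ℕ → ProbabilityMeasure ℝ,
      (∀ M : ℕ, 1 ≤ M → IsBetaM M δ (β M)) ∧ Tendsto β atTop (𝓝 (expNegLaw τ))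

/-! ### The variables `S_2` and `S_2(δ)`, theta and xi -/

/-- `S_2 = (2/π²) ∑_{n ≥ 1} Γ_{2,n} / n²`, where `G n` stands for `Γ_{2,n+1}`. -/
def S2 {Ω : Type*} (G : ℕ → Ω → ℝ) (ω : Ω) : ℝ :=
  2 / Real.pi ^ 2 * ∑' n : ℕ, G n ω / ((n : ℝ) + 1) ^ 2

/-- `S_2(δ) = ∑_{n ≥ 1} Γ_{2,n} / (π²n²/2 + δ)`, where `G n` stands for `Γ_{2,n+1}`. -/
def S2δ {Ω : Type*} (G : ℕ → Ω → ℝ) (δ : ℝ) (ω : Ω) : ℝ :=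
  ∑' n : ℕ, G n ω / (Real.pi ^ 2 * ((n : ℝ) + 1) ^ 2 / 2 + δ)

/-- Jacobi's theta function `θ(t) = 1 + 2 ∑_{n ≥ 1} e^{-π t n²}`, `t > 0`. -/
def thetaJ (t : ℝ) : ℝ := 1 + 2 * ∑' n : ℕ, Real.exp (-Real.pi * t * ((n : ℝ) + 1) ^ 2)

/-- The Riemann xi function as an entire function; see `xiR_eq`. -/
def xiR (s : ℂ) : ℂ := 1 / 2 + s * (s - 1) / 2 * completedRiemannZeta₀ s

/-- `ξ(s) = ½ s(s-1) π^{-s/2} Γ(s/2) ζ(s)` away from the removable singularities of the right-hand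
side. -/
theorem xiR_eq (s : ℂ) (h1 : s ≠ 1) (h : ∀ n : ℕ, s ≠ -(2 * n)) :
    xiR s = 1 / 2 * s * (s - 1) * (Real.pi : ℂ) ^ (-s / 2) * Complex.Gamma (s / 2) *
      riemannZeta s := by
  have h0 : s ≠ 0 := by simpa using h 0
  have h1' : (1 : ℂ) - s ≠ 0 := sub_ne_zero.mpr (Ne.symm h1)
  have hG : Complex.Gammaℝ s ≠ 0 := by
    rw [Ne, Complex.Gammaℝ_eq_zero_iff]
    rintro ⟨n, hn⟩
    exact h n hn
  have hz := riemannZeta_def_of_ne_zero h0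
  have hc : completedRiemannZeta s = Complex.Gammaℝ s * riemannZeta s := by
    rw [hz]; field_simp
  rw [completedRiemannZeta_eq] at hc
  have hd : Complex.Gammaℝ s = (Real.pi : ℂ) ^ (-s / 2) * Complex.Gamma (s / 2) :=
    Complex.Gammaℝ_def s
  have : completedRiemannZeta₀ s = Complex.Gammaℝ s * riemannZeta s + 1 / s + 1 / (1 - s) := by
    rw [← hc]; ring
  rw [xiR, this, hd]
  field_simp
  ring

/-- The factor `(sinh √(2δ) / √(2δ))²`. -/
def sinhFactor (δ : ℝ) : ℝ := (Real.sinh (√(2 * δ)) / √(2 * δ)) ^ 2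

/-! ### Laws on the line -/

/-- `μ` is infinitely divisible: for every `n ≥ 1` it is the law of a sum of `n` independent
random variables with a common law `ν`. -/
def IsInfDivisible (μ : Measure ℝ) : Prop :=
  ∀ n : ℕ, 1 ≤ n → ∃ ν : Measure ℝ, IsProbabilityMeasure ν ∧
    (Measure.pi (fun _ : Fin n => ν)).map (fun x => ∑ i, x i) = μ

/-- The Mellin transform `q ↦ E[X^q]` of a random variable `X > 0` with law `μ`. -/
def mellinE (μ : Measure ℝ) (q : ℂ) : ℂ := ∫ x : ℝ, (x : ℂ) ^ q ∂μ

/-- `∑_{n ≥ 0} (1/n!) (-2δ/π)^n 2ξ(2q + 2n)`, term by term. -/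
def xiTerm (δ : ℝ) (q : ℂ) (n : ℕ) : ℂ :=
  1 / (n.factorial : ℂ) * ((-2 * δ / Real.pi : ℝ) : ℂ) ^ n * (2 * xiR (2 * q + 2 * n))

end

/-! ### Determination of laws by moments and Laplace transforms -/

/-! Write λ_n = π²n²/2 and x = e^{-π²t/2}. The parameters are chosen so that ∏(1 - e^{-b_j t}) / ∏(1
- e^{-a_i t}) is a finite Jacobi triple product in x. It stays below θ(πt/2) and converges to it as
M → ∞ (`barnesRatio_param`, `finite_triple_product`).

The continued Barnes zeta function matters only through its derivative at 0. The alternating sum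
over subsets turns the kernel into the above ratio, which vanishes at t = 0 because there are more
b's than a's. Hence S_N L_M(q) = ∫ e^{-qt} e^{-b_0 t} ratio(t) dt/t (`barnesS_barnesLogGamma`). So
-log β_M(δ) is compound Poisson with Lévy density e^{-δt} ratio(t)/t, which gives existence.
Uniqueness holds because a law on [0, 1] is determined by its moments.

Let M → ∞ in the exponent and split θ = 1 + (θ - 1). The n-th moment of β_M(δ) tends to δ/(n+δ), the
n-th moment of β_00(δ), times the exponential of a Frullani integral. Since θ(πt/2) - 1 = 2 ∑
e^{-λ_k t}, that exponential is ∏ (1 + n/(λ_k+δ))^{-2}, the Laplace transform of S_2(δ) at n. This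
identifies T(δ) as an independent sum (`IsGammaSeq.isLawT_iff`, `IsGammaSeq.lawT_eq_conv`). Laws on
[0, ∞) are determined by their Laplace transforms, so the other identities of laws reduce to
identities of products. In particular Euler's product gives E[e^{-qS_2}] = 1/c_q and shows that
S_2(δ) is an exponential tilt of S_2.

For the moments of S_2, integrate l^{s-1} against 2l/sinh²√(2l), expanded in exponentials. The
result contains ζ(2s+1) and becomes 2ξ(-2s) by the functional equation. Both sides are entire, so
the formula extends to all q (`IsS2Law.mellinE_eq`). Expanding e^{-δS_2} in powers, which the
exponential moments allow for δ < λ_1, gives the ξ-series. Finally E[T^q] - (q/δ) E[T^{q-1}] equals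
E[S_2(δ)^q], because against the density of T the integrand is an exact derivative
(`IsS2Law.mellinE_lawT_sub`). The limit δ → 0 is dominated convergence. -/

lemma integrable_pow_of_mem_Icc {μ : Measure ℝ} [IsFiniteMeasure μ]
    (hμ : μ (Icc 0 1)ᶜ = 0) (n : ℕ) : Integrable (fun x : ℝ => x ^ n) μ := by
  refine Integrable.of_bound (by fun_prop) 1 ?_
  have : ∀ᵐ x ∂μ, x ∈ Icc (0 : ℝ) 1 := by rw [ae_iff]; exact hμ
  filter_upwards [this] with x hx
  rw [norm_pow, Real.norm_of_nonneg hx.1]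
  exact pow_le_one₀ hx.1 hx.2

lemma integral_polynomial_of_mem_Icc {μ : Measure ℝ} [IsFiniteMeasure μ]
    (hμ : μ (Icc 0 1)ᶜ = 0) (p : Polynomial ℝ) :
    Integrable (fun x : ℝ => p.eval x) μ ∧
      ∫ x, p.eval x ∂μ = ∑ i ∈ Finset.range (p.natDegree + 1), p.coeff i * ∫ x, x ^ i ∂μ := by
  simp_rw [Polynomial.eval_eq_sum_range]
  constructor
  · exact integrable_finsetSum _ fun i _ => (integrable_pow_of_mem_Icc hμ i).const_mul _
  · rw [integral_finsetSum _ fun i _ => (integrable_pow_of_mem_Icc hμ i).const_mul _]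
    simp_rw [integral_const_mul]

lemma abs_integral_sub_polynomial_le {μ : Measure ℝ} [IsProbabilityMeasure μ]
    (hμ : μ (Icc 0 1)ᶜ = 0) (f : BoundedContinuousFunction ℝ ℝ) (p : Polynomial ℝ) {ε : ℝ}
    (hp : ∀ x ∈ Icc (0 : ℝ) 1, |p.eval x - f x| < ε) :
    |∫ x, p.eval x ∂μ - ∫ x, f x ∂μ| ≤ ε := by
  have hae : ∀ᵐ x ∂μ, x ∈ Icc (0 : ℝ) 1 := by rw [ae_iff]; exact hμ
  rw [← integral_sub (integral_polynomial_of_mem_Icc hμ p).1 (f.integrable μ)]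
  have := norm_integral_le_of_norm_le_const (μ := μ) (f := fun x => p.eval x - f x) (C := ε)
    (by filter_upwards [hae] with x hx using (hp x hx).le)
  simpa using this

/-- Weak convergence of probability measures on `[0, 1]` follows from convergence of moments. -/
lemma tendsto_of_tendsto_moments {β : ℕ → ProbabilityMeasure ℝ} {τ : ProbabilityMeasure ℝ}
    (hβ : ∀ᶠ M in atTop, (β M : Measure ℝ) (Icc 0 1)ᶜ = 0) (hτ : (τ : Measure ℝ) (Icc 0 1)ᶜ = 0)
    (h : ∀ n : ℕ, Tendsto (fun M => ∫ x, x ^ n ∂(β M : Measure ℝ)) atTop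
      (𝓝 (∫ x, x ^ n ∂(τ : Measure ℝ)))) :
    Tendsto β atTop (𝓝 τ) := by
  rw [ProbabilityMeasure.tendsto_iff_forall_integral_tendsto]
  intro f
  rw [Metric.tendsto_nhds]
  intro ε hε
  -- Weierstrass on [0, 1]: replacing `f` by `p` costs at most ε/4 under each law, and the integrals
  -- of `p`, being finite combinations of moments, eventually differ by less than ε/4.
  obtain ⟨p, hp⟩ := exists_polynomial_near_of_continuousOn 0 1 f f.continuous.continuousOn
    (ε / 4) (by positivity)
  have hconv : Tendsto (fun M => ∑ i ∈ Finset.range (p.natDegree + 1),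
      p.coeff i * ∫ x, x ^ i ∂(β M : Measure ℝ)) atTop
      (𝓝 (∑ i ∈ Finset.range (p.natDegree + 1), p.coeff i * ∫ x, x ^ i ∂(τ : Measure ℝ))) :=
    tendsto_finsetSum _ fun i _ => (h i).const_mul _
  rw [Metric.tendsto_nhds] at hconv
  filter_upwards [hconv (ε / 4) (by positivity), hβ] with M hM hM'
  have h1 := abs_integral_sub_polynomial_le hM' f p hp
  have h2 := abs_integral_sub_polynomial_le hτ f p hp
  rw [← (integral_polynomial_of_mem_Icc hM' p).2, ← (integral_polynomial_of_mem_Icc hτ p).2,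
    Real.dist_eq] at hM
  rw [Real.dist_eq]
  rw [abs_le] at h1 h2
  rw [abs_lt] at hM ⊢
  constructor <;> linarith [hM.1, hM.2, h1.1, h1.2, h2.1, h2.2]

/-- The constant sequence `μ` converges weakly to `ν` as well as to `μ`, and weak limits are unique.
-/
lemma eq_of_moments_eq {μ ν : ProbabilityMeasure ℝ}
    (hμ : (μ : Measure ℝ) (Icc 0 1)ᶜ = 0) (hν : (ν : Measure ℝ) (Icc 0 1)ᶜ = 0)
    (h : ∀ n : ℕ, ∫ x, x ^ n ∂(μ : Measure ℝ) = ∫ x, x ^ n ∂(ν : Measure ℝ)) : μ = ν := by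
  have : Tendsto (fun _ : ℕ => μ) atTop (𝓝 ν) :=
    tendsto_of_tendsto_moments (Eventually.of_forall fun _ => hμ) hν
      fun n => by rw [h n]; exact tendsto_const_nhds
  exact tendsto_nhds_unique tendsto_const_nhds this

lemma map_exp_neg_compl_Icc {μ : Measure ℝ} (hμ : μ (Iio 0) = 0) :
    μ.map (fun x => Real.exp (-x)) (Icc 0 1)ᶜ = 0 := by
  rw [Measure.map_apply (by fun_prop) measurableSet_Icc.compl]
  refine measure_mono_null ?_ hμ
  intro x hx
  by_contra hx'
  simp only [mem_Iio, not_lt] at hx'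
  exact hx ⟨(Real.exp_pos _).le, by simpa using hx'⟩

lemma eq_of_map_exp_neg_eq {μ ν : Measure ℝ}
    (h : μ.map (fun x => Real.exp (-x)) = ν.map (fun x => Real.exp (-x))) : μ = ν := by
  have key : ∀ ρ : Measure ℝ, (ρ.map (fun x => Real.exp (-x))).map (fun x => -Real.log x) = ρ := by
    intro ρ
    rw [Measure.map_map (by fun_prop) (by fun_prop)]
    simp [Function.comp_def]
  rw [← key μ, ← key ν, h]

/-- A probability law on `[0, ∞)` is determined by its Laplace transform at the integers. -/
lemma eq_of_lintegral_exp_neg_eq {μ ν : Measure ℝ} [IsProbabilityMeasure μ]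
    (hμ : μ (Iio 0) = 0) (hν : ν (Iio 0) = 0)
    (h : ∀ n : ℕ, ∫⁻ x, ENNReal.ofReal (Real.exp (-(n * x))) ∂μ =
      ∫⁻ x, ENNReal.ofReal (Real.exp (-(n * x))) ∂ν) : μ = ν := by
  -- The total mass of `ν` is read off from n = 0. This allows `ν` to be a tilted measure whose
  -- normalisation is not known beforehand.
  have hp : IsProbabilityMeasure ν := ⟨by simpa using (h 0).symm⟩
  apply eq_of_map_exp_neg_eq
  have hm : ∀ ρ : Measure ℝ, IsProbabilityMeasure ρ →
      IsProbabilityMeasure (ρ.map (fun x => Real.exp (-x))) :=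
    fun ρ _ => Measure.isProbabilityMeasure_map (by fun_prop)
  have := eq_of_moments_eq (μ := ⟨_, hm μ inferInstance⟩) (ν := ⟨_, hm ν hp⟩)
    (map_exp_neg_compl_Icc hμ) (map_exp_neg_compl_Icc hν) ?_
  · exact congrArg Subtype.val this
  intro n
  simp only [ProbabilityMeasure.coe_mk]
  rw [integral_map (by fun_prop) (by fun_prop), integral_map (by fun_prop) (by fun_prop)]
  have e : ∀ x : ℝ, Real.exp (-x) ^ n = Real.exp (-(n * x)) := by
    intro x; rw [← Real.exp_nat_mul]; ring_nf
  simp_rw [e]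
  rw [integral_eq_lintegral_of_nonneg_ae (ae_of_all _ fun _ => (Real.exp_pos _).le) (by fun_prop),
    integral_eq_lintegral_of_nonneg_ae (ae_of_all _ fun _ => (Real.exp_pos _).le) (by fun_prop), h]

/-! ### Compound Poisson laws -/

/-- The `n`-fold convolution of a measure with itself. -/
noncomputable def convPow (ν : Measure ℝ) : ℕ → Measure ℝ
  | 0 => Measure.dirac 0
  | n + 1 => (convPow ν n).conv ν

instance convPow.isFiniteMeasure (ν : Measure ℝ) [IsFiniteMeasure ν] (n : ℕ) :
    IsFiniteMeasure (convPow ν n) := by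
  induction n with
  | zero => unfold convPow; infer_instance
  | succ n ih => unfold convPow; infer_instance

/-- The compound Poisson law with intensity the finite measure `ν`. -/
noncomputable def compoundPoisson (ν : Measure ℝ) : Measure ℝ :=
  Measure.sum fun n : ℕ =>
    (ENNReal.ofReal (Real.exp (-ν.real univ) / n.factorial)) • convPow ν n

lemma conv_Iio_zero {μ ν : Measure ℝ} [SFinite μ] [SFinite ν] (hμ : μ (Iio 0) = 0)
    (hν : ν (Iio 0) = 0) : (μ.conv ν) (Iio 0) = 0 := by
  rw [Measure.conv, Measure.map_apply (by fun_prop) measurableSet_Iio]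
  refine measure_mono_null (t := (Iio 0 ×ˢ univ) ∪ (univ ×ˢ Iio 0)) ?_ ?_
  · rintro ⟨x, y⟩ h
    simp only [mem_preimage, mem_Iio] at h
    by_contra hc
    simp at hc
    linarith
  · refine measure_union_null ?_ ?_ <;> simp [Measure.prod_prod, hμ, hν]

lemma integral_exp_neg_conv (μ ν : Measure ℝ) [SFinite μ] [SFinite ν] (q : ℝ) :
    ∫ x, Real.exp (-(q * x)) ∂(μ.conv ν) =
      (∫ x, Real.exp (-(q * x)) ∂μ) * ∫ x, Real.exp (-(q * x)) ∂ν := by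
  rw [Measure.conv, integral_map (by fun_prop) (by fun_prop), ← integral_prod_mul]
  refine integral_congr_ae (ae_of_all _ fun z => ?_)
  simp only [← Real.exp_add]
  ring_nf

lemma convPow_Iio_zero {ν : Measure ℝ} [IsFiniteMeasure ν] (hν : ν (Iio 0) = 0) (n : ℕ) :
    convPow ν n (Iio 0) = 0 := by
  induction n with
  | zero => simp [convPow]
  | succ n ih =>
    rw [convPow]
    exact conv_Iio_zero ih hν

lemma compoundPoisson_Iio_zero {ν : Measure ℝ} [IsFiniteMeasure ν] (hν : ν (Iio 0) = 0) :
    compoundPoisson ν (Iio 0) = 0 := by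
  rw [compoundPoisson, Measure.sum_apply _ measurableSet_Iio]
  simp [convPow_Iio_zero hν]

/-- Exponentials are multiplicative, so each convolution contributes one more factor. The version
with norms provides the majorant ∑ Cⁿ/n! for the Poisson sum. -/
lemma convPow_exp {ν : Measure ℝ} [IsFiniteMeasure ν] {q : ℂ}
    (hq : Integrable (fun x : ℝ => Complex.exp (-q * x)) ν) (n : ℕ) :
    Integrable (fun x : ℝ => Complex.exp (-q * x)) (convPow ν n) ∧
      ∫ x : ℝ, Complex.exp (-q * x) ∂(convPow ν n) = (∫ x : ℝ, Complex.exp (-q * x) ∂ν) ^ n ∧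
      ∫ x : ℝ, ‖Complex.exp (-q * x)‖ ∂(convPow ν n) = (∫ x : ℝ, ‖Complex.exp (-q * x)‖ ∂ν) ^ n := by
  induction n with
  | zero =>
    refine ⟨?_, ?_, ?_⟩
    · exact integrable_dirac (by simp)
    · simp [convPow]
    · simp [convPow]
  | succ n ih =>
    have e : ∀ x y : ℝ, Complex.exp (-q * ((x + y : ℝ) : ℂ)) =
        Complex.exp (-q * x) * Complex.exp (-q * y) := by
      intro x y; rw [← Complex.exp_add]; push_cast; ring_nf
    have hint : Integrable (fun x : ℝ => Complex.exp (-q * x)) (convPow ν (n + 1)) := by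
      rw [convPow, integrable_conv_iff (by fun_prop)]
      refine ⟨ae_of_all _ fun x => ?_, ?_⟩
      · simp_rw [e]; exact hq.const_mul _
      · simp_rw [e, norm_mul, integral_const_mul]
        exact ih.1.norm.mul_const _
    refine ⟨hint, ?_, ?_⟩
    · rw [convPow] at hint ⊢
      rw [integral_conv hint]
      simp_rw [e, integral_const_mul, integral_mul_const]
      rw [ih.2.1, pow_succ]
    · rw [convPow] at hint ⊢
      rw [integral_conv hint.norm]
      simp_rw [e, norm_mul, integral_const_mul, integral_mul_const]
      rw [ih.2.2, pow_succ]

/-- The Laplace transform of a compound Poisson law. -/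
lemma compoundPoisson_exp {ν : Measure ℝ} [IsFiniteMeasure ν] {q : ℂ}
    (hq : Integrable (fun x : ℝ => Complex.exp (-q * x)) ν) :
    Integrable (fun x : ℝ => Complex.exp (-q * x)) (compoundPoisson ν) ∧
      ∫ x : ℝ, Complex.exp (-q * x) ∂(compoundPoisson ν) =
        Complex.exp (∫ x : ℝ, Complex.exp (-q * x) ∂ν - ν.real univ) := by
  have h0 : ∀ n : ℕ, 0 ≤ Real.exp (-ν.real univ) / n.factorial := fun n => by positivity
  have hint : Integrable (fun x : ℝ => Complex.exp (-q * x)) (compoundPoisson ν) := by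
    refine ⟨by fun_prop, ?_⟩
    rw [hasFiniteIntegral_iff_norm, compoundPoisson, lintegral_sum_measure]
    simp_rw [lintegral_smul_measure]
    have : ∀ n, ENNReal.ofReal (Real.exp (-ν.real univ) / n.factorial) •
        ∫⁻ a : ℝ, ENNReal.ofReal ‖Complex.exp (-q * a)‖ ∂convPow ν n =
        ENNReal.ofReal (Real.exp (-ν.real univ) *
          ((∫ x : ℝ, ‖Complex.exp (-q * x)‖ ∂ν) ^ n / n.factorial)) := by
      intro n
      rw [← ofReal_integral_eq_lintegral_ofReal (convPow_exp hq n).1.norm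
        (ae_of_all _ fun _ => norm_nonneg _), (convPow_exp hq n).2.2, smul_eq_mul,
        ← ENNReal.ofReal_mul (h0 n)]
      congr 1; ring
    simp_rw [this]
    refine Summable.tsum_ofReal_lt_top ?_
    exact (Real.summable_pow_div_factorial _).mul_left _
  refine ⟨hint, ?_⟩
  have hs := hasSum_integral_measure hint
  have hterm : ∀ n : ℕ, ∫ x : ℝ, Complex.exp (-q * x)
      ∂(ENNReal.ofReal (Real.exp (-ν.real univ) / n.factorial) • convPow ν n) =
      Complex.exp (-(ν.real univ : ℂ)) *
        ((∫ x : ℝ, Complex.exp (-q * x) ∂ν) ^ n / n.factorial) := by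
    intro n
    rw [integral_smul_measure, (convPow_exp hq n).2.1, ENNReal.toReal_ofReal (h0 n),
      Complex.real_smul]
    push_cast
    ring
  simp_rw [hterm] at hs
  have h2 := (NormedSpace.expSeries_div_hasSum_exp (∫ x : ℝ, Complex.exp (-q * x) ∂ν)).mul_left
    (Complex.exp (-(ν.real univ : ℂ)))
  rw [← Complex.exp_eq_exp_ℂ, ← Complex.exp_add] at h2
  exact (hs.unique h2).trans (by ring_nf)

lemma isProbabilityMeasure_compoundPoisson (ν : Measure ℝ) [IsFiniteMeasure ν] :
    IsProbabilityMeasure (compoundPoisson ν) := by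
  have h := compoundPoisson_exp (ν := ν) (q := 0) (by simp)
  simp only [neg_zero, zero_mul, Complex.exp_zero, integral_const, Complex.real_smul, mul_one,
    sub_self, integrable_const_iff, one_ne_zero, false_or] at h
  have := h.1
  constructor
  have h2 : (compoundPoisson ν).real univ = 1 := by exact_mod_cast h.2
  rw [measureReal_def] at h2
  rw [← ENNReal.ofReal_toReal (measure_ne_top (compoundPoisson ν) univ), h2, ENNReal.ofReal_one]

/-! ### Analytic continuation of the Barnes zeta function -/

/-- The domain `{Re s > -1} ∖ {1, …, M}`. -/
def barnesDomain (M : ℕ) : Set ℂ :=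
  {s : ℂ | -1 < s.re ∧ ∀ m : ℕ, 1 ≤ m → m ≤ M → s ≠ (m : ℂ)}

/-- The identity theorem is applied twice on convex sets free of punctures: first on `A`, the part
of Re s > -1 in the upper half-plane, which meets Re s > M, and then on the strip `C`, which
contains 0 and meets `A` near i. Connectedness of the punctured half-plane is not needed. The germ
at 0 is thus the same for every continuation. -/
lemma eventuallyEq_zero_of_differentiableOn_barnesDomain {M : ℕ} {f g : ℂ → ℂ}
    (hf : DifferentiableOn ℂ f (barnesDomain M)) (hg : DifferentiableOn ℂ g (barnesDomain M))
    (h : ∀ s : ℂ, (M : ℝ) < s.re → f s = g s) : f =ᶠ[𝓝 0] g := by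
  set A : Set ℂ := {s : ℂ | -1 < s.re} ∩ {s | 0 < s.im} with hA
  set C : Set ℂ := {s : ℂ | -1 < s.re} ∩ {s | s.re < 1} with hC
  have oA : IsOpen A := (isOpen_lt continuous_const Complex.continuous_re).inter
    (isOpen_lt continuous_const Complex.continuous_im)
  have oC : IsOpen C := (isOpen_lt continuous_const Complex.continuous_re).inter
    (isOpen_lt Complex.continuous_re continuous_const)
  have cA : Convex ℝ A := (convex_halfSpace_re_gt _).inter (convex_halfSpace_im_gt _)
  have cC : Convex ℝ C := (convex_halfSpace_re_gt _).inter (convex_halfSpace_re_lt _)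
  have sA : A ⊆ barnesDomain M := by
    intro s hs
    refine ⟨hs.1, fun m _ _ h => ?_⟩
    have := hs.2
    simp [h] at this
  have sC : C ⊆ barnesDomain M := by
    intro s hs
    refine ⟨hs.1, fun m hm _ h => ?_⟩
    have h1 : s.re < 1 := hs.2
    have hm' : (1 : ℝ) ≤ m := by exact_mod_cast hm
    simp [h] at h1
    omega
  have eA : EqOn f g A := by
    refine ((hf.mono sA).analyticOnNhd oA).eqOn_of_preconnected_of_eventuallyEq
      ((hg.mono sA).analyticOnNhd oA) cA.isPreconnected (z₀ := (M : ℂ) + 1 + Complex.I) ?_ ?_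
    · have : (-1 : ℝ) < M + 1 := by linarith [(Nat.cast_nonneg M : (0:ℝ) ≤ M)]
      exact ⟨by simpa using this, by simp⟩
    · have : ∀ᶠ s : ℂ in 𝓝 ((M : ℂ) + 1 + Complex.I), (M : ℝ) < s.re :=
        (isOpen_lt continuous_const Complex.continuous_re).mem_nhds (by simp)
      exact this.mono h
  have eC : EqOn f g C := by
    refine ((hf.mono sC).analyticOnNhd oC).eqOn_of_preconnected_of_eventuallyEq
      ((hg.mono sC).analyticOnNhd oC) cC.isPreconnected (z₀ := Complex.I) (by simp [hC]) ?_
    exact Filter.eventually_of_mem (oA.mem_nhds (show Complex.I ∈ A by simp [hA])) eA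
  exact Filter.eventually_of_mem (oC.mem_nhds (show (0 : ℂ) ∈ C by simp [hC])) eC

/-- Iteration of Γ(z+1) = zΓ(z). After division by Γ(s), a term Γ(s-n) leaves only the poles 1, …,
n. -/
lemma Complex.Gamma_eq_Gamma_sub_mul_prod {s : ℂ} (n : ℕ) (hs : (n : ℝ) < s.re) :
    Complex.Gamma s = Complex.Gamma (s - n) * ∏ m ∈ Finset.Icc 1 n, (s - m) := by
  induction n with
  | zero => simp
  | succ n ih =>
    have hs' : (n : ℝ) + 1 < s.re := by exact_mod_cast hs
    rw [ih (by linarith), Finset.prod_Icc_succ_top (by omega)]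
    have hne : s - ((n + 1 : ℕ) : ℂ) ≠ 0 := by
      intro h
      have := congrArg Complex.re h
      simp at this
      linarith
    have := Complex.Gamma_add_one _ hne
    rw [show s - ((n + 1 : ℕ) : ℂ) + 1 = s - n by push_cast; ring] at this
    rw [this]
    ring

/-- `∏_j (1 - e^{-a_j t})⁻¹`. -/
noncomputable def barnesKernel {ι : Type*} [Fintype ι] (a : ι → ℝ) (t : ℝ) : ℝ :=
  ∏ j, (1 - Real.exp (-(a j) * t))⁻¹

lemma tendsto_barnesKernel_atTop {ι : Type*} [Fintype ι] {a : ι → ℝ} (ha : ∀ j, 0 < a j) :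
    Tendsto (barnesKernel a) atTop (𝓝 1) := by
  have : Tendsto (barnesKernel a) atTop (𝓝 (∏ _j : ι, (1 - 0)⁻¹)) := by
    refine tendsto_finsetProd _ fun j _ => ?_
    refine Tendsto.inv₀ (tendsto_const_nhds.sub ?_) (by norm_num)
    refine Real.tendsto_exp_atBot.comp ?_
    exact tendsto_id.const_mul_atTop_of_neg (by linarith [ha j])
  simpa using this

lemma continuousOn_barnesKernel {ι : Type*} [Fintype ι] {a : ι → ℝ} (ha : ∀ j, 0 < a j) :
    ContinuousOn (barnesKernel a) (Ioi 0) := by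
  refine continuousOn_finsetProd _ fun j _ => ?_
  refine ContinuousOn.inv₀ (by fun_prop) fun t ht => ?_
  have : Real.exp (-(a j) * t) < 1 := by
    rw [Real.exp_lt_one_iff]
    have := mul_pos (ha j) ht
    linarith
  linarith

/-- Taylor expansion of order `M` at `0` of `t^M e^{-vt} ∏_j (1 - e^{-a_j t})⁻¹`. -/
lemma exists_taylor_barnesKernel {ι : Type*} [Fintype ι] {a : ι → ℝ} (ha : ∀ j, 0 < a j) (v : ℂ) :
    ∃ c : ℕ → ℂ, (fun t : ℝ => (t : ℂ) ^ Fintype.card ι * Complex.exp (-v * t) * barnesKernel a t -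
      ∑ k ∈ Finset.range (Fintype.card ι + 1), c k * (t : ℂ) ^ k) =O[𝓝[>] 0]
        fun t => t ^ (Fintype.card ι + 1) := by
  set M := Fintype.card ι
  -- The slope function divides out the simple zero of 1 - e^{-a_j z} at 0 and takes the value a_j ≠
  -- 0 there, so its inverse is an analytic extension of z/(1 - e^{-a_j z}).
  set D : ι → ℂ → ℂ := fun j => dslope (fun z : ℂ => 1 - Complex.exp (-(a j) * z)) 0 with hD
  have hDan : ∀ j, AnalyticAt ℂ (D j) 0 := by
    intro j
    have : AnalyticAt ℂ (fun z : ℂ => 1 - Complex.exp (-(a j) * z)) 0 := by fun_prop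
    obtain ⟨p, hp⟩ := this
    exact ⟨_, hp.has_fpower_series_dslope_fslope⟩
  have hD0 : ∀ j, D j 0 ≠ 0 := by
    intro j
    have : HasDerivAt (fun z : ℂ => 1 - Complex.exp (-(a j) * z)) (a j : ℂ) 0 := by
      have h1 : HasDerivAt (fun z : ℂ => -(a j : ℂ) * z) (-(a j : ℂ)) 0 := by
        simpa using (hasDerivAt_id (0 : ℂ)).const_mul (-(a j : ℂ))
      simpa using h1.cexp.const_sub 1
    rw [hD]
    simp only [dslope_same, this.deriv]
    exact_mod_cast (ha j).ne'
  have hG : AnalyticAt ℂ (fun z : ℂ => Complex.exp (-v * z) * ∏ j, (D j z)⁻¹) 0 := by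
    refine AnalyticAt.mul (by fun_prop) ?_
    exact Finset.analyticAt_fun_prod _ fun j _ => (hDan j).inv (hD0 j)
  obtain ⟨p, hp⟩ := hG
  have hO := hp.isBigO_sub_partialSum_pow (M + 1)
  refine ⟨p.coeff, ?_⟩
  have hO2 := hO.comp_tendsto (k := fun t : ℝ => (t : ℂ)) (l' := 𝓝[>] 0) (by
    have := (Complex.continuous_ofReal.tendsto 0).mono_left
      (nhdsWithin_le_nhds (s := Ioi (0 : ℝ)))
    simpa using this)
  refine (hO2.congr' ?_ ?_)
  · filter_upwards [self_mem_nhdsWithin] with t ht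
    have ht' : (t : ℂ) ≠ 0 := by exact_mod_cast (ne_of_gt ht)
    simp only [Function.comp, zero_add, FormalMultilinearSeries.partialSum]
    congr 1
    · have : ∀ j, (D j t)⁻¹ = (t : ℂ) * ((1 - Real.exp (-(a j) * t))⁻¹ : ℝ) := by
        intro j
        simp only [hD]
        rw [dslope_of_ne _ ht', slope_def_field]
        push_cast
        simp
        field_simp
      simp_rw [this, Finset.prod_mul_distrib, barnesKernel]
      simp [M]
      ring
    · refine Finset.sum_congr rfl fun k _ => ?_
      rw [p.apply_eq_pow_smul_coeff, smul_eq_mul, mul_comm]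
  · filter_upwards [self_mem_nhdsWithin] with t ht
    simp only [Function.comp, Complex.norm_real, Real.norm_of_nonneg (le_of_lt ht)]

lemma ofReal_cpow_mul_pow_div_pow {t : ℝ} (ht : 0 < t) (s : ℂ) (k M : ℕ) :
    (t : ℂ) ^ (s - 1) * ((t : ℂ) ^ k / (t : ℂ) ^ M) = (t : ℂ) ^ (s + k - M - 1) := by
  have ht' : (t : ℂ) ≠ 0 := by exact_mod_cast ht.ne'
  rw [← Complex.cpow_natCast, ← Complex.cpow_natCast, ← Complex.cpow_sub _ _ ht',
    ← Complex.cpow_add _ _ ht']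
  ring_nf

lemma isBigO_exp_mul_pow_div_pow_atTop (r : ℝ) (k M : ℕ) (hk : k ≤ M) :
    (fun t : ℝ => Complex.exp (-r * t) * ((t : ℂ) ^ k / (t : ℂ) ^ M)) =O[atTop]
      fun t : ℝ => Real.exp (-r * t) := by
  refine Asymptotics.IsBigO.of_bound 1 ?_
  filter_upwards [eventually_ge_atTop 1] with t ht
  have h1 : ‖Complex.exp (-r * t)‖ = Real.exp (-r * t) := by
    rw [Complex.norm_exp]; simp
  rw [norm_mul, h1, norm_div, norm_pow, norm_pow, Complex.norm_real,
    Real.norm_of_nonneg (by linarith : 0 ≤ t), Real.norm_of_nonneg (Real.exp_pos _).le, mul_comm]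
  gcongr
  rw [div_le_one (by positivity)]
  exact pow_le_pow_right₀ ht hk

lemma isBigO_exp_mul_pow_div_pow_zero (r : ℝ) (k M : ℕ) :
    (fun t : ℝ => Complex.exp (-r * t) * ((t : ℂ) ^ k / (t : ℂ) ^ M)) =O[𝓝[>] 0]
      fun t : ℝ => t ^ (-((M : ℝ) - k)) := by
  have h1 : (fun t : ℝ => Complex.exp (-r * t)) =O[𝓝[>] 0] fun _ => (1 : ℝ) := by
    have h : ContinuousAt (fun t : ℝ => Complex.exp (-r * t)) 0 := by fun_prop
    exact (h.tendsto.isBigO_one ℝ).mono nhdsWithin_le_nhds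
  have h2 : (fun t : ℝ => ((t : ℂ) ^ k / (t : ℂ) ^ M)) =O[𝓝[>] 0]
      fun t : ℝ => t ^ (-((M : ℝ) - k)) := by
    refine Asymptotics.IsBigO.of_bound 1 ?_
    filter_upwards [self_mem_nhdsWithin] with t ht
    have ht : 0 < t := ht
    rw [norm_div, norm_pow, norm_pow, Complex.norm_real, Real.norm_of_nonneg ht.le,
      Real.norm_of_nonneg (by positivity), one_mul, neg_sub, Real.rpow_sub ht, Real.rpow_natCast,
      Real.rpow_natCast]
  simpa using h1.mul h2

lemma continuousOn_exp_mul_pow_div_pow (r : ℝ) (k M : ℕ) :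
    ContinuousOn (fun t : ℝ => Complex.exp (-r * t) * ((t : ℂ) ^ k / (t : ℂ) ^ M)) (Ioi 0) := by
  refine ContinuousOn.mul (by fun_prop) (ContinuousOn.div (by fun_prop) (by fun_prop) ?_)
  intro t ht
  exact pow_ne_zero _ (by exact_mod_cast (ne_of_gt ht))

lemma mellinConvergent_exp_mul_pow_div_pow {r : ℝ} (hr : 0 < r) {k M : ℕ} (hk : k ≤ M)
    {s : ℂ} (hs : (M : ℝ) < s.re) :
    MellinConvergent (fun t : ℝ => Complex.exp (-r * t) * ((t : ℂ) ^ k / (t : ℂ) ^ M)) s :=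
  mellinConvergent_of_isBigO_rpow_exp hr
    ((continuousOn_exp_mul_pow_div_pow r k M).locallyIntegrableOn measurableSet_Ioi)
    (isBigO_exp_mul_pow_div_pow_atTop r k M hk) (isBigO_exp_mul_pow_div_pow_zero r k M)
    (by have : (0 : ℝ) ≤ k := by positivity
        linarith)

/-- A gamma integral with value r^{-(s+k-M)} Γ(s+k-M). Writing it with Γ(s) makes the prefactor
1/Γ(s) cancel, so that these terms continue explicitly. -/
lemma mellin_exp_mul_pow_div_pow {r : ℝ} (hr : 0 < r) {k M : ℕ} (hk : k ≤ M)
    {s : ℂ} (hs : (M : ℝ) < s.re) :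
    mellin (fun t : ℝ => Complex.exp (-r * t) * ((t : ℂ) ^ k / (t : ℂ) ^ M)) s =
      (1 / r : ℂ) ^ (s + k - M) * (Complex.Gamma s / ∏ m ∈ Finset.Icc 1 (M - k), (s - m)) := by
  have hre : ((M - k : ℕ) : ℝ) < s.re := by
    have : ((M - k : ℕ) : ℝ) ≤ M := by exact_mod_cast Nat.sub_le M k
    linarith
  have hG := Complex.Gamma_eq_Gamma_sub_mul_prod (M - k) hre
  have e1 : s + k - M = s - ((M - k : ℕ) : ℂ) := by push_cast [hk]; ring
  have hne : ∏ m ∈ Finset.Icc 1 (M - k), (s - m) ≠ 0 := by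
    rw [Finset.prod_ne_zero_iff]
    intro m hm h
    rw [Finset.mem_Icc] at hm
    have h1 := congrArg Complex.re h
    simp at h1
    have : (m : ℝ) ≤ ((M - k : ℕ) : ℝ) := by exact_mod_cast hm.2
    linarith
  have h1 := Complex.integral_cpow_mul_exp_neg_mul_Ioi (a := s + k - M) (r := r) (by
    rw [e1]; simpa using hre) (by simpa using hr)
  rw [hG, mul_div_cancel_right₀ _ hne, ← e1, ← h1, mellin]
  refine setIntegral_congr_fun measurableSet_Ioi fun t ht => ?_
  simp only [smul_eq_mul]
  rw [← ofReal_cpow_mul_pow_div_pow ht]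
  ring_nf

/-- The Barnes zeta function has an analytic continuation to the required domain. -/
lemma exists_isBarnesZetaContinuation {ι : Type*} [Fintype ι] {a : ι → ℝ} (ha : ∀ j, 0 < a j)
    {w : ℂ} (hw : 0 < w.re) : ∃ Z, IsBarnesZetaContinuation a w Z := by
  set M := Fintype.card ι with hM
  -- The comparison terms carry the real exponential e^{-rt}, which decays at the same rate as
  -- e^{-wt}. The oscillating factor e^{-(w-r)t} goes into the Taylor expansion.
  set r := w.re
  obtain ⟨c, hc⟩ := exists_taylor_barnesKernel ha (w - r)
  rw [← hM] at hc
  set E : ℕ → ℝ → ℂ := fun k t => Complex.exp (-r * t) * ((t : ℂ) ^ k / (t : ℂ) ^ M) with hE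
  set F : ℝ → ℂ := fun t => Complex.exp (-w * t) * barnesKernel a t with hF
  set H : ℝ → ℂ := fun t => F t - ∑ k ∈ Finset.range (M + 1), c k * E k t with hH
  have hFcont : ContinuousOn F (Ioi 0) := by
    refine ContinuousOn.mul (by fun_prop) ?_
    exact Complex.continuous_ofReal.comp_continuousOn (continuousOn_barnesKernel ha)
  have hHcont : ContinuousOn H (Ioi 0) := hFcont.sub <|
    continuousOn_finsetSum _ fun k _ =>
      continuousOn_const.mul (continuousOn_exp_mul_pow_div_pow r k M)
  have hFtop : F =O[atTop] fun t : ℝ => Real.exp (-r * t) := by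
    have h1 : (fun t : ℝ => Complex.exp (-w * t)) =O[atTop] fun t : ℝ => Real.exp (-r * t) := by
      refine Asymptotics.IsBigO.of_bound 1 (Eventually.of_forall fun t => ?_)
      rw [Complex.norm_exp, Real.norm_of_nonneg (Real.exp_pos _).le]
      simp [r]
    have h2 : (fun t : ℝ => (barnesKernel a t : ℂ)) =O[atTop] fun _ : ℝ => (1 : ℝ) :=
      ((Complex.continuous_ofReal.tendsto 1).comp (tendsto_barnesKernel_atTop ha)).isBigO_one ℝ
    simpa only [mul_one] using h1.mul h2
  have hHtop : H =O[atTop] fun t : ℝ => Real.exp (-r * t) := by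
    refine hFtop.sub (Asymptotics.IsBigO.fun_sum fun k hk => ?_)
    exact (isBigO_exp_mul_pow_div_pow_atTop r k M
      (by simpa [Nat.lt_succ_iff] using hk)).const_mul_left _
  -- A Taylor remainder O(t^{M+1}) divided by t^M is O(t), which extends the Mellin transform of `H`
  -- to Re s > -1.
  have hHzero : H =O[𝓝[>] 0] fun t : ℝ => t ^ (-(-1 : ℝ)) := by
    have h1 : (fun t : ℝ => Complex.exp (-r * t) / (t : ℂ) ^ M) =O[𝓝[>] 0]
        fun t : ℝ => t ^ (-(M : ℝ)) := by
      have := isBigO_exp_mul_pow_div_pow_zero r 0 M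
      simpa [div_eq_mul_inv] using this
    refine (h1.mul hc).congr' ?_ ?_
    · filter_upwards [self_mem_nhdsWithin] with t ht
      have ht' : (t : ℂ) ^ M ≠ 0 := pow_ne_zero _ (by exact_mod_cast (ne_of_gt ht))
      simp only [hH, hF, hE, mul_sub, Finset.mul_sum]
      congr 1
      · have : Complex.exp (-w * t) =
            Complex.exp (-r * t) * Complex.exp (-(w - r) * t) := by
          rw [← Complex.exp_add]; ring_nf
        rw [this]
        field_simp
      · refine Finset.sum_congr rfl fun k _ => ?_
        field_simp
    · filter_upwards [self_mem_nhdsWithin] with t ht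
      have ht : 0 < t := ht
      rw [← Real.rpow_natCast, ← Real.rpow_add ht]
      push_cast
      ring_nf
  -- The subtracted terms are put back in closed form. Their only poles lie among 1, …, M.
  refine ⟨fun s => ∑ k ∈ Finset.range (M + 1), c k * ((1 / r : ℂ) ^ (s + k - M) /
    ∏ m ∈ Finset.Icc 1 (M - k), (s - m)) + (Complex.Gamma s)⁻¹ * mellin H s, ?_, ?_⟩
  · intro s hs
    refine DifferentiableAt.differentiableWithinAt ?_
    refine DifferentiableAt.add ?_ ?_
    · refine DifferentiableAt.fun_sum fun k hk => ?_
      refine DifferentiableAt.mul (by fun_prop) (DifferentiableAt.div ?_ ?_ ?_)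
      · refine DifferentiableAt.const_cpow (by fun_prop) (Or.inl ?_)
        have : (r : ℂ) ≠ 0 := by exact_mod_cast hw.ne'
        simpa using this
      · fun_prop
      · rw [Finset.prod_ne_zero_iff]
        intro m hm h
        rw [Finset.mem_Icc] at hm
        exact hs.2 m hm.1 (hm.2.trans (Nat.sub_le _ _)) (sub_eq_zero.mp h)
    · refine (Complex.differentiable_one_div_Gamma s).mul ?_
      exact mellin_differentiableAt_of_isBigO_rpow_exp hw
        (hHcont.locallyIntegrableOn measurableSet_Ioi) hHtop hHzero hs.1
  · intro s hs
    have hs0 : 0 < s.re := lt_of_le_of_lt (by positivity) hs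
    have hG : Complex.Gamma s ≠ 0 := Complex.Gamma_ne_zero_of_re_pos hs0
    have hHm : MellinConvergent H s := mellinConvergent_of_isBigO_rpow_exp hw
      (hHcont.locallyIntegrableOn measurableSet_Ioi) hHtop hHzero (by linarith)
    have hEm : ∀ k ∈ Finset.range (M + 1), MellinConvergent (fun t => c k * E k t) s :=
      fun k hk => (mellinConvergent_exp_mul_pow_div_pow hw
        (by simpa [Nat.lt_succ_iff] using hk) hs).const_smul (c k)
    have hsum : mellin F s = mellin H s + ∑ k ∈ Finset.range (M + 1), c k * mellin (E k) s := by
      have h1 : ∀ t, F t = H t + ∑ k ∈ Finset.range (M + 1), c k * E k t := by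
        intro t; simp [hH]
      simp only [mellin]
      simp_rw [h1, smul_add, Finset.smul_sum]
      rw [integral_add hHm (integrable_finsetSum _ fun k hk => hEm k hk),
        integral_finsetSum _ fun k hk => hEm k hk]
      congr 1
      refine Finset.sum_congr rfl fun k _ => ?_
      rw [← integral_const_mul]
      refine integral_congr_ae (ae_of_all _ fun t => ?_)
      simp only [smul_eq_mul]
      ring
    have hF' : barnesZetaIntegral a s w = (Complex.Gamma s)⁻¹ * mellin F s := by
      rw [barnesZetaIntegral, mellin]
      congr 1
      refine setIntegral_congr_fun measurableSet_Ioi fun t _ => ?_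
      simp only [smul_eq_mul, hF, barnesKernel]
      ring
    rw [hF', hsum, mul_add, Finset.mul_sum, add_comm ((Complex.Gamma s)⁻¹ * mellin H s)]
    refine congrArg₂ (· + ·) ?_ rfl
    refine Finset.sum_congr rfl fun k hk => ?_
    rw [mellin_exp_mul_pow_div_pow hw (by simpa [Nat.lt_succ_iff] using hk) hs]
    field_simp
    rfl

lemma isBarnesZetaContinuation_epsilon {ι : Type*} [Fintype ι] {a : ι → ℝ} (ha : ∀ j, 0 < a j)
    {w : ℂ} (hw : 0 < w.re) :
    IsBarnesZetaContinuation a w (Classical.epsilon (IsBarnesZetaContinuation a w)) :=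
  Classical.epsilon_spec (exists_isBarnesZetaContinuation ha hw)

/-! ### The Barnes eta function as a Laplace exponent -/

/-- `∏_j (1 - e^{-b_j t}) / ∏_i (1 - e^{-a_i t})`. -/
noncomputable def barnesRatio {ι κ : Type*} [Fintype ι] [Fintype κ] (a : ι → ℝ) (b : κ → ℝ)
    (t : ℝ) : ℝ :=
  barnesKernel a t * ∏ j, (1 - Real.exp (-(b j) * t))

lemma barnesDomain_mem_nhds_zero (M : ℕ) : barnesDomain M ∈ 𝓝 (0 : ℂ) := by
  have h1 : ∀ᶠ s : ℂ in 𝓝 0, -1 < s.re :=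
    (isOpen_lt continuous_const Complex.continuous_re).mem_nhds (by simp)
  have h2 : ∀ᶠ s : ℂ in 𝓝 0, s.re < 1 :=
    (isOpen_lt Complex.continuous_re continuous_const).mem_nhds (by simp)
  filter_upwards [h1, h2] with s hs1 hs2
  refine ⟨hs1, fun m hm _ h => ?_⟩
  simp [h] at hs2
  omega

lemma isBigO_barnesKernel_zero {ι : Type*} [Fintype ι] {a : ι → ℝ} (ha : ∀ j, 0 < a j) :
    barnesKernel a =O[𝓝[>] 0] fun t : ℝ => (t⁻¹) ^ Fintype.card ι := by
  have : (fun t : ℝ => (t⁻¹) ^ Fintype.card ι) = fun t : ℝ => ∏ _j : ι, t⁻¹ := by simp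
  rw [this]
  refine Asymptotics.IsBigO.finsetProd fun j _ => ?_
  -- The constant comes from 1 - e^{-y} ≥ y/(1+y) at y = a_j t, with t < 1.
  refine Asymptotics.IsBigO.of_bound ((1 + a j) / a j) ?_
  filter_upwards [Ioo_mem_nhdsGT (zero_lt_one' ℝ)] with t ht
  have h0 : 0 < a j * t := mul_pos (ha j) ht.1
  have h1 : Real.exp (-(a j) * t) ≤ (1 + a j * t)⁻¹ := by
    rw [neg_mul, Real.exp_neg]
    exact inv_anti₀ (by positivity) (by linarith [Real.add_one_le_exp (a j * t)])
  have h2 : a j * t / (1 + a j * t) ≤ 1 - Real.exp (-(a j) * t) := by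
    have : a j * t / (1 + a j * t) = 1 - (1 + a j * t)⁻¹ := by field_simp; ring
    linarith
  have h3 : 0 < a j * t / (1 + a j * t) := by positivity
  rw [Real.norm_of_nonneg (inv_nonneg.mpr (h3.le.trans h2)),
    Real.norm_of_nonneg (inv_nonneg.mpr ht.1.le)]
  refine (inv_anti₀ h3 h2).trans ?_
  rw [inv_div, ← div_eq_mul_inv, div_div]
  have := ha j
  gcongr
  nlinarith [ht.1, ht.2]

/-- There are |κ| zeros against |ι| poles at t = 0, so the strict inequality of cardinalities leaves
at least one zero. This zero cancels the 1/t of the Lévy density. -/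
lemma isBigO_barnesRatio_zero {ι κ : Type*} [Fintype ι] [Fintype κ] {a : ι → ℝ} {b : κ → ℝ}
    (ha : ∀ j, 0 < a j) (hb : ∀ j, 0 < b j) (hcard : Fintype.card ι < Fintype.card κ) :
    barnesRatio a b =O[𝓝[>] 0] fun t : ℝ => t := by
  have h1 : (fun t : ℝ => ∏ j, (1 - Real.exp (-(b j) * t))) =O[𝓝[>] 0]
      fun t : ℝ => t ^ Fintype.card κ := by
    have : (fun t : ℝ => t ^ Fintype.card κ) = fun t : ℝ => ∏ _j : κ, t := by simp
    rw [this]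
    refine Asymptotics.IsBigO.finsetProd fun j _ => ?_
    refine Asymptotics.IsBigO.of_bound (b j) ?_
    filter_upwards [self_mem_nhdsWithin] with t ht
    have h0 : 0 < b j * t := mul_pos (hb j) ht
    have h1 : Real.exp (-(b j) * t) ≤ 1 := by rw [Real.exp_le_one_iff]; linarith
    have h2 := Real.add_one_le_exp (-(b j) * t)
    rw [Real.norm_of_nonneg (by linarith), Real.norm_of_nonneg (le_of_lt ht)]
    linarith
  refine ((isBigO_barnesKernel_zero ha).mul h1).trans ?_
  refine Asymptotics.IsBigO.of_bound 1 ?_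
  filter_upwards [Ioo_mem_nhdsGT (zero_lt_one' ℝ)] with t ht
  have e : t⁻¹ ^ Fintype.card ι * t ^ Fintype.card κ = t ^ (Fintype.card κ - Fintype.card ι) := by
    rw [inv_pow, pow_sub₀ _ ht.1.ne' hcard.le]; ring
  rw [e, norm_pow, Real.norm_of_nonneg ht.1.le, one_mul]
  exact pow_le_of_le_one ht.1.le ht.2.le (by omega)

lemma tendsto_barnesRatio_atTop {ι κ : Type*} [Fintype ι] [Fintype κ] {a : ι → ℝ} {b : κ → ℝ}
    (ha : ∀ j, 0 < a j) (hb : ∀ j, 0 < b j) : Tendsto (barnesRatio a b) atTop (𝓝 1) := by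
  have : Tendsto (fun t : ℝ => ∏ j, (1 - Real.exp (-(b j) * t))) atTop (𝓝 (∏ _j : κ, (1 - 0))) := by
    refine tendsto_finsetProd _ fun j _ => tendsto_const_nhds.sub ?_
    refine Real.tendsto_exp_atBot.comp ?_
    exact tendsto_id.const_mul_atTop_of_neg (by linarith [hb j])
  have h := (tendsto_barnesKernel_atTop ha).mul this
  simp only [sub_zero, Finset.prod_const_one, mul_one] at h
  exact h

lemma continuousOn_barnesRatio {ι κ : Type*} [Fintype ι] [Fintype κ] {a : ι → ℝ} (b : κ → ℝ)
    (ha : ∀ j, 0 < a j) : ContinuousOn (barnesRatio a b) (Ioi 0) :=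
  (continuousOn_barnesKernel ha).mul (by fun_prop)

lemma isBigO_exp_neg_mul_of_tendsto (w : ℂ) {f : ℝ → ℝ} (hf : Tendsto f atTop (𝓝 1)) :
    (fun t : ℝ => Complex.exp (-w * t) * (f t : ℂ)) =O[atTop] fun t : ℝ => Real.exp (-w.re * t) := by
  have h1 : (fun t : ℝ => Complex.exp (-w * t)) =O[atTop] fun t : ℝ => Real.exp (-w.re * t) := by
    refine Asymptotics.IsBigO.of_bound 1 (Eventually.of_forall fun t => ?_)
    rw [Complex.norm_exp, Real.norm_of_nonneg (Real.exp_pos _).le]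
    simp
  have h2 : (fun t : ℝ => (f t : ℂ)) =O[atTop] fun _ : ℝ => (1 : ℝ) :=
    ((Complex.continuous_ofReal.tendsto 1).comp hf).isBigO_one ℝ
  simpa only [mul_one] using h1.mul h2

lemma isBigO_exp_neg_mul_zero (w : ℂ) {f g : ℝ → ℝ} (hf : f =O[𝓝[>] 0] g) :
    (fun t : ℝ => Complex.exp (-w * t) * (f t : ℂ)) =O[𝓝[>] 0] g := by
  have h1 : (fun t : ℝ => Complex.exp (-w * t)) =O[𝓝[>] 0] fun _ => (1 : ℝ) := by
    have h : ContinuousAt (fun t : ℝ => Complex.exp (-w * t)) 0 := by fun_prop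
    exact (h.tendsto.isBigO_one ℝ).mono nhdsWithin_le_nhds
  have h2 : (fun t : ℝ => (f t : ℂ)) =O[𝓝[>] 0] g := by
    refine Asymptotics.IsBigO.trans (Asymptotics.IsBigO.of_bound 1 ?_) hf
    simp
  simpa only [one_mul] using h1.mul h2

lemma locallyIntegrableOn_exp_neg_mul (w : ℂ) {f : ℝ → ℝ} (hf : ContinuousOn f (Ioi 0)) :
    LocallyIntegrableOn (fun t : ℝ => Complex.exp (-w * t) * (f t : ℂ)) (Ioi 0) := by
  refine ContinuousOn.locallyIntegrableOn ?_ measurableSet_Ioi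
  exact ContinuousOn.mul (by fun_prop) (Complex.continuous_ofReal.comp_continuousOn hf)

lemma mellinConvergent_exp_mul_barnesKernel {ι : Type*} [Fintype ι] {a : ι → ℝ}
    (ha : ∀ j, 0 < a j) {w s : ℂ} (hw : 0 < w.re) (hs : (Fintype.card ι : ℝ) < s.re) :
    MellinConvergent (fun t : ℝ => Complex.exp (-w * t) * (barnesKernel a t : ℂ)) s := by
  refine mellinConvergent_of_isBigO_rpow_exp hw
    (locallyIntegrableOn_exp_neg_mul w (continuousOn_barnesKernel ha))
    (isBigO_exp_neg_mul_of_tendsto w (tendsto_barnesKernel_atTop ha)) ?_ hs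
  refine (isBigO_exp_neg_mul_zero w (isBigO_barnesKernel_zero ha)).congr' EventuallyEq.rfl ?_
  filter_upwards [self_mem_nhdsWithin] with t ht
  rw [Real.rpow_neg (le_of_lt ht), Real.rpow_natCast, inv_pow]

lemma mellin_barnesRatio {ι κ : Type*} [Fintype ι] [Fintype κ] {a : ι → ℝ} {b : κ → ℝ}
    (ha : ∀ j, 0 < a j) (hb : ∀ j, 0 < b j) (hcard : Fintype.card ι < Fintype.card κ)
    {w s : ℂ} (hw : 0 < w.re) (hs : -1 < s.re) :
    MellinConvergent (fun t : ℝ => Complex.exp (-w * t) * (barnesRatio a b t : ℂ)) s ∧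
    DifferentiableAt ℂ
      (mellin fun t : ℝ => Complex.exp (-w * t) * (barnesRatio a b t : ℂ)) s := by
  have h0 : (fun t : ℝ => Complex.exp (-w * t) * (barnesRatio a b t : ℂ)) =O[𝓝[>] 0]
      fun t : ℝ => t ^ (-(-1 : ℝ)) := by
    simpa using isBigO_exp_neg_mul_zero w (isBigO_barnesRatio_zero ha hb hcard)
  have h1 := isBigO_exp_neg_mul_of_tendsto w (tendsto_barnesRatio_atTop ha hb)
  have h2 := locallyIntegrableOn_exp_neg_mul w (continuousOn_barnesRatio b ha)
  exact ⟨mellinConvergent_of_isBigO_rpow_exp hw h2 h1 h0 hs,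
    mellin_differentiableAt_of_isBigO_rpow_exp hw h2 h1 h0 hs⟩

/-- Inclusion-exclusion: expanding ∏(1 - e^{-b_j t}) gives one term for each subset. -/
lemma sum_neg_one_pow_mul_exp {κ : Type*} [Fintype κ] (b : κ → ℝ) (v : ℂ) (t : ℝ) :
    ∑ S : Finset κ, (-1 : ℂ) ^ S.card * Complex.exp (-(v + ∑ j ∈ S, (b j : ℂ)) * t) =
      Complex.exp (-v * t) * ((∏ j, (1 - Real.exp (-(b j) * t)) : ℝ) : ℂ) := by
  classical
  push_cast
  have := Finset.prod_add (fun j => -Complex.exp (-(b j : ℂ) * t)) (fun _ => (1 : ℂ))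
    (Finset.univ : Finset κ)
  have e : ∏ j, (1 - Complex.exp (-(b j : ℂ) * t)) =
      ∏ j, (-Complex.exp (-(b j : ℂ) * t) + 1) :=
    Finset.prod_congr rfl fun j _ => by ring
  rw [e, this, Finset.mul_sum, Finset.powerset_univ]
  refine Finset.sum_congr rfl fun S _ => ?_
  rw [Finset.prod_const_one, mul_one, Finset.prod_neg, ← Complex.exp_sum, mul_left_comm,
    ← Complex.exp_add]
  congr 2
  rw [← Finset.sum_mul, Finset.sum_neg_distrib]
  ring

/-- From 1/Γ(s) = s/Γ(s+1). Since 1/Γ vanishes at 0 with slope 1, the derivative at 0 of m(s)/Γ(s)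
is m(0) when m is differentiable there. -/
lemma hasDerivAt_one_div_Gamma_zero : HasDerivAt (fun s : ℂ => (Complex.Gamma s)⁻¹) 1 0 := by
  have h1 : HasDerivAt (fun s : ℂ => s * (Complex.Gamma (s + 1))⁻¹)
      (1 * (Complex.Gamma (0 + 1))⁻¹ + 0 * deriv (fun s : ℂ => (Complex.Gamma (s + 1))⁻¹) 0) 0 := by
    refine (hasDerivAt_id (0 : ℂ)).mul (DifferentiableAt.hasDerivAt ?_)
    exact (Complex.differentiable_one_div_Gamma.comp (differentiable_id.add_const 1)) 0
  simp only [zero_add, Complex.Gamma_one, inv_one, mul_one, zero_mul, add_zero] at h1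
  exact h1.congr_of_eventuallyEq
    (Eventually.of_forall Complex.one_div_Gamma_eq_self_mul_one_div_Gamma_add_one)

/-- The alternating sum of Barnes log-gamma functions as an integral. -/
lemma barnesS_barnesLogGamma {ι κ : Type*} [Fintype ι] [Fintype κ] {a : ι → ℝ} {b : κ → ℝ}
    (ha : ∀ j, 0 < a j) (hb : ∀ j, 0 < b j) (hcard : Fintype.card ι < Fintype.card κ)
    (b₀ : ℝ) {q : ℂ} (hq : -b₀ < q.re) :
    barnesS (barnesLogGamma a) b₀ b q =
      ∫ t in Ioi (0 : ℝ), Complex.exp (-q * t) *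
        ((Real.exp (-b₀ * t) * barnesRatio a b t / t : ℝ) : ℂ) := by
  set M := Fintype.card ι with hM
  set w : Finset κ → ℂ := fun S => q + b₀ + ∑ j ∈ S, (b j : ℂ) with hw
  have hwre : ∀ S, 0 < (w S).re := by
    intro S
    have : 0 ≤ ∑ j ∈ S, b j := Finset.sum_nonneg fun j _ => (hb j).le
    simp only [hw, Complex.add_re, Complex.ofReal_re, Complex.re_sum]
    linarith
  have hv : 0 < (q + b₀).re := by simp; linarith
  set Z : Finset κ → ℂ → ℂ := fun S => Classical.epsilon (IsBarnesZetaContinuation a (w S))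
  have hZ : ∀ S, IsBarnesZetaContinuation a (w S) (Z S) := fun S =>
    isBarnesZetaContinuation_epsilon ha (hwre S)
  set R : ℝ → ℂ := fun t => Complex.exp (-(q + b₀) * t) * (barnesRatio a b t : ℂ) with hR
  set F : ℂ → ℂ := fun s => ∑ S : Finset κ, (-1) ^ S.card * Z S s with hF
  set K : ℂ → ℂ := fun s => (Complex.Gamma s)⁻¹ * mellin R s with hK
  have hFd : DifferentiableOn ℂ F (barnesDomain M) :=
    DifferentiableOn.fun_sum fun S _ => (hZ S).1.const_mul _
  have hKd : DifferentiableOn ℂ K (barnesDomain M) := fun s hs =>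
    ((Complex.differentiable_one_div_Gamma s).mul
      (mellin_barnesRatio ha hb hcard hv hs.1).2).differentiableWithinAt
  -- Only for Re s > M are the individual zeta functions convergent integrals. There the kernels
  -- combine into the ratio, whose Mellin transform already makes sense at s = 0.
  have hFK : ∀ s : ℂ, (M : ℝ) < s.re → F s = K s := by
    intro s hs
    have h1 : ∀ S, Z S s = (Complex.Gamma s)⁻¹ *
        mellin (fun t : ℝ => Complex.exp (-(w S) * t) * (barnesKernel a t : ℂ)) s := by
      intro S
      rw [(hZ S).2 s hs, barnesZetaIntegral, mellin]
      congr 1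
      refine setIntegral_congr_fun measurableSet_Ioi fun t _ => ?_
      simp only [smul_eq_mul, barnesKernel]
      ring
    simp only [hF, hK, h1]
    simp_rw [mul_left_comm _ (Complex.Gamma s)⁻¹]
    rw [← Finset.mul_sum]
    congr 1
    have h2 : ∀ S ∈ (Finset.univ : Finset (Finset κ)), IntegrableOn (fun t : ℝ => (-1 : ℂ) ^ S.card *
        ((t : ℂ) ^ (s - 1) • (Complex.exp (-(w S) * t) * (barnesKernel a t : ℂ)))) (Ioi 0) :=
      fun S _ => (mellinConvergent_exp_mul_barnesKernel ha (hwre S) hs).const_mul _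
    simp only [mellin]
    simp_rw [← integral_const_mul]
    rw [← integral_finsetSum _ h2]
    refine setIntegral_congr_fun measurableSet_Ioi fun t _ => ?_
    have h3 := sum_neg_one_pow_mul_exp b (q + b₀) t
    simp only [hR, smul_eq_mul, barnesRatio, Complex.ofReal_mul]
    rw [mul_comm (barnesKernel a t : ℂ), ← mul_assoc (Complex.exp _), ← h3, Finset.sum_mul,
      Finset.mul_sum]
    refine Finset.sum_congr rfl fun S _ => ?_
    simp only [hw]
    ring
  have hloc := eventuallyEq_zero_of_differentiableOn_barnesDomain hFd hKd hFK
  have hd : deriv F 0 = deriv K 0 := hloc.deriv_eq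
  have hdF : deriv F 0 = barnesS (barnesLogGamma a) b₀ b q := by
    simp only [hF]
    have hdiff : ∀ S, DifferentiableAt ℂ (Z S) 0 := fun S =>
      (hZ S).1.differentiableAt (barnesDomain_mem_nhds_zero M)
    rw [deriv_fun_sum fun S _ => (hdiff S).const_mul _]
    refine Finset.sum_congr rfl fun S _ => ?_
    rw [deriv_const_mul _ (hdiff S)]
    rfl
  have hdK : deriv K 0 = mellin R 0 := by
    have h1 := hasDerivAt_one_div_Gamma_zero.mul
      (mellin_barnesRatio ha hb hcard hv (s := 0) (by simp)).2.hasDerivAt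
    have h2 := h1.deriv
    simp only [Complex.Gamma_zero, inv_zero, zero_mul, add_zero, one_mul] at h2
    exact h2
  rw [← hdF, hd, hdK, mellin]
  refine setIntegral_congr_fun measurableSet_Ioi fun t _ => ?_
  simp only [hR, smul_eq_mul, zero_sub, Complex.cpow_neg_one]
  push_cast
  rw [show -(q + b₀) * (t : ℂ) = -q * t + -b₀ * t by ring, Complex.exp_add]
  ring

lemma integrableOn_exp_mul_barnesRatio {ι κ : Type*} [Fintype ι] [Fintype κ] {a : ι → ℝ}
    {b : κ → ℝ} (ha : ∀ j, 0 < a j) (hb : ∀ j, 0 < b j)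
    (hcard : Fintype.card ι < Fintype.card κ) (b₀ : ℝ) {q : ℂ} (hq : -b₀ < q.re) :
    IntegrableOn (fun t : ℝ => Complex.exp (-q * t) *
      ((Real.exp (-b₀ * t) * barnesRatio a b t / t : ℝ) : ℂ)) (Ioi 0) := by
  have hv : 0 < (q + b₀).re := by simp; linarith
  refine (mellin_barnesRatio ha hb hcard hv (s := 0) (by simp)).1.congr_fun (fun t _ => ?_)
    measurableSet_Ioi
  simp only [smul_eq_mul, zero_sub, Complex.cpow_neg_one]
  push_cast
  rw [show -(q + b₀) * (t : ℂ) = -q * t + -b₀ * t by ring, Complex.exp_add]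
  ring

lemma barnesRatio_nonneg {ι κ : Type*} [Fintype ι] [Fintype κ] {a : ι → ℝ} {b : κ → ℝ}
    (ha : ∀ j, 0 < a j) (hb : ∀ j, 0 < b j) {t : ℝ} (ht : 0 < t) : 0 ≤ barnesRatio a b t := by
  have h : ∀ x : ℝ, 0 < x → 0 ≤ 1 - Real.exp (-x * t) := by
    intro x hx
    have : Real.exp (-x * t) ≤ 1 := by
      rw [Real.exp_le_one_iff]; nlinarith [mul_pos hx ht]
    linarith
  exact mul_nonneg (Finset.prod_nonneg fun j _ => inv_nonneg.mpr (h _ (ha j)))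
    (Finset.prod_nonneg fun j _ => h _ (hb j))

/-! ### Existence and uniqueness of Barnes beta laws -/

/-- Since b_0 > 0, the exponents 0, 1, 2, … are all admissible, so the Mellin transform fixes every
moment of a law supported in [0, 1]. -/
lemma IsBarnesBeta.unique {ι κ : Type*} [Fintype ι] [Fintype κ] {a : ι → ℝ} {b₀ : ℝ} {b : κ → ℝ}
    (hb₀ : 0 < b₀) {μ ν : ProbabilityMeasure ℝ} (hμ : IsBarnesBeta a b₀ b μ)
    (hν : IsBarnesBeta a b₀ b ν) : μ = ν := by
  have hsub : (Icc (0 : ℝ) 1)ᶜ ⊆ (Ioc 0 1)ᶜ := compl_subset_compl.mpr Ioc_subset_Icc_self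
  refine eq_of_moments_eq (measure_mono_null hsub hμ.1) (measure_mono_null hsub hν.1) fun n => ?_
  have hn : -b₀ < ((n : ℂ)).re := by
    simp only [Complex.natCast_re]
    have : (0 : ℝ) ≤ n := n.cast_nonneg
    linarith
  have key : ∀ ρ : ProbabilityMeasure ℝ, IsBarnesBeta a b₀ b ρ →
      ((∫ x, x ^ n ∂(ρ : Measure ℝ) : ℝ) : ℂ) = barnesEta a b₀ b n := by
    intro ρ hρ
    rw [← (hρ.2 n hn).2, ← integral_complex_ofReal]
    simp
  have := (key μ hμ).trans (key ν hν).symm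
  exact_mod_cast this

/-- The Lévy measure of `-log β_{M,N}`. -/
noncomputable def barnesLevy {ι κ : Type*} [Fintype ι] [Fintype κ] (a : ι → ℝ) (b₀ : ℝ) (b : κ → ℝ) :
    Measure ℝ :=
  (volume.restrict (Ioi 0)).withDensity fun t =>
    ENNReal.ofReal (Real.exp (-b₀ * t) * barnesRatio a b t / t)

lemma measurable_barnesRatio {ι κ : Type*} [Fintype ι] [Fintype κ] (a : ι → ℝ) (b : κ → ℝ) :
    Measurable (barnesRatio a b) := by
  unfold barnesRatio barnesKernel
  fun_prop

lemma barnesLevy_exp {ι κ : Type*} [Fintype ι] [Fintype κ] {a : ι → ℝ} {b : κ → ℝ}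
    (ha : ∀ j, 0 < a j) (hb : ∀ j, 0 < b j) (hcard : Fintype.card ι < Fintype.card κ)
    (b₀ : ℝ) {q : ℂ} (hq : -b₀ < q.re) :
    Integrable (fun x : ℝ => Complex.exp (-q * x)) (barnesLevy a b₀ b) ∧
      ∫ x : ℝ, Complex.exp (-q * x) ∂(barnesLevy a b₀ b) =
        barnesS (barnesLogGamma a) b₀ b q := by
  have hm := measurable_barnesRatio a b
  have hmeas : Measurable fun t : ℝ => ENNReal.ofReal
      (Real.exp (-b₀ * t) * barnesRatio a b t / t) := by fun_prop
  have hnn : ∀ t ∈ Ioi (0 : ℝ), 0 ≤ Real.exp (-b₀ * t) * barnesRatio a b t / t := fun t ht =>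
    div_nonneg (mul_nonneg (Real.exp_pos _).le (barnesRatio_nonneg ha hb ht)) (le_of_lt ht)
  constructor
  · rw [barnesLevy, integrable_withDensity_iff_integrable_smul' hmeas
      (ae_of_all _ fun _ => ENNReal.ofReal_lt_top)]
    refine (integrableOn_exp_mul_barnesRatio ha hb hcard b₀ hq).congr_fun (fun t ht => ?_)
      measurableSet_Ioi
    simp only [ENNReal.toReal_ofReal (hnn t ht), Complex.real_smul]
    exact mul_comm _ _
  · rw [barnesS_barnesLogGamma ha hb hcard b₀ hq, barnesLevy,
      integral_withDensity_eq_integral_toReal_smul hmeas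
      (ae_of_all _ fun _ => ENNReal.ofReal_lt_top)]
    refine setIntegral_congr_fun measurableSet_Ioi fun t ht => ?_
    simp only [ENNReal.toReal_ofReal (hnn t ht), Complex.real_smul]
    exact mul_comm _ _

/-- This is integrability at q = 0, which is admissible because b_0 > 0. Finite mass makes -log β
compound Poisson, with no compensation of small jumps. -/
lemma isFiniteMeasure_barnesLevy {ι κ : Type*} [Fintype ι] [Fintype κ] {a : ι → ℝ} {b : κ → ℝ}
    (ha : ∀ j, 0 < a j) (hb : ∀ j, 0 < b j) (hcard : Fintype.card ι < Fintype.card κ)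
    {b₀ : ℝ} (hb₀ : 0 < b₀) : IsFiniteMeasure (barnesLevy a b₀ b) := by
  have := (barnesLevy_exp ha hb hcard b₀ (q := 0) (by simpa using hb₀)).1
  simpa [integrable_const_iff, isFiniteMeasure_iff] using this

/-- Take e^{-X} with X compound Poisson of intensity `barnesLevy`. The mass subtracted in its
exponent is S_N L_M(0), so the transform is η exactly. -/
lemma exists_isBarnesBeta {ι κ : Type*} [Fintype ι] [Fintype κ] {a : ι → ℝ} {b : κ → ℝ}
    (ha : ∀ j, 0 < a j) (hb : ∀ j, 0 < b j) (hcard : Fintype.card ι < Fintype.card κ)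
    {b₀ : ℝ} (hb₀ : 0 < b₀) : ∃ μ, IsBarnesBeta a b₀ b μ := by
  have hfin := isFiniteMeasure_barnesLevy ha hb hcard hb₀
  have hprob := isProbabilityMeasure_compoundPoisson (barnesLevy a b₀ b)
  have hneg : barnesLevy a b₀ b (Iio 0) = 0 := by
    refine (withDensity_absolutelyContinuous _ _) ?_
    rw [Measure.restrict_apply measurableSet_Iio]
    convert! measure_empty (μ := (volume : Measure ℝ))
    ext x; simp; intro h; exact h.le
  refine ⟨⟨(compoundPoisson (barnesLevy a b₀ b)).map fun x => Real.exp (-x),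
    Measure.isProbabilityMeasure_map (by fun_prop)⟩, ?_, fun q hq => ?_⟩
  · simp only [ProbabilityMeasure.coe_mk]
    rw [Measure.map_apply (by fun_prop) measurableSet_Ioc.compl]
    refine measure_mono_null ?_ (compoundPoisson_Iio_zero hneg)
    intro x hx
    by_contra hx'
    simp only [mem_Iio, not_lt] at hx'
    exact hx ⟨Real.exp_pos _, by simpa using hx'⟩
  · simp only [ProbabilityMeasure.coe_mk]
    have hmeas : Measurable fun x : ℝ => (x : ℂ) ^ q := by fun_prop
    have e : ∀ x : ℝ, ((Real.exp (-x) : ℝ) : ℂ) ^ q = Complex.exp (-q * x) := by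
      intro x
      rw [Complex.cpow_def_of_ne_zero (by exact_mod_cast (Real.exp_pos _).ne'),
        ← Complex.ofReal_log (Real.exp_pos _).le, Real.log_exp]
      push_cast
      ring_nf
    obtain ⟨h1, h2⟩ := compoundPoisson_exp (barnesLevy_exp ha hb hcard b₀ hq).1
    rw [integrable_map_measure hmeas.aestronglyMeasurable (by fun_prop),
      integral_map (by fun_prop) hmeas.aestronglyMeasurable]
    simp only [Function.comp_def, e]
    refine ⟨h1, ?_⟩
    rw [h2, (barnesLevy_exp ha hb hcard b₀ hq).2, barnesEta]
    congr 2
    rw [← (barnesLevy_exp ha hb hcard b₀ (q := 0) (by simpa using hb₀)).2]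
    simp

/-! ### The finite Jacobi triple product -/

/-- Gaussian binomial coefficients. -/
def gaussBinom (q : ℝ) : ℕ → ℕ → ℝ
  | _, 0 => 1
  | 0, _ + 1 => 0
  | n + 1, k + 1 => gaussBinom q n k + q ^ (k + 1) * gaussBinom q n (k + 1)

/-- The finite `q`-Pochhammer symbol `(q; q)_n`. -/
def qPoch (q : ℝ) (n : ℕ) : ℝ := ∏ i ∈ Finset.range n, (1 - q ^ (i + 1))

lemma gaussBinom_zero_right (q : ℝ) (n : ℕ) : gaussBinom q n 0 = 1 := by
  cases n <;> rfl

lemma gaussBinom_of_lt (q : ℝ) {n k : ℕ} (h : n < k) : gaussBinom q n k = 0 := by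
  induction n generalizing k with
  | zero => obtain ⟨k, rfl⟩ := Nat.exists_eq_succ_of_ne_zero h.ne'; rfl
  | succ n ih =>
    obtain ⟨k, rfl⟩ := Nat.exists_eq_succ_of_ne_zero (by omega : k ≠ 0)
    rw [Nat.succ_eq_add_one, gaussBinom, ih (by omega), ih (by omega)]
    simp

/-- The q-analogue of binom(n+j, n) n! j! = (n+j)!, free of division and hence valid for every q.
The induction combines the Pascal recursion with 1 - q^{n+j+2} = (1 - q^{n+1}) + q^{n+1}(1 -
q^{j+1}). -/
lemma gaussBinom_mul_qPoch (q : ℝ) (n j : ℕ) :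
    gaussBinom q (n + j) n * qPoch q n * qPoch q j = qPoch q (n + j) := by
  suffices h : ∀ N n j, n + j = N →
      gaussBinom q N n * qPoch q n * qPoch q j = qPoch q N from h _ n j rfl
  intro N
  induction N with
  | zero =>
    intro n j h
    obtain ⟨rfl, rfl⟩ : n = 0 ∧ j = 0 := by omega
    simp [gaussBinom, qPoch]
  | succ N ih =>
    intro n j h
    rcases n with _ | n
    · obtain rfl : j = N + 1 := by omega
      simp [gaussBinom, qPoch]
    have e1 : qPoch q (n + 1) = qPoch q n * (1 - q ^ (n + 1)) := Finset.prod_range_succ _ _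
    have e3 : qPoch q (N + 1) = qPoch q N * (1 - q ^ (N + 1)) := Finset.prod_range_succ _ _
    have h1 := ih n j (by omega)
    rcases j with _ | j
    · obtain rfl : n = N := by omega
      rw [gaussBinom, gaussBinom_of_lt q (Nat.lt_succ_self n), e3]
      linear_combination (1 - q ^ (n + 1)) * h1
    · have e2 : qPoch q (j + 1) = qPoch q j * (1 - q ^ (j + 1)) := Finset.prod_range_succ _ _
      have h2 := ih (n + 1) j (by omega)
      have e4 : q ^ (N + 1) = q ^ (n + 1) * q ^ (j + 1) := by rw [← pow_add]; congr 1; omega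
      rw [e1] at h2 ⊢
      rw [gaussBinom, e3, e4]
      rw [e2] at h1 ⊢
      linear_combination (1 - q ^ (n + 1)) * h1 + q ^ (n + 1) * (1 - q ^ (j + 1)) * h2

/-- The `q`-binomial theorem. -/
lemma prod_one_add_mul_pow (q z : ℝ) (N : ℕ) :
    ∏ i ∈ Finset.range N, (1 + z * q ^ i) =
      ∑ k ∈ Finset.range (N + 1), q ^ (k.choose 2) * gaussBinom q N k * z ^ k := by
  induction N generalizing z with
  | zero => simp [gaussBinom]
  | succ N ih =>
    rw [Finset.prod_range_succ']
    have e : ∀ i, z * q ^ (i + 1) = (z * q) * q ^ i := fun i => by ring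
    simp_rw [e]
    rw [ih, Finset.sum_range_succ' _ (N + 1)]
    have hterm : ∀ k, q ^ ((k + 1).choose 2) * gaussBinom q (N + 1) (k + 1) * z ^ (k + 1) =
        z * (q ^ (k.choose 2) * gaussBinom q N k * (z * q) ^ k) +
        q ^ ((k + 1).choose 2) * gaussBinom q N (k + 1) * (z * q) ^ (k + 1) := by
      intro k
      rw [gaussBinom, show (k + 1).choose 2 = k + k.choose 2 by
        rw [Nat.choose_succ_succ' k 1]; simp]
      ring
    simp_rw [hterm]
    rw [Finset.sum_add_distrib, ← Finset.mul_sum]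
    have h2 := Finset.sum_range_succ' (fun k => q ^ (k.choose 2) * gaussBinom q N k * (z * q) ^ k)
      (N + 1)
    rw [Finset.sum_range_succ, gaussBinom_of_lt q (Nat.lt_succ_self N)] at h2
    simp only [gaussBinom_zero_right, pow_zero, mul_one, Nat.choose_zero_succ] at h2 ⊢
    linear_combination h2

/-- The coefficients `(q)_M (q)_{2M} / ((q)_{M+j} (q)_{M-j})` of the finite triple product. -/
noncomputable def jacobiCoeff (q : ℝ) (M j : ℕ) : ℝ :=
  if j ≤ M then qPoch q M * qPoch q (2 * M) / (qPoch q (M + j) * qPoch q (M - j)) else 0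

lemma qPoch_pos {q : ℝ} (h0 : 0 ≤ q) (h1 : q < 1) (n : ℕ) : 0 < qPoch q n :=
  Finset.prod_pos fun i _ => sub_pos.mpr (pow_lt_one₀ h0 h1 (Nat.succ_ne_zero i))

lemma qPoch_antitone {q : ℝ} (h0 : 0 ≤ q) (h1 : q < 1) : Antitone (qPoch q) := by
  refine antitone_nat_of_succ_le fun n => ?_
  rw [qPoch, Finset.prod_range_succ]
  have := qPoch_pos h0 h1 n
  have h2 : 0 ≤ q ^ (n + 1) := by positivity
  exact mul_le_of_le_one_right this.le (by linarith)

lemma jacobiCoeff_nonneg {q : ℝ} (h0 : 0 ≤ q) (h1 : q < 1) (M j : ℕ) : 0 ≤ jacobiCoeff q M j := by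
  unfold jacobiCoeff
  split_ifs
  · have := qPoch_pos h0 h1
    have h1 := this M
    have h2 := this (2 * M)
    have h3 := this (M + j)
    have h4 := this (M - j)
    positivity
  · exact le_rfl

/-- Since (q)_n decreases in n, (q)_M ≤ (q)_{M-j} and (q)_{2M} ≤ (q)_{M+j}. This bound is uniform in
M and dominates the finite sums by θ. -/
lemma jacobiCoeff_le_one {q : ℝ} (h0 : 0 ≤ q) (h1 : q < 1) (M j : ℕ) : jacobiCoeff q M j ≤ 1 := by
  unfold jacobiCoeff
  split_ifs with h
  · have := qPoch_pos h0 h1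
    have h3 := this (M + j)
    have h4 := this (M - j)
    rw [div_le_one (by positivity), mul_comm (qPoch q (M + j))]
    exact mul_le_mul (qPoch_antitone h0 h1 (Nat.sub_le M j))
      (qPoch_antitone h0 h1 (by omega)) (this _).le h4.le
  · exact zero_le_one

lemma tendsto_qPoch {q : ℝ} (h0 : 0 ≤ q) (h1 : q < 1) :
    ∃ L : ℝ, L ≠ 0 ∧ Tendsto (qPoch q) atTop (𝓝 L) := by
  have hs : Summable fun i : ℕ => ‖-q ^ (i + 1)‖ := by
    simp_rw [norm_neg, norm_pow, Real.norm_of_nonneg h0]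
    exact (summable_geometric_of_lt_one h0 h1).comp_injective (add_left_injective 1)
  refine ⟨∏' i : ℕ, (1 + -q ^ (i + 1)), tprod_one_add_ne_zero_of_summable (fun i => ?_) hs, ?_⟩
  · have := pow_lt_one₀ h0 h1 (Nat.succ_ne_zero i)
    simp only [Nat.succ_eq_add_one] at this
    linarith
  · have := (multipliable_one_add_of_summable hs).hasProd.tendsto_prod_nat
    simpa only [qPoch, sub_eq_add_neg] using! this

/-- For fixed j, all four Pochhammer symbols tend to the same nonzero limit (q)_∞. -/
lemma tendsto_jacobiCoeff {q : ℝ} (h0 : 0 ≤ q) (h1 : q < 1) (j : ℕ) :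
    Tendsto (fun M => jacobiCoeff q M j) atTop (𝓝 1) := by
  obtain ⟨L, hL, ht⟩ := tendsto_qPoch h0 h1
  have h2 : Tendsto (fun M => qPoch q M * qPoch q (2 * M) / (qPoch q (M + j) * qPoch q (M - j)))
      atTop (𝓝 (L * L / (L * L))) := by
    refine (ht.mul (ht.comp ?_)).div ((ht.comp (tendsto_add_atTop_nat j)).mul
      (ht.comp (tendsto_sub_atTop_nat j))) (mul_ne_zero hL hL)
    exact tendsto_id.const_mul_atTop' (by norm_num)
  rw [div_self (mul_ne_zero hL hL)] at h2
  refine h2.congr' ?_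
  filter_upwards [eventually_ge_atTop j] with M hM
  rw [jacobiCoeff, if_pos hM]

lemma prod_pow_odd (x : ℝ) (M : ℕ) : ∏ i ∈ Finset.range M, x ^ (2 * i + 1) = x ^ (M ^ 2) := by
  induction M with
  | zero => simp
  | succ M ih => rw [Finset.prod_range_succ, ih, ← pow_add]; congr 1; ring

/-- The finite Jacobi triple product. -/
lemma finite_triple_product {x : ℝ} (h0 : 0 < x) (h1 : x < 1) (M : ℕ) :
    (∏ i ∈ Finset.range M, (1 + x ^ (2 * i + 1)) ^ 2) * qPoch (x ^ 2) M =
      jacobiCoeff (x ^ 2) M 0 +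
        2 * ∑ j ∈ Finset.range M, jacobiCoeff (x ^ 2) M (j + 1) * x ^ ((j + 1) ^ 2) := by
  have hq0 : 0 ≤ x ^ 2 := by positivity
  have hq1 : x ^ 2 < 1 := by nlinarith
  have hx : x ≠ 0 := h0.ne'
  -- With z = x^{1-2M} and base x², the 2M factors of the q-binomial product have the odd exponents
  -- 1-2M, …, 2M-1. The prefactor x^{M²} = ∏ x^{2i+1} turns the factors with negative exponents into
  -- a second copy of those with positive ones.
  set z : ℝ := x / x ^ (2 * M) with hz
  have hprod : x ^ (M ^ 2) * ∏ i ∈ Finset.range (2 * M), (1 + z * (x ^ 2) ^ i) =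
      ∏ i ∈ Finset.range M, (1 + x ^ (2 * i + 1)) ^ 2 := by
    rw [two_mul M, Finset.prod_range_add, ← Finset.prod_range_reflect, ← prod_pow_odd, ← mul_assoc,
      ← Finset.prod_mul_distrib, ← Finset.prod_mul_distrib]
    refine Finset.prod_congr rfl fun i hi => ?_
    rw [Finset.mem_range] at hi
    have e1 : z * (x ^ 2) ^ (M + i) = x ^ (2 * i + 1) := by
      rw [hz, ← pow_mul, mul_add, pow_add]; field_simp; ring
    have e2 : x ^ (2 * i + 1) * (z * (x ^ 2) ^ (M - 1 - i)) = 1 := by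
      rw [hz, ← pow_mul]
      have : x ^ (2 * M) = x ^ (2 * i + 1) * x * x ^ (2 * (M - 1 - i)) := by
        rw [← pow_succ, ← pow_add]; congr 1; omega
      rw [this]; field_simp
    rw [e1]
    linear_combination (1 + x ^ (2 * i + 1)) * e2
  -- The total exponent is M² + k² - 2Mk = (M-k)² = j². The indices k = M ± j give equal terms,
  -- whence the factor 2 in front of the sum.
  have hcoef : ∀ k j : ℕ, k ≤ 2 * M → (k + j = M ∨ k = M + j) →
      x ^ (M ^ 2) * ((x ^ 2) ^ (k.choose 2) * gaussBinom (x ^ 2) (2 * M) k * z ^ k) *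
        qPoch (x ^ 2) M = jacobiCoeff (x ^ 2) M j * x ^ (j ^ 2) := by
    intro k j hk hkj
    have hj : j ≤ M := by omega
    have hp := qPoch_pos hq0 hq1
    have hg := gaussBinom_mul_qPoch (x ^ 2) k (2 * M - k)
    rw [show k + (2 * M - k) = 2 * M by omega] at hg
    have hsym : qPoch (x ^ 2) k * qPoch (x ^ 2) (2 * M - k) =
        qPoch (x ^ 2) (M + j) * qPoch (x ^ 2) (M - j) := by
      rcases hkj with h | h
      · rw [show 2 * M - k = M + j by omega, show k = M - j by omega, mul_comm]
      · rw [show 2 * M - k = M - j by omega, h]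
    have hpow : x ^ (M ^ 2) * ((x ^ 2) ^ (k.choose 2) * z ^ k) = x ^ (j ^ 2) := by
      rw [hz, div_pow, ← pow_mul, ← pow_mul]
      have hne : x ^ (2 * M * k) ≠ 0 := pow_ne_zero _ hx
      have h2 : 2 * k.choose 2 + k = k ^ 2 := by
        rw [Nat.choose_two_right]
        have : 2 ∣ k * (k - 1) := even_iff_two_dvd.mp (Nat.even_mul_pred_self k)
        rw [Nat.mul_div_cancel' this]
        rcases k with _ | k
        · simp
        · simp; ring
      have h3 : M ^ 2 + k ^ 2 = j ^ 2 + 2 * M * k := by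
        rcases hkj with h | h
        · subst h; ring
        · subst h; ring
      field_simp
      rw [← pow_add, ← pow_add, ← pow_add]
      congr 1
      omega
    rw [jacobiCoeff, if_pos hj, ← hsym, ← hpow, ← hg]
    have := (hp k).ne'
    have := (hp (2 * M - k)).ne'
    field_simp
  rw [← hprod, prod_one_add_mul_pow, Finset.mul_sum, Finset.sum_mul,
    show 2 * M + 1 = M + (M + 1) by ring, Finset.sum_range_add, Finset.sum_range_succ',
    ← Finset.sum_range_reflect]
  have hA : ∑ j ∈ Finset.range M, x ^ (M ^ 2) * ((x ^ 2) ^ ((M - 1 - j).choose 2) *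
      gaussBinom (x ^ 2) (2 * M) (M - 1 - j) * z ^ (M - 1 - j)) * qPoch (x ^ 2) M =
      ∑ j ∈ Finset.range M, jacobiCoeff (x ^ 2) M (j + 1) * x ^ ((j + 1) ^ 2) := by
    refine Finset.sum_congr rfl fun j hj => ?_
    rw [Finset.mem_range] at hj
    exact hcoef _ (j + 1) (by omega) (Or.inl (by omega))
  have hB : ∑ j ∈ Finset.range M, x ^ (M ^ 2) * ((x ^ 2) ^ ((M + (j + 1)).choose 2) *
      gaussBinom (x ^ 2) (2 * M) (M + (j + 1)) * z ^ (M + (j + 1))) * qPoch (x ^ 2) M =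
      ∑ j ∈ Finset.range M, jacobiCoeff (x ^ 2) M (j + 1) * x ^ ((j + 1) ^ 2) := by
    refine Finset.sum_congr rfl fun j hj => ?_
    rw [Finset.mem_range] at hj
    exact hcoef _ (j + 1) (by omega) (Or.inr rfl)
  rw [hA, hB, hcoef (M + 0) 0 (by omega) (Or.inr rfl)]
  simp
  ring

/-! ### The parameters of `β_M(δ)` and the theta function -/

lemma aParam_pos (M : ℕ) (p : Fin 2 × Fin M) : 0 < aParam M p := by
  unfold aParam
  have : (0 : ℝ) ≤ (p.2 : ℕ) := Nat.cast_nonneg _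
  have h : (0 : ℝ) < 2 * ((p.2 : ℕ) + 1) - 1 := by linarith
  positivity

lemma bParam_pos (M : ℕ) (p : Fin 3 × Fin M) : 0 < bParam M p := by
  unfold bParam
  have : (0 : ℝ) ≤ (p.2 : ℕ) := Nat.cast_nonneg _
  have h : (0 : ℝ) < 4 * ((p.2 : ℕ) + 1) - 2 := by linarith
  split_ifs <;> positivity

lemma card_param_lt {M : ℕ} (hM : 1 ≤ M) :
    Fintype.card (Fin 2 × Fin M) < Fintype.card (Fin 3 × Fin M) := by
  simp; omega

/-- The variable `x = e^{-π² t / 2}` of the theta function. -/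
noncomputable def thetaVar (t : ℝ) : ℝ := Real.exp (-(Real.pi ^ 2 / 2 * t))

lemma thetaVar_pos (t : ℝ) : 0 < thetaVar t := Real.exp_pos _

lemma thetaVar_lt_one {t : ℝ} (ht : 0 < t) : thetaVar t < 1 := by
  rw [thetaVar, Real.exp_lt_one_iff]
  have : 0 < Real.pi ^ 2 / 2 * t := by positivity
  linarith

lemma thetaVar_pow (t : ℝ) (n : ℕ) : thetaVar t ^ n = Real.exp (-(n * (Real.pi ^ 2 / 2 * t))) := by
  rw [thetaVar, ← Real.exp_nat_mul]; ring_nf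

lemma thetaJ_eq (t : ℝ) :
    thetaJ (Real.pi * t / 2) = 1 + 2 * ∑' n : ℕ, thetaVar t ^ ((n + 1) ^ 2) := by
  rw [thetaJ]
  congr 3
  ext n
  rw [thetaVar_pow]
  push_cast
  ring_nf

lemma summable_thetaVar {t : ℝ} (ht : 0 < t) : Summable fun n : ℕ => thetaVar t ^ ((n + 1) ^ 2) := by
  refine Summable.of_nonneg_of_le (fun n => pow_nonneg (thetaVar_pos t).le _) (fun n => ?_)
    (summable_geometric_of_lt_one (thetaVar_pos t).le (thetaVar_lt_one ht))
  exact pow_le_pow_of_le_one (thetaVar_pos t).le (thetaVar_lt_one ht).le (by nlinarith)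

/-- For k = 1, 2 each pair of a and b factors gives (1 - x^{2(2i+1)})/(1 - x^{2i+1}) = 1 + x^{2i+1},
with i counted from 0. The third family of b's supplies (x²; x²)_M. -/
lemma barnesRatio_param (M : ℕ) {t : ℝ} (ht : 0 < t) :
    barnesRatio (aParam M) (bParam M) t =
      (∏ i ∈ Finset.range M, (1 + thetaVar t ^ (2 * i + 1)) ^ 2) * qPoch (thetaVar t ^ 2) M := by
  have ha : ∀ (k : Fin 2) (i : Fin M), Real.exp (-(aParam M (k, i)) * t) =
      thetaVar t ^ (2 * (i : ℕ) + 1) := by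
    intro k i
    rw [thetaVar_pow, aParam]
    push_cast
    ring_nf
  have hb : ∀ (i : Fin M), Real.exp (-(bParam M (2, i)) * t) =
      (thetaVar t ^ 2) ^ ((i : ℕ) + 1) := by
    intro i
    rw [← pow_mul, thetaVar_pow, bParam, if_pos rfl]
    push_cast
    ring_nf
  have hb' : ∀ (k : Fin 3) (i : Fin M), k ≠ 2 → Real.exp (-(bParam M (k, i)) * t) =
      (thetaVar t ^ (2 * (i : ℕ) + 1)) ^ 2 := by
    intro k i hk
    rw [← pow_mul, thetaVar_pow, bParam, if_neg hk]
    push_cast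
    ring_nf
  rw [barnesRatio, barnesKernel, Fintype.prod_prod_type, Fintype.prod_prod_type, Fin.prod_univ_two,
    Fin.prod_univ_three, qPoch, Finset.prod_range, Finset.prod_range]
  simp_rw [ha, hb, hb' 0 _ (by decide), hb' 1 _ (by decide)]
  simp_rw [← Finset.prod_mul_distrib]
  refine Finset.prod_congr rfl fun i _ => ?_
  have h1 : thetaVar t ^ (2 * (i : ℕ) + 1) < 1 :=
    pow_lt_one₀ (thetaVar_pos t).le (thetaVar_lt_one ht) (by omega)
  have h2 : 1 - thetaVar t ^ (2 * (i : ℕ) + 1) ≠ 0 := by linarith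
  field_simp
  ring

lemma barnesRatio_param_eq_tsum (M : ℕ) {t : ℝ} (ht : 0 < t) :
    barnesRatio (aParam M) (bParam M) t = jacobiCoeff (thetaVar t ^ 2) M 0 +
      2 * ∑' j : ℕ, jacobiCoeff (thetaVar t ^ 2) M (j + 1) * thetaVar t ^ ((j + 1) ^ 2) := by
  rw [barnesRatio_param M ht, finite_triple_product (thetaVar_pos t) (thetaVar_lt_one ht),
    tsum_eq_sum (s := Finset.range M)]
  intro j hj
  rw [Finset.mem_range, not_lt] at hj
  rw [jacobiCoeff, if_neg (by omega), zero_mul]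

lemma barnesRatio_param_le_thetaJ (M : ℕ) {t : ℝ} (ht : 0 < t) :
    barnesRatio (aParam M) (bParam M) t ≤ thetaJ (Real.pi * t / 2) := by
  have hx0 := thetaVar_pos t
  have hx1 := thetaVar_lt_one ht
  have hq0 : 0 ≤ thetaVar t ^ 2 := by positivity
  have hq1 : thetaVar t ^ 2 < 1 := by nlinarith
  have hle : ∀ j, jacobiCoeff (thetaVar t ^ 2) M (j + 1) * thetaVar t ^ ((j + 1) ^ 2) ≤
      thetaVar t ^ ((j + 1) ^ 2) := fun j =>
    mul_le_of_le_one_left (by positivity) (jacobiCoeff_le_one hq0 hq1 _ _)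
  rw [barnesRatio_param_eq_tsum M ht, thetaJ_eq]
  refine add_le_add (jacobiCoeff_le_one hq0 hq1 _ _)
    (mul_le_mul_of_nonneg_left ?_ zero_le_two)
  refine Summable.tsum_le_tsum hle (Summable.of_nonneg_of_le (fun j => ?_) hle (summable_thetaVar ht))
    (summable_thetaVar ht)
  exact mul_nonneg (jacobiCoeff_nonneg hq0 hq1 _ _) (by positivity)

lemma tendsto_barnesRatio_param {t : ℝ} (ht : 0 < t) :
    Tendsto (fun M => barnesRatio (aParam M) (bParam M) t) atTop
      (𝓝 (thetaJ (Real.pi * t / 2))) := by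
  have hx0 := thetaVar_pos t
  have hx1 := thetaVar_lt_one ht
  have hq0 : 0 ≤ thetaVar t ^ 2 := by positivity
  have hq1 : thetaVar t ^ 2 < 1 := by nlinarith
  simp_rw [barnesRatio_param_eq_tsum _ ht]
  rw [thetaJ_eq]
  refine (tendsto_jacobiCoeff hq0 hq1 0).add (Tendsto.const_mul 2 ?_)
  refine tendsto_tsum_of_dominated_convergence (summable_thetaVar ht) (fun j => ?_)
    (Eventually.of_forall fun M j => ?_)
  · simpa using (tendsto_jacobiCoeff hq0 hq1 (j + 1)).mul_const (thetaVar t ^ ((j + 1) ^ 2))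
  · rw [norm_mul, Real.norm_of_nonneg (jacobiCoeff_nonneg hq0 hq1 _ _),
      Real.norm_of_nonneg (by positivity)]
    exact mul_le_of_le_one_left (by positivity) (jacobiCoeff_le_one hq0 hq1 _ _)

lemma existsUnique_isBetaM {M : ℕ} (hM : 1 ≤ M) {δ : ℝ} (hδ : 0 < δ) :
    ∃! μ : ProbabilityMeasure ℝ, IsBetaM M δ μ := by
  obtain ⟨μ, hμ⟩ := exists_isBarnesBeta (aParam_pos M) (bParam_pos M) (card_param_lt hM) hδ
  exact ⟨μ, hμ, fun ν hν => IsBarnesBeta.unique hδ hν hμ⟩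

/-! ### Integration of series and the identity theorem -/

lemma integrable_tsum_of_summable_integral_norm {α : Type*} [MeasurableSpace α] {μ : Measure α}
    {F : ℕ → α → ℝ} (hF : ∀ i, Integrable (F i) μ)
    (hsum : Summable fun i => ∫ a, ‖F i a‖ ∂μ) : Integrable (fun a => ∑' i, F i a) μ := by
  have h1 : ∫⁻ a, ∑' i, ‖F i a‖ₑ ∂μ < ⊤ := by
    rw [lintegral_tsum fun i => (hF i).1.enorm]
    have : ∀ i, ∫⁻ a, ‖F i a‖ₑ ∂μ = ENNReal.ofReal (∫ a, ‖F i a‖ ∂μ) := fun i =>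
      (ofReal_integral_norm_eq_lintegral_enorm (hF i)).symm
    simp_rw [this]
    exact hsum.tsum_ofReal_lt_top
  have h2 : ∀ᵐ a ∂μ, Summable fun i => F i a := by
    filter_upwards [ae_lt_top' (AEMeasurable.tsum fun i => (hF i).1.enorm) h1.ne] with a ha
    refine Summable.of_norm ?_
    have h3 : Summable fun i => ‖F i a‖₊ := ENNReal.tsum_coe_ne_top_iff_summable.mp ha.ne
    exact NNReal.summable_coe.mpr h3
  refine ⟨aestronglyMeasurable_of_tendsto_ae atTop
    (f := fun n a => ∑ i ∈ Finset.range n, F i a)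
    (fun n => Finset.aestronglyMeasurable_fun_sum _ fun i _ => (hF i).1) ?_, ?_⟩
  · filter_upwards [h2] with a ha using ha.hasSum.tendsto_sum_nat
  · exact lt_of_le_of_lt (lintegral_mono fun a => enorm_tsum_le_tsum_enorm) h1

/-- Identity theorem from agreement on a real interval `(x₀, x₀ + ε)`. -/
lemma eqOn_of_eventually_eq_ofReal {f g : ℂ → ℂ} {U : Set ℂ} (hU : IsOpen U)
    (hUc : IsPreconnected U) (hf : DifferentiableOn ℂ f U) (hg : DifferentiableOn ℂ g U) {x₀ : ℝ}
    (hx₀ : (x₀ : ℂ) ∈ U) (h : ∀ᶠ x : ℝ in 𝓝[>] x₀, f x = g x) : EqOn f g U := by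
  refine (hf.analyticOnNhd hU).eqOn_of_preconnected_of_frequently_eq (hg.analyticOnNhd hU) hUc hx₀ ?_
  have ht : Tendsto (fun x : ℝ => (x : ℂ)) (𝓝[>] x₀) (𝓝[≠] (x₀ : ℂ)) := by
    refine tendsto_nhdsWithin_iff.mpr ⟨(Complex.continuous_ofReal.tendsto x₀).mono_left
      nhdsWithin_le_nhds, ?_⟩
    filter_upwards [self_mem_nhdsWithin] with x hx
    simpa using (ne_of_gt hx)
  exact ht.frequently h.frequently

/-! ### Gamma laws -/

lemma measurable_gammaPDF (a r : ℝ) : Measurable (gammaPDF a r) :=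
  (measurable_gammaPDFReal a r).ennreal_ofReal

lemma lintegral_exp_gammaMeasure {r t : ℝ} (hr : 0 < r) (ht : t < 1) :
    ∫⁻ x, ENNReal.ofReal (Real.exp (t * x)) ∂(gammaMeasure r 1) =
      ENNReal.ofReal ((1 - t) ^ (-r)) := by
  have h1t : 0 < 1 - t := by linarith
  have hm := measurable_gammaPDF r 1
  rw [gammaMeasure, lintegral_withDensity_eq_lintegral_mul _ hm (by fun_prop)]
  have : ∀ x, (gammaPDF r 1 * fun x => ENNReal.ofReal (Real.exp (t * x))) x =
      ENNReal.ofReal ((1 - t) ^ (-r)) * gammaPDF r (1 - t) x := by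
    intro x
    simp only [Pi.mul_apply]
    rcases lt_or_ge x 0 with hx | hx
    · simp [gammaPDF_of_neg hx]
    · rw [gammaPDF_of_nonneg hx, gammaPDF_of_nonneg hx, ← ENNReal.ofReal_mul' (Real.exp_pos _).le,
        ← ENNReal.ofReal_mul (by positivity)]
      congr 1
      rw [Real.rpow_neg h1t.le, Real.one_rpow]
      have : (1 - t) ^ r ≠ 0 := (Real.rpow_pos_of_pos h1t r).ne'
      have hG : Real.Gamma r ≠ 0 := (Real.Gamma_pos_of_pos hr).ne'
      have e : Real.exp (-((1 - t) * x)) = Real.exp (-(1 * x)) * Real.exp (t * x) := by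
        rw [← Real.exp_add]; ring_nf
      rw [e]
      field_simp
  simp_rw [this]
  rw [lintegral_const_mul _ (measurable_gammaPDF r _),
    lintegral_gammaPDF_eq_one hr h1t, mul_one]

lemma gammaMeasure_Iic_zero (r : ℝ) : gammaMeasure r 1 (Iic 0) = 0 := by
  rw [gammaMeasure, withDensity_apply _ measurableSet_Iic, setLIntegral_congr Iio_ae_eq_Iic.symm]
  exact lintegral_gammaPDF_of_nonpos le_rfl

lemma integrable_exp_gammaMeasure {r t : ℝ} (hr : 0 < r) (ht : t < 1) :
    Integrable (fun x => Real.exp (t * x)) (gammaMeasure r 1) := by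
  refine ⟨by fun_prop, ?_⟩
  rw [hasFiniteIntegral_iff_ofReal (ae_of_all _ fun _ => (Real.exp_pos _).le),
    lintegral_exp_gammaMeasure hr ht]
  exact ENNReal.ofReal_lt_top

lemma integral_exp_gammaMeasure {r t : ℝ} (hr : 0 < r) (ht : t < 1) :
    ∫ x, Real.exp (t * x) ∂(gammaMeasure r 1) = (1 - t) ^ (-r) := by
  rw [integral_eq_lintegral_of_nonneg_ae (ae_of_all _ fun _ => (Real.exp_pos _).le) (by fun_prop),
    lintegral_exp_gammaMeasure hr ht, ENNReal.toReal_ofReal]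
  exact Real.rpow_nonneg (by linarith) _

/-- Both sides are holomorphic on Re z < 1 and agree for real z in (0, 1). -/
lemma complexMGF_gammaMeasure {r : ℝ} (hr : 0 < r) {z : ℂ} (hz : z.re < 1) :
    complexMGF id (gammaMeasure r 1) z = (1 - z) ^ (-r : ℂ) := by
  set U : Set ℂ := {z : ℂ | z.re < 1} with hU
  have hopen : IsOpen U := isOpen_lt Complex.continuous_re continuous_const
  have hsub : Iio (1 : ℝ) ⊆ interior (integrableExpSet id (gammaMeasure r 1)) :=
    interior_maximal (fun t ht => integrable_exp_gammaMeasure hr ht) isOpen_Iio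
  refine eqOn_of_eventually_eq_ofReal hopen (convex_halfSpace_re_lt 1).isPreconnected
    (f := complexMGF id (gammaMeasure r 1)) (g := fun z => (1 - z) ^ (-r : ℂ))
    (x₀ := 0) ?_ ?_ (by simp [hU]) ?_ hz
  · exact differentiableOn_complexMGF.mono fun z hz => hsub hz
  · refine DifferentiableOn.cpow_const (by fun_prop) fun z hz => Or.inl ?_
    have : z.re < 1 := hz
    simpa using this
  · filter_upwards [Ioo_mem_nhdsGT (zero_lt_one' ℝ)] with x hx
    rw [complexMGF_ofReal, mgf]
    simp only [id]
    rw [integral_exp_gammaMeasure hr hx.2, Complex.ofReal_cpow (by linarith [hx.2])]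
    push_cast
    rfl

/-! ### The law `β_{0,0}(δ)` -/

/-- With no parameters a, the integral is the gamma integral ∫ t^{s-1} e^{-wt} dt at complex rate w,
that is, the complex moment generating function of a gamma law at 1 - w. -/
lemma barnesZetaIntegral_elim0 {s : ℝ} (hs : 0 < s) {w : ℂ} (hw : 0 < w.re) :
    barnesZetaIntegral (Fin.elim0 : Fin 0 → ℝ) s w = w ^ (-s : ℂ) := by
  have h := complexMGF_gammaMeasure hs (z := 1 - w) (by simpa using hw)
  rw [sub_sub_cancel] at h
  rw [← h, complexMGF, gammaMeasure,
    integral_withDensity_eq_integral_toReal_smul (measurable_gammaPDF s 1)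
      (ae_of_all _ fun _ => ENNReal.ofReal_lt_top), barnesZetaIntegral, ← integral_const_mul]
  have hind : ∀ x : ℝ, (gammaPDF s 1 x).toReal • Complex.exp ((1 - w) * (id x : ℝ)) =
      (Ici (0 : ℝ)).indicator
        (fun x => (gammaPDF s 1 x).toReal • Complex.exp ((1 - w) * (id x : ℝ))) x := by
    intro x
    by_cases hx : 0 ≤ x
    · rw [indicator_of_mem (by exact hx)]
    · rw [indicator_of_notMem (by exact hx), gammaPDF_of_neg (not_le.mp hx)]
      simp
  rw [integral_congr_ae (ae_of_all _ hind)]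
  rw [integral_indicator measurableSet_Ici, integral_Ici_eq_integral_Ioi]
  refine setIntegral_congr_fun measurableSet_Ioi fun x hx => ?_
  have hx : 0 < x := hx
  have hG := Real.Gamma_pos_of_pos hs
  simp only [id, gammaPDF_of_nonneg hx.le]
  rw [ENNReal.toReal_ofReal (by positivity), Complex.real_smul]
  have e : Complex.exp (-w * x) = Complex.exp (-(1 * x)) * Complex.exp ((1 - w) * x) := by
    rw [← Complex.exp_add]; ring_nf
  rw [e, Complex.Gamma_ofReal]
  push_cast
  rw [Complex.ofReal_cpow hx.le]
  simp
  ring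

lemma barnesLogGamma_elim0 {w : ℂ} (hw : 0 < w.re) :
    barnesLogGamma (Fin.elim0 : Fin 0 → ℝ) w = -Complex.log w := by
  have hZ := isBarnesZetaContinuation_epsilon (a := (Fin.elim0 : Fin 0 → ℝ)) (fun j => j.elim0) hw
  rw [barnesLogGamma]
  set Z := Classical.epsilon (IsBarnesZetaContinuation (Fin.elim0 : Fin 0 → ℝ) w)
  have hw0 : w ≠ 0 := fun h => by simp [h] at hw
  have hd : HasDerivAt (fun s : ℂ => w ^ (-s)) (-Complex.log w) 0 := by
    have := (hasDerivAt_neg (0 : ℂ)).const_cpow (c := w) (Or.inl hw0)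
    simpa using this
  have hdom : {s : ℂ | -1 < s.re} = barnesDomain (Fintype.card (Fin 0)) := by
    ext s
    simp only [barnesDomain, Fintype.card_fin, mem_ofPred]
    exact ⟨fun h => ⟨h, fun m h1 h2 => by omega⟩, fun h => h.1⟩
  have hopen : IsOpen {s : ℂ | -1 < s.re} := isOpen_lt continuous_const Complex.continuous_re
  have heq : EqOn Z (fun s => w ^ (-s)) {s : ℂ | -1 < s.re} := by
    refine eqOn_of_eventually_eq_ofReal hopen (convex_halfSpace_re_gt _).isPreconnected
      (hdom ▸ hZ.1) ?_ (x₀ := 0) (by simp) ?_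
    · exact (DifferentiableOn.const_cpow (by fun_prop) (Or.inl hw0))
    · filter_upwards [self_mem_nhdsWithin] with x hx
      rw [hZ.2 x (by simpa using hx), barnesZetaIntegral_elim0 hx hw]
  have hev : Z =ᶠ[𝓝 0] fun s => w ^ (-s) :=
    Filter.eventually_of_mem (hopen.mem_nhds (show (0 : ℂ) ∈ {s : ℂ | -1 < s.re} by simp)) heq
  rw [hev.deriv_eq, hd.deriv]

lemma barnesEta_elim0 {δ : ℝ} (hδ : 0 < δ) {q : ℂ} (hq : -δ < q.re) :
    barnesEta (Fin.elim0 : Fin 0 → ℝ) δ (Fin.elim0 : Fin 0 → ℝ) q = δ / (q + δ) := by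
  have h : 0 < (q + δ).re := by simp; linarith
  have h0 : q + δ ≠ 0 := fun h' => by simp [h'] at h
  have hd : (δ : ℂ) ≠ 0 := by exact_mod_cast hδ.ne'
  have hu : (Finset.univ : Finset (Finset (Fin 0))) = {∅} := rfl
  rw [barnesEta, barnesS, barnesS, hu]
  simp only [Finset.sum_singleton, Finset.card_empty, pow_zero, one_mul, Finset.sum_empty, add_zero,
    zero_add]
  rw [barnesLogGamma_elim0 h, barnesLogGamma_elim0 (by simpa using hδ), Complex.exp_sub,
    Complex.exp_neg, Complex.exp_neg, Complex.exp_log h0, Complex.exp_log hd]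
  field_simp

/-- The measure with density `δ x^{δ-1}` on `(0, 1)`. -/
noncomputable def powerLaw (δ : ℝ) : Measure ℝ :=
  (volume.restrict (Ioo 0 1)).withDensity (fun x => ENNReal.ofReal (δ * x ^ (δ - 1)))

lemma powerLaw_cpow {δ : ℝ} (hδ : 0 < δ) {q : ℂ} (hq : -δ < q.re) :
    Integrable (fun x : ℝ => (x : ℂ) ^ q) (powerLaw δ) ∧
      ∫ x : ℝ, (x : ℂ) ^ q ∂(powerLaw δ) = δ / (q + δ) := by
  have h : 0 < (q + δ).re := by simp; linarith
  have h0 : q + δ ≠ 0 := fun h' => by simp [h'] at h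
  have hm : Measurable fun x : ℝ => ENNReal.ofReal (δ * x ^ (δ - 1)) := by fun_prop
  have hcongr : ∀ x ∈ Ioo (0 : ℝ) 1, (ENNReal.ofReal (δ * x ^ (δ - 1))).toReal • (x : ℂ) ^ q =
      δ * (x : ℂ) ^ (q + δ - 1) := by
    intro x hx
    have hx0 : (x : ℂ) ≠ 0 := by exact_mod_cast hx.1.ne'
    have : 0 ≤ x ^ (δ - 1) := Real.rpow_nonneg hx.1.le _
    rw [ENNReal.toReal_ofReal (by positivity), Complex.real_smul]
    push_cast
    rw [Complex.ofReal_cpow hx.1.le, mul_assoc, ← Complex.cpow_add _ _ hx0]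
    push_cast
    ring_nf
  have hre : -1 < (q + δ - 1).re := by simp; linarith
  have hint : IntegrableOn (fun x : ℝ => (x : ℂ) ^ (q + δ - 1)) (Ioo 0 1) := by
    have := intervalIntegral.intervalIntegrable_cpow' (a := 0) (b := 1) hre
    rw [intervalIntegrable_iff_integrableOn_Ioo_of_le zero_le_one] at this
    exact this
  constructor
  · rw [powerLaw, integrable_withDensity_iff_integrable_smul' hm
      (ae_of_all _ fun _ => ENNReal.ofReal_lt_top)]
    exact IntegrableOn.congr_fun (hint.const_mul (δ : ℂ)) (fun x hx => (hcongr x hx).symm)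
      measurableSet_Ioo
  · rw [powerLaw, integral_withDensity_eq_integral_toReal_smul hm
      (ae_of_all _ fun _ => ENNReal.ofReal_lt_top), setIntegral_congr_fun measurableSet_Ioo hcongr,
      integral_const_mul, ← integral_Ioc_eq_integral_Ioo,
      ← intervalIntegral.integral_of_le zero_le_one, integral_cpow (Or.inl hre)]
    have h1 : q + (δ : ℂ) - 1 + 1 = q + δ := by ring
    rw [h1]
    simp [Complex.zero_cpow h0]
    ring

lemma isProbabilityMeasure_powerLaw {δ : ℝ} (hδ : 0 < δ) : IsProbabilityMeasure (powerLaw δ) := by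
  have h := powerLaw_cpow hδ (q := 0) (by simpa using hδ)
  have hd : (δ : ℂ) ≠ 0 := by exact_mod_cast hδ.ne'
  simp only [Complex.cpow_zero, integral_const, Complex.real_smul, mul_one, zero_add,
    integrable_const_iff, one_ne_zero, false_or, div_self hd] at h
  have := h.1
  constructor
  have h2 : (powerLaw δ).real univ = 1 := by exact_mod_cast h.2
  rw [measureReal_def] at h2
  rw [← ENNReal.ofReal_toReal (measure_ne_top (powerLaw δ) univ), h2, ENNReal.ofReal_one]

lemma isBeta00_iff {δ : ℝ} (hδ : 0 < δ) (μ : ProbabilityMeasure ℝ) :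
    IsBeta00 δ μ ↔ (μ : Measure ℝ) = powerLaw δ := by
  have hp := isProbabilityMeasure_powerLaw hδ
  have hex : IsBeta00 δ ⟨powerLaw δ, hp⟩ := by
    refine ⟨?_, fun q hq => ?_⟩
    · simp only [ProbabilityMeasure.coe_mk]
      refine (withDensity_absolutelyContinuous _ _) ?_
      rw [Measure.restrict_apply measurableSet_Ioc.compl]
      convert! measure_empty (μ := (volume : Measure ℝ))
      ext x
      simp
      intro h1 h2
      exact (h1 h2).le
    · rw [barnesEta_elim0 hδ hq]
      exact powerLaw_cpow hδ hq
  constructor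
  · intro h
    exact congrArg Subtype.val (IsBarnesBeta.unique hδ h hex)
  · intro h
    have : μ = ⟨powerLaw δ, hp⟩ := Subtype.ext h
    rw [this]
    exact hex

/-! ### Frullani integrals and the theta function -/

lemma abs_exp_neg_mul_sub_one_le {q t : ℝ} (hq : 0 ≤ q) (ht : 0 ≤ t) :
    |Real.exp (-q * t) - 1| ≤ q * t := by
  have h1 : Real.exp (-q * t) ≤ 1 := by
    rw [Real.exp_le_one_iff]; nlinarith [mul_nonneg hq ht]
  have h2 := Real.add_one_le_exp (-q * t)
  rw [abs_of_nonpos (by linarith)]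
  linarith

lemma integrableOn_exp_neg_mul {c : ℝ} (hc : 0 < c) :
    IntegrableOn (fun t : ℝ => Real.exp (-c * t)) (Ioi 0) := by
  exact integrableOn_exp_mul_Ioi (by linarith) 0

/-- The bound |e^{-qt} - 1| ≤ qt absorbs the factor 1/t. -/
lemma integrableOn_frullani {q : ℝ} (hq : 0 ≤ q) {f : ℝ → ℝ} (hf : IntegrableOn f (Ioi 0)) :
    IntegrableOn (fun t : ℝ => (Real.exp (-q * t) - 1) * f t / t) (Ioi 0) := by
  refine Integrable.mono (hf.const_mul q) ?_ ?_
  · have h1 : AEStronglyMeasurable (fun t : ℝ => (Real.exp (-q * t) - 1) / t)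
        (volume.restrict (Ioi 0)) := (by fun_prop : Measurable _).aestronglyMeasurable
    refine (h1.mul hf.1).congr (ae_of_all _ fun t => ?_)
    simp only [Pi.mul_apply]
    ring
  · refine (ae_restrict_iff' measurableSet_Ioi).mpr (ae_of_all _ fun t ht => ?_)
    have ht : 0 < t := ht
    have h := abs_exp_neg_mul_sub_one_le hq ht.le
    rw [norm_div, norm_mul, norm_mul, Real.norm_eq_abs, Real.norm_of_nonneg ht.le,
      Real.norm_of_nonneg hq, div_le_iff₀ ht]
    calc _ ≤ q * t * ‖f t‖ := by gcongr
      _ = _ := by ring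

/-- A special case of Frullani's integral. -/
lemma integral_frullani {q c : ℝ} (hq : 0 ≤ q) (hc : 0 < c) :
    ∫ t in Ioi (0 : ℝ), (Real.exp (-q * t) - 1) * Real.exp (-c * t) / t = -Real.log (1 + q / c) := by
  have e : ∀ t : ℝ, (Real.exp (-q * t) - 1) * Real.exp (-c * t) / t =
      t⁻¹ • (Real.exp (-((c + q) * t)) - Real.exp (-(c * t))) := by
    intro t
    rw [smul_eq_mul, sub_mul, ← Real.exp_add]
    ring_nf
  have hint := integrableOn_frullani hq (integrableOn_exp_neg_mul hc)
  simp_rw [e] at hint ⊢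
  have hcont : Continuous fun t : ℝ => Real.exp (-t) := by fun_prop
  have h := Frullani.integral_Ioi_eq (f := fun t => Real.exp (-t)) (a := c + q) (b := c)
    (L := 1) (R := 0) (hcont.continuousOn.locallyIntegrableOn measurableSet_Ioi)
    (by linarith) hc ?_ ?_ hint
  · rw [h, smul_eq_mul, sub_zero, mul_one, ← Real.log_inv, inv_eq_one_div]
    congr 1
    field_simp
  · have := hcont.tendsto 0
    simp only [neg_zero, Real.exp_zero] at this
    exact this.mono_left nhdsWithin_le_nhds
  · exact Real.tendsto_exp_neg_atTop_nhds_zero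

/-- `π² n² / 2`, with `n + 1` in place of `n`. -/
noncomputable def thetaEig (n : ℕ) : ℝ := Real.pi ^ 2 * ((n : ℝ) + 1) ^ 2 / 2

lemma thetaEig_pos (n : ℕ) : 0 < thetaEig n := by
  unfold thetaEig
  positivity

lemma thetaJ_sub_one (t : ℝ) :
    thetaJ (Real.pi * t / 2) - 1 = ∑' n : ℕ, 2 * Real.exp (-(thetaEig n) * t) := by
  rw [thetaJ, add_sub_cancel_left, tsum_mul_left]
  congr 2
  ext n
  congr 1
  rw [thetaEig]
  ring

lemma summable_inv_add_thetaEig {δ : ℝ} (hδ : 0 ≤ δ) :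
    Summable fun n : ℕ => 1 / (thetaEig n + δ) := by
  have h : Summable fun n : ℕ => 1 / ((n : ℝ) + 1) ^ 2 := by
    have := (summable_nat_add_iff 1).mpr (Real.summable_one_div_nat_pow.mpr one_lt_two)
    simpa using this
  refine Summable.of_nonneg_of_le (fun n => ?_) (fun n => ?_) (h.mul_left (2 / Real.pi ^ 2))
  · have := thetaEig_pos n
    positivity
  · have h1 : 2 / Real.pi ^ 2 * (1 / ((n : ℝ) + 1) ^ 2) = 1 / thetaEig n := by
      rw [thetaEig]
      field_simp
    rw [h1]
    exact one_div_le_one_div_of_le (thetaEig_pos n) (by linarith)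

lemma integrable_summable_theta {δ : ℝ} (hδ : 0 < δ) :
    (∀ n, IntegrableOn (fun t : ℝ => 2 * Real.exp (-(thetaEig n + δ) * t)) (Ioi 0)) ∧
    (Summable fun n => ∫ t in Ioi (0 : ℝ), ‖2 * Real.exp (-(thetaEig n + δ) * t)‖) := by
  have hpos : ∀ n, 0 < thetaEig n + δ := fun n => by linarith [thetaEig_pos n]
  refine ⟨fun n => (integrableOn_exp_neg_mul (hpos n)).const_mul 2, ?_⟩
  refine ((summable_inv_add_thetaEig hδ.le).mul_left 2).congr fun n => ?_
  have h : ∀ t : ℝ, ‖2 * Real.exp (-(thetaEig n + δ) * t)‖ =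
      2 * Real.exp (-(thetaEig n + δ) * t) := fun t => Real.norm_of_nonneg (by positivity)
  simp_rw [h]
  rw [integral_const_mul, integral_exp_mul_Ioi (by linarith [hpos n]), neg_div_neg_eq]
  simp

lemma exp_mul_thetaJ_sub_one (δ t : ℝ) :
    Real.exp (-δ * t) * (thetaJ (Real.pi * t / 2) - 1) =
      ∑' n : ℕ, 2 * Real.exp (-(thetaEig n + δ) * t) := by
  rw [thetaJ_sub_one, ← tsum_mul_left]
  congr 1
  ext n
  rw [mul_left_comm, ← Real.exp_add]
  ring_nf

lemma integrableOn_exp_mul_thetaJ_sub_one {δ : ℝ} (hδ : 0 < δ) :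
    IntegrableOn (fun t : ℝ => Real.exp (-δ * t) * (thetaJ (Real.pi * t / 2) - 1)) (Ioi 0) := by
  simp_rw [exp_mul_thetaJ_sub_one]
  exact integrable_tsum_of_summable_integral_norm (integrable_summable_theta hδ).1
    (integrable_summable_theta hδ).2

/-- Frullani is applied to each exponential of θ - 1. The interchange is justified by the summable
majorant 2q/(λ_n+δ). The coefficient -2 matches the gamma shape 2: each summand is the log-Laplace
transform of one term of S_2(δ). -/
lemma hasSum_integral_thetaJ {δ q : ℝ} (hδ : 0 < δ) (hq : 0 ≤ q) :
    HasSum (fun n : ℕ => -2 * Real.log (1 + q / (thetaEig n + δ)))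
      (∫ t in Ioi (0 : ℝ), (Real.exp (-q * t) - 1) *
        (Real.exp (-δ * t) * (thetaJ (Real.pi * t / 2) - 1)) / t) := by
  have hpos : ∀ n, 0 < thetaEig n + δ := fun n => by linarith [thetaEig_pos n]
  have hint := fun n => integrableOn_frullani hq ((integrable_summable_theta hδ).1 n)
  have hval : ∀ n, ∫ t in Ioi (0 : ℝ), (Real.exp (-q * t) - 1) *
      (2 * Real.exp (-(thetaEig n + δ) * t)) / t = -2 * Real.log (1 + q / (thetaEig n + δ)) := by
    intro n
    have h := integral_frullani hq (hpos n)
    have e : ∀ t : ℝ, (Real.exp (-q * t) - 1) * (2 * Real.exp (-(thetaEig n + δ) * t)) / t =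
        2 * ((Real.exp (-q * t) - 1) * Real.exp (-(thetaEig n + δ) * t) / t) := fun t => by ring
    simp_rw [e]
    rw [integral_const_mul, h]
    ring
  have hle : ∀ n t, t ∈ Ioi (0 : ℝ) → ‖(Real.exp (-q * t) - 1) *
      (2 * Real.exp (-(thetaEig n + δ) * t)) / t‖ ≤ q * ‖2 * Real.exp (-(thetaEig n + δ) * t)‖ := by
    intro n t ht
    have ht : 0 < t := ht
    have h := abs_exp_neg_mul_sub_one_le hq ht.le
    rw [norm_div, norm_mul, Real.norm_eq_abs, Real.norm_of_nonneg ht.le, div_le_iff₀ ht]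
    calc _ ≤ q * t * ‖2 * Real.exp (-(thetaEig n + δ) * t)‖ := by gcongr
      _ = _ := by ring
  have hsum : Summable fun n => ∫ t in Ioi (0 : ℝ), ‖(Real.exp (-q * t) - 1) *
      (2 * Real.exp (-(thetaEig n + δ) * t)) / t‖ := by
    refine Summable.of_nonneg_of_le (fun n => integral_nonneg fun _ => norm_nonneg _) (fun n => ?_)
      ((integrable_summable_theta hδ).2.mul_left q)
    rw [← integral_const_mul]
    exact setIntegral_mono_on (hint n).norm (((integrable_summable_theta hδ).1 n).norm.const_mul q)
      measurableSet_Ioi (hle n)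
  have h := hasSum_integral_of_summable_integral_norm hint hsum
  simp_rw [hval] at h
  convert! h using 1
  refine integral_congr_ae (ae_of_all _ fun t => ?_)
  simp only []
  rw [exp_mul_thetaJ_sub_one, ← tsum_mul_left, ← tsum_div_const]

/-! ### Convergence of the moments of `β_M(δ)` -/

lemma integral_pow_betaM {M : ℕ} (hM : 1 ≤ M) {δ : ℝ} (hδ : 0 < δ) {μ : ProbabilityMeasure ℝ}
    (hμ : IsBetaM M δ μ) (n : ℕ) :
    ∫ x, x ^ n ∂(μ : Measure ℝ) = Real.exp (∫ t in Ioi (0 : ℝ), (Real.exp (-(n : ℝ) * t) - 1) *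
      (Real.exp (-δ * t) * barnesRatio (aParam M) (bParam M) t) / t) := by
  have hn : -δ < ((n : ℂ)).re := by
    simp only [Complex.natCast_re]
    have : (0 : ℝ) ≤ n := n.cast_nonneg
    linarith
  have h0 : -δ < ((0 : ℂ)).re := by simpa using hδ
  have ha := aParam_pos M
  have hb := bParam_pos M
  have hc := card_param_lt hM
  have h1 : ((∫ x, x ^ n ∂(μ : Measure ℝ) : ℝ) : ℂ) =
      barnesEta (aParam M) δ (bParam M) n := by
    rw [← (hμ.2 n hn).2, ← integral_complex_ofReal]
    simp
  have h2 : ((∫ x, x ^ n ∂(μ : Measure ℝ) : ℝ) : ℂ) =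
      ((Real.exp (∫ t in Ioi (0 : ℝ), (Real.exp (-(n : ℝ) * t) - 1) *
        (Real.exp (-δ * t) * barnesRatio (aParam M) (bParam M) t) / t) : ℝ) : ℂ) := by
    rw [h1, barnesEta, barnesS_barnesLogGamma ha hb hc δ hn, barnesS_barnesLogGamma ha hb hc δ h0,
      ← integral_sub (integrableOn_exp_mul_barnesRatio ha hb hc δ hn)
        (integrableOn_exp_mul_barnesRatio ha hb hc δ h0), Complex.ofReal_exp,
      ← integral_complex_ofReal]
    congr 1
    refine integral_congr_ae (ae_of_all _ fun t => ?_)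
    simp only [neg_zero, zero_mul, Complex.exp_zero, one_mul]
    push_cast
    ring
  exact_mod_cast h2

/-- Dominated convergence in the exponent, with majorant n e^{-δt} θ(πt/2). The constant term 1 of θ
integrates by Frullani to the factor (1 + n/δ)⁻¹, which becomes the β_00(δ) component. -/
lemma tendsto_integral_pow_betaM {δ : ℝ} (hδ : 0 < δ) {β : ℕ → ProbabilityMeasure ℝ}
    (hβ : ∀ M, 1 ≤ M → IsBetaM M δ (β M)) (n : ℕ) :
    Tendsto (fun M => ∫ x, x ^ n ∂(β M : Measure ℝ)) atTop
      (𝓝 ((1 + n / δ)⁻¹ * Real.exp (∫ t in Ioi (0 : ℝ), (Real.exp (-(n : ℝ) * t) - 1) *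
        (Real.exp (-δ * t) * (thetaJ (Real.pi * t / 2) - 1)) / t))) := by
  have hn : (0 : ℝ) ≤ n := n.cast_nonneg
  have hθint : IntegrableOn (fun t : ℝ => Real.exp (-δ * t) * thetaJ (Real.pi * t / 2)) (Ioi 0) := by
    refine ((integrableOn_exp_mul_thetaJ_sub_one hδ).add (integrableOn_exp_neg_mul hδ)).congr
      (ae_of_all _ fun t => ?_)
    simp only [Pi.add_apply]
    ring
  have hlim : Tendsto (fun M => ∫ t in Ioi (0 : ℝ), (Real.exp (-(n : ℝ) * t) - 1) *
      (Real.exp (-δ * t) * barnesRatio (aParam M) (bParam M) t) / t) atTop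
      (𝓝 (∫ t in Ioi (0 : ℝ), (Real.exp (-(n : ℝ) * t) - 1) *
        (Real.exp (-δ * t) * thetaJ (Real.pi * t / 2)) / t)) := by
    refine tendsto_integral_of_dominated_convergence
      (fun t => n * (Real.exp (-δ * t) * thetaJ (Real.pi * t / 2)))
      (fun M => ?_) (hθint.const_mul _) (fun M => ?_) ?_
    · have := measurable_barnesRatio (aParam M) (bParam M)
      exact (by fun_prop : Measurable _).aestronglyMeasurable
    · refine (ae_restrict_iff' measurableSet_Ioi).mpr (ae_of_all _ fun t ht => ?_)
      have ht : 0 < t := ht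
      have h := abs_exp_neg_mul_sub_one_le hn ht.le
      have h0 := barnesRatio_nonneg (aParam_pos M) (bParam_pos M) ht
      have h1 := barnesRatio_param_le_thetaJ M ht
      rw [norm_div, norm_mul, norm_mul, Real.norm_eq_abs, Real.norm_of_nonneg ht.le,
        Real.norm_of_nonneg h0, Real.norm_of_nonneg (Real.exp_pos _).le, div_le_iff₀ ht]
      calc _ ≤ n * t * (Real.exp (-δ * t) * thetaJ (Real.pi * t / 2)) := by gcongr
        _ = _ := by ring
    · refine (ae_restrict_iff' measurableSet_Ioi).mpr (ae_of_all _ fun t ht => ?_)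
      exact (((tendsto_barnesRatio_param ht).const_mul _).const_mul _).div_const _
  have hval : Real.exp (∫ t in Ioi (0 : ℝ), (Real.exp (-(n : ℝ) * t) - 1) *
      (Real.exp (-δ * t) * thetaJ (Real.pi * t / 2)) / t) =
      (1 + n / δ)⁻¹ * Real.exp (∫ t in Ioi (0 : ℝ), (Real.exp (-(n : ℝ) * t) - 1) *
        (Real.exp (-δ * t) * (thetaJ (Real.pi * t / 2) - 1)) / t) := by
    have hpos : 0 < 1 + n / δ := by positivity
    rw [← Real.exp_log (inv_pos.mpr hpos), Real.log_inv, ← integral_frullani hn hδ, ← Real.exp_add,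
      ← integral_add (integrableOn_frullani hn (integrableOn_exp_neg_mul hδ))
        (integrableOn_frullani hn (integrableOn_exp_mul_thetaJ_sub_one hδ))]
    congr 1
    refine integral_congr_ae (ae_of_all _ fun t => ?_)
    simp only []
    ring
  rw [← hval]
  refine ((Real.continuous_exp.tendsto _).comp hlim).congr' ?_
  filter_upwards [eventually_ge_atTop 1] with M hM
  exact (integral_pow_betaM hM hδ (hβ M hM) n).symm

/-! ### Weighted sums of independent gamma variables -/

/-- The variables `G n` are independent with common law the gamma law of shape `r` and rate `1`. -/
structure IsGammaSeq {Ω : Type*} [MeasurableSpace Ω] (P : Measure Ω) (G : ℕ → Ω → ℝ) (r : ℝ) :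
    Prop where
  measurable : ∀ n, Measurable (G n)
  indep : iIndepFun G P
  law : ∀ n, P.map (G n) = gammaMeasure r 1

/-- The series `∑ G n * c n`. -/
noncomputable def gammaSum {Ω : Type*} (G : ℕ → Ω → ℝ) (c : ℕ → ℝ) (ω : Ω) : ℝ := ∑' n, G n ω * c n

lemma eq_of_integral_exp_neg_eq {μ ν : Measure ℝ} [IsProbabilityMeasure μ] [IsProbabilityMeasure ν]
    (hμ : μ (Iio 0) = 0) (hν : ν (Iio 0) = 0)
    (h : ∀ n : ℕ, ∫ x, Real.exp (-(n * x)) ∂μ = ∫ x, Real.exp (-(n * x)) ∂ν) : μ = ν := by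
  have key : ∀ ρ : Measure ℝ, IsProbabilityMeasure ρ → ρ (Iio 0) = 0 → ∀ n : ℕ,
      ∫⁻ x, ENNReal.ofReal (Real.exp (-(n * x))) ∂ρ =
        ENNReal.ofReal (∫ x, Real.exp (-(n * x)) ∂ρ) := by
    intro ρ _ hρ n
    rw [ofReal_integral_eq_lintegral_ofReal _ (ae_of_all _ fun _ => (Real.exp_pos _).le)]
    refine Integrable.of_bound (by fun_prop) 1 ?_
    have : ∀ᵐ x ∂ρ, ¬ x < 0 := by
      rw [ae_iff]
      exact measure_mono_null (fun x hx => by simpa using hx) hρ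
    filter_upwards [this] with x hx
    rw [Real.norm_of_nonneg (Real.exp_pos _).le, Real.exp_le_one_iff]
    have := mul_nonneg (n.cast_nonneg : (0 : ℝ) ≤ n) (not_lt.mp hx)
    linarith
  exact eq_of_lintegral_exp_neg_eq hμ hν fun n => by
    rw [key μ inferInstance hμ, key ν inferInstance hν, h]

namespace IsGammaSeq

variable {Ω : Type*} [MeasurableSpace Ω] {P : Measure Ω} {G : ℕ → Ω → ℝ} {r : ℝ} {c : ℕ → ℝ}

lemma measurable_gammaSum (hG : IsGammaSeq P G r) (c : ℕ → ℝ) : Measurable (gammaSum G c) :=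
  Measurable.tsum fun n => (hG.measurable n).mul_const _

lemma ae_pos (hG : IsGammaSeq P G r) : ∀ᵐ ω ∂P, ∀ n, 0 < G n ω := by
  rw [ae_all_iff]
  intro n
  have h : ∀ᵐ x ∂(P.map (G n)), 0 < x := by
    rw [hG.law, ae_iff]
    simp only [not_lt]
    exact gammaMeasure_Iic_zero r
  exact ae_of_ae_map (hG.measurable n).aemeasurable h

/-- The expected sum is E[Γ] ∑ c_n < ∞, hence the sum is almost surely finite. Independence plays no
role. -/
lemma ae_summable (hG : IsGammaSeq P G r) (hr : 0 < r) (hc0 : ∀ n, 0 < c n) (hc : Summable c) :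
    ∀ᵐ ω ∂P, Summable fun n => G n ω * c n := by
  set K := ∫⁻ x, ENNReal.ofReal x ∂(gammaMeasure r 1) with hK
  have hKfin : K < ⊤ := by
    refine lt_of_le_of_lt (lintegral_mono (g := fun x =>
      ENNReal.ofReal 2 * ENNReal.ofReal (Real.exp (1 / 2 * x))) fun x => ?_) ?_
    · simp only []
      rw [← ENNReal.ofReal_mul zero_le_two]
      refine ENNReal.ofReal_le_ofReal ?_
      linarith [Real.add_one_le_exp (1 / 2 * x)]
    · rw [lintegral_const_mul _ (by fun_prop), lintegral_exp_gammaMeasure hr (by norm_num)]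
      exact ENNReal.mul_lt_top ENNReal.ofReal_lt_top ENNReal.ofReal_lt_top
  have h1 : ∫⁻ ω, ∑' n, ENNReal.ofReal (G n ω * c n) ∂P < ⊤ := by
    rw [lintegral_tsum fun n => ((hG.measurable n).mul_const _).ennreal_ofReal.aemeasurable]
    have : ∀ n, ∫⁻ ω, ENNReal.ofReal (G n ω * c n) ∂P = K * ENNReal.ofReal (c n) := by
      intro n
      simp_rw [ENNReal.ofReal_mul' (hc0 n).le]
      rw [lintegral_mul_const _ (hG.measurable n).ennreal_ofReal, hK, ← hG.law n,
        lintegral_map (by fun_prop) (hG.measurable n)]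
    simp_rw [this]
    rw [ENNReal.tsum_mul_left]
    exact ENNReal.mul_lt_top hKfin hc.tsum_ofReal_lt_top
  have hm : Measurable fun ω => ∑' n, ENNReal.ofReal (G n ω * c n) :=
    Measurable.tsum fun n => ((hG.measurable n).mul_const _).ennreal_ofReal
  filter_upwards [ae_lt_top hm h1.ne, hG.ae_pos] with ω h2 h3
  have h4 := ENNReal.summable_toReal h2.ne
  refine h4.congr fun n => ?_
  rw [ENNReal.toReal_ofReal (mul_pos (h3 n) (hc0 n)).le]

lemma ae_gammaSum_pos (hG : IsGammaSeq P G r) (hr : 0 < r) (hc0 : ∀ n, 0 < c n) (hc : Summable c) :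
    ∀ᵐ ω ∂P, 0 < gammaSum G c ω := by
  filter_upwards [hG.ae_summable hr hc0 hc, hG.ae_pos] with ω h1 h2
  exact h1.tsum_pos (fun n => (mul_pos (h2 n) (hc0 n)).le) 0 (mul_pos (h2 0) (hc0 0))

lemma lintegral_exp_sum (hG : IsGammaSeq P G r) (hr : 0 < r) {t : ℝ} (ht : ∀ n, t * c n < 1)
    (N : ℕ) : ∫⁻ ω, ENNReal.ofReal (Real.exp (t * ∑ n ∈ Finset.range N, G n ω * c n)) ∂P =
      ENNReal.ofReal (∏ n ∈ Finset.range N, (1 - t * c n) ^ (-r)) := by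
  have hind : iIndepFun (fun n ω => ENNReal.ofReal (Real.exp (t * c n * G n ω))) P :=
    hG.indep.comp (fun n x => ENNReal.ofReal (Real.exp (t * c n * x))) fun n => by fun_prop
  have h1 : ∀ ω, ENNReal.ofReal (Real.exp (t * ∑ n ∈ Finset.range N, G n ω * c n)) =
      ∏ n ∈ Finset.range N, ENNReal.ofReal (Real.exp (t * c n * G n ω)) := by
    intro ω
    rw [← ENNReal.ofReal_prod_of_nonneg fun _ _ => (Real.exp_pos _).le, ← Real.exp_sum,
      Finset.mul_sum]
    congr 2
    refine Finset.sum_congr rfl fun n _ => by ring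
  simp_rw [h1]
  rw [lintegral_prod_eq_prod_lintegral_of_indepFun _ _ hind fun n => by
    have := hG.measurable n; fun_prop, ENNReal.ofReal_prod_of_nonneg fun n _ =>
      Real.rpow_nonneg (by linarith [ht n]) _]
  refine Finset.prod_congr rfl fun n _ => ?_
  rw [← lintegral_exp_gammaMeasure hr (ht n), ← hG.law n, lintegral_map (by fun_prop)
    (hG.measurable n)]

/-- The Laplace transform of a weighted sum of gamma variables. -/
lemma tendsto_laplace [IsProbabilityMeasure P] (hG : IsGammaSeq P G r) (hr : 0 < r)
    (hc0 : ∀ n, 0 < c n) (hc : Summable c) {q : ℝ} (hq : 0 ≤ q) :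
    Tendsto (fun N => ∏ n ∈ Finset.range N, (1 + q * c n) ^ (-r)) atTop
      (𝓝 (∫ ω, Real.exp (-q * gammaSum G c ω) ∂P)) := by
  have hlt : ∀ n, -q * c n < 1 := fun n => by nlinarith [mul_nonneg hq (hc0 n).le]
  have h1 : ∀ N, ∏ n ∈ Finset.range N, (1 + q * c n) ^ (-r) =
      ∫ ω, Real.exp (-q * ∑ n ∈ Finset.range N, G n ω * c n) ∂P := by
    intro N
    have hm : Measurable fun ω => Real.exp (-q * ∑ n ∈ Finset.range N, G n ω * c n) := by
      have := hG.measurable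
      fun_prop
    rw [integral_eq_lintegral_of_nonneg_ae (ae_of_all _ fun _ => (Real.exp_pos _).le)
      hm.aestronglyMeasurable, hG.lintegral_exp_sum hr hlt, ENNReal.toReal_ofReal]
    · refine Finset.prod_congr rfl fun n _ => ?_
      congr 1; ring
    · exact Finset.prod_nonneg fun n _ => Real.rpow_nonneg (by linarith [hlt n]) _
  simp_rw [h1]
  refine tendsto_integral_of_dominated_convergence (fun _ => 1) (fun N => ?_)
    (integrable_const _) (fun N => ?_) ?_
  · have := hG.measurable
    exact (by fun_prop : Measurable _).aestronglyMeasurable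
  · filter_upwards [hG.ae_pos] with ω hω
    rw [Real.norm_of_nonneg (Real.exp_pos _).le, Real.exp_le_one_iff]
    have := Finset.sum_nonneg fun n (_ : n ∈ Finset.range N) => (mul_pos (hω n) (hc0 n)).le
    nlinarith [mul_nonneg hq this]
  · filter_upwards [hG.ae_summable hr hc0 hc] with ω hω
    exact (Real.continuous_exp.tendsto _).comp (hω.hasSum.tendsto_sum_nat.const_mul _)

/-- Fatou along partial sums. The product of moment generating functions is bounded through
-log(1-u) ≤ u/(1-u) ≤ u/κ at u = t c_n, so the gap κ has to be uniform in n. -/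
lemma integrable_exp_gammaSum (hG : IsGammaSeq P G r) (hr : 0 < r)
    (hc0 : ∀ n, 0 < c n) (hc : Summable c) {t κ : ℝ} (ht : 0 ≤ t) (hκ : 0 < κ)
    (htc : ∀ n, t * c n ≤ 1 - κ) : Integrable (fun ω => Real.exp (t * gammaSum G c ω)) P := by
  have hm := hG.measurable_gammaSum c
  refine ⟨(by fun_prop : Measurable _).aestronglyMeasurable, ?_⟩
  rw [hasFiniteIntegral_iff_ofReal (ae_of_all _ fun _ => (Real.exp_pos _).le)]
  have hlt : ∀ n, t * c n < 1 := fun n => by linarith [htc n]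
  have hbound : ∀ N, ∏ n ∈ Finset.range N, (1 - t * c n) ^ (-r) ≤
      Real.exp (r * (t / κ) * ∑' n, c n) := by
    intro N
    have h1 : ∀ n, (1 - t * c n) ^ (-r) ≤ Real.exp (r * (t / κ) * c n) := by
      intro n
      have hp : 0 < 1 - t * c n := by linarith [hlt n]
      rw [Real.rpow_def_of_pos hp, Real.exp_le_exp]
      have h2 := Real.one_sub_inv_le_log_of_pos hp
      have h3 : (1 - t * c n)⁻¹ - 1 ≤ t / κ * c n := by
        have : (1 - t * c n)⁻¹ - 1 = t * c n / (1 - t * c n) := by field_simp; ring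
        rw [this, div_mul_eq_mul_div]
        exact div_le_div_of_nonneg_left (mul_nonneg ht (hc0 n).le) hκ (by linarith [htc n])
      nlinarith
    calc _ ≤ ∏ n ∈ Finset.range N, Real.exp (r * (t / κ) * c n) :=
          Finset.prod_le_prod (fun n _ => Real.rpow_nonneg (by linarith [hlt n]) _) fun n _ => h1 n
      _ = Real.exp (r * (t / κ) * ∑ n ∈ Finset.range N, c n) := by
          rw [← Real.exp_sum, Finset.mul_sum]
      _ ≤ _ := by
          gcongr
          exact hc.sum_le_tsum _ fun n _ => (hc0 n).le
  have h4 : ∫⁻ ω, ENNReal.ofReal (Real.exp (t * gammaSum G c ω)) ∂P ≤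
      ∫⁻ ω, liminf (fun N => ENNReal.ofReal
        (Real.exp (t * ∑ n ∈ Finset.range N, G n ω * c n))) atTop ∂P := by
    refine lintegral_mono_ae ?_
    filter_upwards [hG.ae_summable hr hc0 hc] with ω hω
    have : Tendsto (fun N => ENNReal.ofReal
        (Real.exp (t * ∑ n ∈ Finset.range N, G n ω * c n))) atTop
        (𝓝 (ENNReal.ofReal (Real.exp (t * gammaSum G c ω)))) :=
      (ENNReal.continuous_ofReal.tendsto _).comp
        ((Real.continuous_exp.tendsto _).comp (hω.hasSum.tendsto_sum_nat.const_mul _))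
    rw [this.liminf_eq]
  refine lt_of_le_of_lt (h4.trans ((lintegral_liminf_le fun N => ?_).trans ?_))
    (ENNReal.ofReal_lt_top (r := Real.exp (r * (t / κ) * ∑' n, c n)))
  · have := hG.measurable
    fun_prop
  · simp_rw [hG.lintegral_exp_sum hr hlt]
    refine (liminf_le_liminf (Eventually.of_forall fun N =>
      ENNReal.ofReal_le_ofReal (hbound N))).trans ?_
    simp

lemma map_Iio_zero (hG : IsGammaSeq P G r) (hr : 0 < r) (hc0 : ∀ n, 0 < c n) (hc : Summable c) :
    P.map (gammaSum G c) (Iio 0) = 0 := by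
  rw [Measure.map_apply (hG.measurable_gammaSum c) measurableSet_Iio]
  have := hG.ae_gammaSum_pos hr hc0 hc
  rw [ae_iff] at this
  refine measure_mono_null (fun ω hω => ?_) this
  simp only [mem_preimage, mem_Iio] at hω
  simpa using hω.le

lemma integral_exp_map (hG : IsGammaSeq P G r) (q : ℝ) :
    ∫ x, Real.exp (-(q * x)) ∂(P.map (gammaSum G c)) =
      ∫ ω, Real.exp (-q * gammaSum G c ω) ∂P := by
  rw [integral_map (hG.measurable_gammaSum c).aemeasurable (by fun_prop)]
  simp only [neg_mul]

/-- Split off the first term: its scaled gamma law has a density, and convolution keeps absolute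
continuity. The splitting is verified on Laplace transforms. -/
lemma absolutelyContinuous_map [IsProbabilityMeasure P] (hG : IsGammaSeq P G r) (hr : 0 < r)
    (hc0 : ∀ n, 0 < c n) (hc : Summable c) : P.map (gammaSum G c) ≪ volume := by
  have hG' : IsGammaSeq P (fun n => G (n + 1)) r :=
    ⟨fun n => hG.measurable _, hG.indep.precomp (add_left_injective 1), fun n => hG.law _⟩
  have hc' : Summable fun n => c (n + 1) := hc.comp_injective (add_left_injective 1)
  have hc0' : ∀ n, 0 < c (n + 1) := fun n => hc0 _
  have hgp := isProbabilityMeasure_gammaMeasure hr one_pos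
  set ρ := (gammaMeasure r 1).map fun x => c 0 * x with hρ
  set σ := P.map (gammaSum (fun n => G (n + 1)) fun n => c (n + 1)) with hσ
  have hρp : IsProbabilityMeasure ρ := Measure.isProbabilityMeasure_map (by fun_prop)
  have hσp : IsProbabilityMeasure σ :=
    Measure.isProbabilityMeasure_map (hG'.measurable_gammaSum _).aemeasurable
  have hXp : IsProbabilityMeasure (P.map (gammaSum G c)) :=
    Measure.isProbabilityMeasure_map (hG.measurable_gammaSum _).aemeasurable
  have hρac : ρ ≪ volume := by
    refine Measure.AbsolutelyContinuous.trans
      (Measure.AbsolutelyContinuous.map (withDensity_absolutelyContinuous _ _) (by fun_prop)) ?_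
    rw [Real.map_volume_mul_left (hc0 0).ne']
    exact Measure.smul_absolutelyContinuous
  have hρ0 : ρ (Iio 0) = 0 := by
    rw [hρ, Measure.map_apply (by fun_prop) measurableSet_Iio]
    refine measure_mono_null (fun x hx => ?_) (gammaMeasure_Iic_zero r)
    simp only [mem_preimage, mem_Iio] at hx
    simp only [mem_Iic]
    by_contra h
    nlinarith [hc0 0]
  have hσ0 : σ (Iio 0) = 0 := hG'.map_Iio_zero hr hc0' hc'
  have hsplit : ∀ q : ℝ, 0 ≤ q → ∫ ω, Real.exp (-q * gammaSum G c ω) ∂P =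
      (∫ ω, Real.exp (-q * gammaSum (fun n => G (n + 1)) (fun n => c (n + 1)) ω) ∂P) *
        (1 + q * c 0) ^ (-r) := by
    intro q hq
    have h1 := (tendsto_add_atTop_iff_nat 1).mpr (hG.tendsto_laplace hr hc0 hc hq)
    simp_rw [Finset.prod_range_succ'] at h1
    exact tendsto_nhds_unique h1 ((hG'.tendsto_laplace hr hc0' hc' hq).mul_const _)
  have heq : P.map (gammaSum G c) = σ.conv ρ := by
    refine eq_of_integral_exp_neg_eq (hG.map_Iio_zero hr hc0 hc) (conv_Iio_zero hσ0 hρ0) fun n => ?_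
    rw [integral_exp_neg_conv, hG.integral_exp_map, hG'.integral_exp_map, hsplit n n.cast_nonneg]
    congr 1
    rw [hρ, integral_map (by fun_prop) (by fun_prop)]
    have h0 : -(n * c 0) < 1 := by
      have := mul_nonneg (n.cast_nonneg : (0 : ℝ) ≤ n) (hc0 0).le
      linarith
    have h2 := integral_exp_gammaMeasure hr h0
    rw [sub_neg_eq_add] at h2
    rw [← h2]
    refine integral_congr_ae (ae_of_all _ fun x => ?_)
    simp only []
    ring_nf
  rw [heq]
  exact Measure.conv_absolutelyContinuous hρac

/-- Weighted sums of independent gamma variables are infinitely divisible. -/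
lemma isInfDivisible_map [IsProbabilityMeasure P] (hG : IsGammaSeq P G r) (hr : 0 < r)
    (hc0 : ∀ n, 0 < c n) (hc : Summable c) : IsInfDivisible (P.map (gammaSum G c)) := by
  intro m hm
  have hm0 : (0 : ℝ) < m := by exact_mod_cast hm
  have hrm : 0 < r / m := by positivity
  have hgp := isProbabilityMeasure_gammaMeasure hrm one_pos
  -- The m-th root of the law is the same weighted series with gamma shape r/m, since (1 + q
  -- c_k)^{-r/m} raised to the power m is (1 + q c_k)^{-r}.
  obtain ⟨Ω', mΩ', P', G', hG'm, hG'l, hG'i, hP'⟩ := exists_iid ℕ (gammaMeasure (r / m) 1)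
  have hG' : IsGammaSeq P' G' (r / m) := ⟨hG'm, hG'i, fun n => (hG'l n).map_eq⟩
  set ν := P'.map (gammaSum G' c) with hν
  have hνp : IsProbabilityMeasure ν :=
    Measure.isProbabilityMeasure_map (hG'.measurable_gammaSum _).aemeasurable
  have hXp : IsProbabilityMeasure (P.map (gammaSum G c)) :=
    Measure.isProbabilityMeasure_map (hG.measurable_gammaSum _).aemeasurable
  have hSp : IsProbabilityMeasure ((Measure.pi fun _ : Fin m => ν).map fun x => ∑ i, x i) :=
    Measure.isProbabilityMeasure_map (by fun_prop)
  refine ⟨ν, hνp, ?_⟩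
  refine eq_of_integral_exp_neg_eq ?_ (hG.map_Iio_zero hr hc0 hc) fun n => ?_
  · have hν0 : ∀ᵐ x ∂ν, 0 ≤ x := by
      rw [ae_iff]
      exact measure_mono_null (fun x hx => by simpa using hx) (hG'.map_Iio_zero hrm hc0 hc)
    have hall : ∀ᵐ x ∂(Measure.pi fun _ : Fin m => ν), ∀ i, 0 ≤ x i := by
      rw [ae_all_iff]
      intro i
      exact (Measure.quasiMeasurePreserving_eval (fun _ : Fin m => ν) i).ae hν0
    rw [Measure.map_apply (by fun_prop) measurableSet_Iio]
    rw [ae_iff] at hall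
    refine measure_mono_null (t := {x | ¬ ∀ i, 0 ≤ x i}) (fun x hx => ?_) hall
    intro h
    simp only [mem_preimage, mem_Iio] at hx
    exact absurd (Finset.sum_nonneg fun i _ => h i) (not_le.mpr hx)
  · rw [integral_map (by fun_prop) (by fun_prop), hG.integral_exp_map]
    have h1 : ∀ x : Fin m → ℝ, Real.exp (-(n * ∑ i, x i)) = ∏ i, Real.exp (-(n * x i)) := by
      intro x
      rw [← Real.exp_sum, Finset.mul_sum, Finset.sum_neg_distrib]
    simp_rw [h1]
    rw [integral_fintype_prod_eq_pow (fun x => Real.exp (-(n * x))), hG'.integral_exp_map,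
      Fintype.card_fin]
    have h2 := (hG'.tendsto_laplace hrm hc0 hc (n.cast_nonneg : (0 : ℝ) ≤ n)).pow m
    refine tendsto_nhds_unique h2 ((hG.tendsto_laplace hr hc0 hc n.cast_nonneg).congr fun N => ?_)
    rw [← Finset.prod_pow]
    refine Finset.prod_congr rfl fun k _ => ?_
    have : 0 ≤ 1 + n * c k := by
      have := mul_nonneg (n.cast_nonneg : (0 : ℝ) ≤ n) (hc0 k).le
      linarith
    rw [← Real.rpow_natCast, ← Real.rpow_mul this]
    congr 1
    field_simp

end IsGammaSeq

/-! ### The laws of `S_2` and `S_2(δ)` -/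

lemma sinhFactor_pos {q : ℝ} (hq : 0 < q) : 0 < sinhFactor q := by
  have h : 0 < √(2 * q) := Real.sqrt_pos.mpr (by linarith)
  have := Real.sinh_pos_iff.mpr h
  unfold sinhFactor
  positivity

/-- Euler's product for the sine, evaluated at ix/π. -/
lemma tendsto_prod_sinh {x : ℝ} (hx : x ≠ 0) :
    Tendsto (fun N : ℕ => ∏ n ∈ Finset.range N, (1 + x ^ 2 / (Real.pi ^ 2 * ((n : ℝ) + 1) ^ 2)))
      atTop (𝓝 (Real.sinh x / x)) := by
  have hpi : (Real.pi : ℂ) ≠ 0 := by exact_mod_cast Real.pi_ne_zero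
  have hx' : (x : ℂ) ≠ 0 := by exact_mod_cast hx
  have h := Complex.tendsto_euler_sin_prod (x * Complex.I / Real.pi)
  have e1 : (Real.pi : ℂ) * (x * Complex.I / Real.pi) = x * Complex.I := by field_simp
  rw [e1, Complex.sin_mul_I] at h
  have h2 := h.div_const ((x : ℂ) * Complex.I)
  have h3 := (Complex.continuous_re.tendsto _).comp h2
  have e2 : (Complex.sinh x * Complex.I / (x * Complex.I)).re = Real.sinh x / x := by
    rw [mul_div_mul_right _ _ Complex.I_ne_zero, ← Complex.ofReal_sinh, ← Complex.ofReal_div,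
      Complex.ofReal_re]
  rw [e2] at h3
  refine h3.congr fun N => ?_
  simp only [Function.comp]
  rw [mul_div_cancel_left₀ _ (mul_ne_zero hx' Complex.I_ne_zero), ← Complex.ofReal_re
    (∏ n ∈ Finset.range N, (1 + x ^ 2 / (Real.pi ^ 2 * ((n : ℝ) + 1) ^ 2)))]
  congr 1
  push_cast
  refine Finset.prod_congr rfl fun n _ => ?_
  rw [div_pow, mul_pow, Complex.I_sq, mul_neg_one, neg_div, neg_div, sub_neg_eq_add, div_div]

lemma tendsto_prod_thetaEig {q : ℝ} (hq : 0 < q) :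
    Tendsto (fun N : ℕ => ∏ n ∈ Finset.range N, (1 + q / thetaEig n) ^ 2) atTop
      (𝓝 (sinhFactor q)) := by
  have h : 0 < √(2 * q) := Real.sqrt_pos.mpr (by linarith)
  refine ((tendsto_prod_sinh h.ne').pow 2).congr fun N => ?_
  rw [← Finset.prod_pow]
  refine Finset.prod_congr rfl fun n _ => ?_
  rw [Real.sq_sqrt (by linarith), thetaEig]
  congr 2
  field_simp

/-- The weights `1 / (π² n² / 2 + δ)`. -/
noncomputable def gammaWeight (δ : ℝ) (n : ℕ) : ℝ := 1 / (thetaEig n + δ)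

lemma gammaWeight_pos {δ : ℝ} (hδ : 0 ≤ δ) (n : ℕ) : 0 < gammaWeight δ n := by
  have := thetaEig_pos n
  unfold gammaWeight
  positivity

lemma summable_gammaWeight {δ : ℝ} (hδ : 0 ≤ δ) : Summable (gammaWeight δ) :=
  summable_inv_add_thetaEig hδ

lemma S2δ_eq_gammaSum {Ω : Type*} (G : ℕ → Ω → ℝ) (δ : ℝ) :
    S2δ G δ = gammaSum G (gammaWeight δ) := by
  ext ω
  simp only [S2δ, gammaSum, gammaWeight, thetaEig, mul_one_div]

lemma S2_eq_gammaSum {Ω : Type*} (G : ℕ → Ω → ℝ) : S2 G = gammaSum G (gammaWeight 0) := by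
  ext ω
  simp only [S2, gammaSum, gammaWeight, thetaEig, add_zero]
  rw [← tsum_mul_left]
  congr 1
  ext n
  field_simp

namespace IsGammaSeq

variable {Ω : Type*} [MeasurableSpace Ω] {P : Measure Ω} {G : ℕ → Ω → ℝ}

lemma measurable_S2 (hG : IsGammaSeq P G 2) : Measurable (S2 G) := by
  rw [S2_eq_gammaSum]; exact hG.measurable_gammaSum _

lemma measurable_S2δ (hG : IsGammaSeq P G 2) (δ : ℝ) : Measurable (S2δ G δ) := by
  rw [S2δ_eq_gammaSum]; exact hG.measurable_gammaSum _

lemma ae_S2_pos (hG : IsGammaSeq P G 2) : ∀ᵐ ω ∂P, 0 < S2 G ω := by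
  rw [S2_eq_gammaSum]
  exact hG.ae_gammaSum_pos two_pos (gammaWeight_pos le_rfl) (summable_gammaWeight le_rfl)

lemma ae_summable_S2 (hG : IsGammaSeq P G 2) :
    ∀ᵐ ω ∂P, Summable fun n : ℕ => G n ω / ((n : ℝ) + 1) ^ 2 := by
  have hs : Summable fun n : ℕ => 1 / ((n : ℝ) + 1) ^ 2 := by
    have := (summable_nat_add_iff 1).mpr (Real.summable_one_div_nat_pow.mpr one_lt_two)
    simpa using this
  have := hG.ae_summable two_pos (fun n => by positivity) hs
  simpa only [mul_one_div] using this

lemma ae_summable_S2δ (hG : IsGammaSeq P G 2) {δ : ℝ} (hδ : 0 < δ) :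
    ∀ᵐ ω ∂P, Summable fun n : ℕ => G n ω / (Real.pi ^ 2 * ((n : ℝ) + 1) ^ 2 / 2 + δ) := by
  have := hG.ae_summable two_pos (gammaWeight_pos hδ.le) (summable_gammaWeight hδ.le)
  simpa only [gammaWeight, thetaEig, mul_one_div] using this

variable [IsProbabilityMeasure P]

lemma integral_exp_S2 (hG : IsGammaSeq P G 2) {q : ℝ} (hq : 0 < q) :
    ∫ ω, Real.exp (-q * S2 G ω) ∂P = (sinhFactor q)⁻¹ := by
  rw [S2_eq_gammaSum]
  have h1 := hG.tendsto_laplace two_pos (gammaWeight_pos le_rfl) (summable_gammaWeight le_rfl) hq.le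
  refine tendsto_nhds_unique h1
    (((tendsto_prod_thetaEig hq).inv₀ (sinhFactor_pos hq).ne').congr fun N => ?_)
  rw [← Finset.prod_inv_distrib]
  refine Finset.prod_congr rfl fun n _ => ?_
  have := thetaEig_pos n
  rw [gammaWeight, add_zero, mul_one_div, Real.rpow_neg (by positivity), Real.rpow_two]

/-- Factor by factor, 1 + q/(λ_n+δ) = (1 + (q+δ)/λ_n) / (1 + δ/λ_n), and the two resulting products
have the limits c_{q+δ} and c_δ. -/
lemma integral_exp_S2δ (hG : IsGammaSeq P G 2) {δ q : ℝ} (hδ : 0 < δ) (hq : 0 ≤ q) :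
    ∫ ω, Real.exp (-q * S2δ G δ ω) ∂P =
      sinhFactor δ * ∫ ω, Real.exp (-(q + δ) * S2 G ω) ∂P := by
  rw [hG.integral_exp_S2 (by linarith), S2δ_eq_gammaSum]
  have h1 := hG.tendsto_laplace two_pos (gammaWeight_pos hδ.le) (summable_gammaWeight hδ.le) hq
  have h2 := (tendsto_prod_thetaEig hδ).mul ((tendsto_prod_thetaEig (by linarith : 0 < q + δ)).inv₀
    (sinhFactor_pos (by linarith)).ne')
  refine tendsto_nhds_unique h1 (h2.congr fun N => ?_)
  rw [← Finset.prod_inv_distrib, ← Finset.prod_mul_distrib]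
  refine Finset.prod_congr rfl fun n _ => ?_
  have := thetaEig_pos n
  rw [gammaWeight, mul_one_div, Real.rpow_neg (by positivity), Real.rpow_two, ← inv_pow, ← inv_pow,
    ← mul_pow]
  congr 1
  field_simp
  ring

lemma integral_exp_S2δ_eq_exp (hG : IsGammaSeq P G 2) {δ q : ℝ} (hδ : 0 < δ) (hq : 0 ≤ q) :
    ∫ ω, Real.exp (-q * S2δ G δ ω) ∂P =
      Real.exp (∫ t in Ioi (0 : ℝ), (Real.exp (-q * t) - 1) *
        (Real.exp (-δ * t) * (thetaJ (Real.pi * t / 2) - 1)) / t) := by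
  rw [S2δ_eq_gammaSum]
  have h1 := hG.tendsto_laplace two_pos (gammaWeight_pos hδ.le) (summable_gammaWeight hδ.le) hq
  have h2 := (Real.continuous_exp.tendsto _).comp (hasSum_integral_thetaJ hδ hq).tendsto_sum_nat
  refine tendsto_nhds_unique h1 (h2.congr fun N => ?_)
  simp only [Function.comp]
  rw [Real.exp_sum]
  refine Finset.prod_congr rfl fun n _ => ?_
  have := thetaEig_pos n
  rw [gammaWeight, mul_one_div, Real.rpow_def_of_pos (by positivity)]
  ring_nf

/-- The law of `S_2(δ)` is an exponential tilting of the law of `S_2`. -/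
lemma map_S2δ (hG : IsGammaSeq P G 2) {δ : ℝ} (hδ : 0 < δ) :
    P.map (S2δ G δ) = (P.map (S2 G)).withDensity
      fun x => ENNReal.ofReal (sinhFactor δ * Real.exp (-δ * x)) := by
  have hm := hG.measurable_S2
  have hmδ := hG.measurable_S2δ δ
  have hs := sinhFactor_pos hδ
  have hp : IsProbabilityMeasure (P.map (S2δ G δ)) :=
    Measure.isProbabilityMeasure_map hmδ.aemeasurable
  refine eq_of_lintegral_exp_neg_eq ?_ ?_ fun n => ?_
  · rw [S2δ_eq_gammaSum]
    exact hG.map_Iio_zero two_pos (gammaWeight_pos hδ.le) (summable_gammaWeight hδ.le)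
  · refine (withDensity_absolutelyContinuous _ _) ?_
    rw [S2_eq_gammaSum]
    exact hG.map_Iio_zero two_pos (gammaWeight_pos le_rfl) (summable_gammaWeight le_rfl)
  · have hint : ∀ {q : ℝ}, 0 ≤ q → ∀ {X : Ω → ℝ}, Measurable X → (∀ᵐ ω ∂P, 0 < X ω) →
        Integrable (fun ω => Real.exp (-q * X ω)) P := by
      intro q hq X hX hpos
      refine Integrable.of_bound (by fun_prop : Measurable _).aestronglyMeasurable 1 ?_
      filter_upwards [hpos] with ω hω
      rw [Real.norm_of_nonneg (Real.exp_pos _).le, Real.exp_le_one_iff]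
      nlinarith [mul_nonneg hq hω.le]
    have hδpos : ∀ᵐ ω ∂P, 0 < S2δ G δ ω := by
      rw [S2δ_eq_gammaSum]
      exact hG.ae_gammaSum_pos two_pos (gammaWeight_pos hδ.le) (summable_gammaWeight hδ.le)
    have hn : (0 : ℝ) ≤ n := n.cast_nonneg
    rw [lintegral_withDensity_eq_lintegral_mul _ (by fun_prop) (by fun_prop),
      lintegral_map (by fun_prop) hmδ]
    simp only [Pi.mul_apply, ← neg_mul]
    rw [lintegral_map (by fun_prop) hm, ← ofReal_integral_eq_lintegral_ofReal
      (hint hn hmδ hδpos) (ae_of_all _ fun _ => (Real.exp_pos _).le), hG.integral_exp_S2δ hδ hn,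
      ENNReal.ofReal_mul hs.le, ofReal_integral_eq_lintegral_ofReal
      (hint (by linarith) hm hG.ae_S2_pos) (ae_of_all _ fun _ => (Real.exp_pos _).le),
      ← lintegral_const_mul _ (by fun_prop)]
    refine lintegral_congr fun ω => ?_
    rw [← ENNReal.ofReal_mul hs.le, ← ENNReal.ofReal_mul (by positivity), mul_assoc, ← Real.exp_add]
    ring_nf

lemma exists_density_S2 (hG : IsGammaSeq P G 2) :
    ∃ f : ℝ → ℝ, Measurable f ∧ (∀ x, 0 ≤ f x) ∧
      P.map (S2 G) = (volume.restrict (Ioi 0)).withDensity (fun x => ENNReal.ofReal (f x)) := by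
  have hm := hG.measurable_S2
  have hp : IsProbabilityMeasure (P.map (S2 G)) := Measure.isProbabilityMeasure_map hm.aemeasurable
  have hac : P.map (S2 G) ≪ volume := by
    rw [S2_eq_gammaSum]
    exact hG.absolutelyContinuous_map two_pos (gammaWeight_pos le_rfl) (summable_gammaWeight le_rfl)
  refine ⟨fun x => ((P.map (S2 G)).rnDeriv volume x).toReal,
    (Measure.measurable_rnDeriv _ _).ennreal_toReal, fun x => ENNReal.toReal_nonneg, ?_⟩
  have h1 : P.map (S2 G) = volume.withDensity
      fun x => ENNReal.ofReal ((P.map (S2 G)).rnDeriv volume x).toReal := by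
    conv_lhs => rw [← Measure.withDensity_rnDeriv_eq _ _ hac]
    refine withDensity_congr_ae ?_
    filter_upwards [Measure.rnDeriv_lt_top (P.map (S2 G)) volume] with x hx
    rw [ENNReal.ofReal_toReal hx.ne]
  have h2 : (P.map (S2 G)).restrict (Ioi 0) = P.map (S2 G) := by
    refine Measure.restrict_eq_self_of_ae_mem ?_
    exact (ae_map_iff hm.aemeasurable measurableSet_Ioi).mpr hG.ae_S2_pos
  conv_lhs => rw [← h2]
  conv_lhs => rw [h1]
  rw [restrict_withDensity measurableSet_Ioi]

end IsGammaSeq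

/-! ### Mellin transforms -/

/-- A nonzero value rules out the default value 0 of a non-integrable function, so integrability is
automatic. -/
lemma lintegral_ofReal_of_integral_eq {α : Type*} [MeasurableSpace α] {μ : Measure α} {f : α → ℝ}
    {v : ℝ} (hf : 0 ≤ᵐ[μ] f) (h : ∫ x, f x ∂μ = v) (hv : v ≠ 0) :
    ∫⁻ x, ENNReal.ofReal (f x) ∂μ = ENNReal.ofReal v := by
  have hint : Integrable f μ := by
    by_contra hc
    exact hv (h ▸ integral_undef hc)
  rw [← ofReal_integral_eq_lintegral_ofReal hint hf, h]

/-- X^q = e^{q log X}: holomorphy of the Mellin transform is that of the moment generating function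
of log X. -/
lemma mellinE_eq_complexMGF_log {ν : Measure ℝ} (hν : ∀ᵐ x ∂ν, 0 < x) :
    mellinE ν = complexMGF Real.log ν := by
  ext q
  refine integral_congr_ae ?_
  filter_upwards [hν] with x hx
  rw [Complex.cpow_def_of_ne_zero (by exact_mod_cast hx.ne'), ← Complex.ofReal_log hx.le, mul_comm]

lemma differentiable_mellinE {ν : Measure ℝ} (hν : ∀ᵐ x ∂ν, 0 < x)
    (h : ∀ p : ℝ, Integrable (fun x : ℝ => x ^ p) ν) : Differentiable ℂ (mellinE ν) := by
  rw [mellinE_eq_complexMGF_log hν]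
  have huniv : integrableExpSet Real.log ν = univ := by
    ext p
    simp only [mem_univ, iff_true]
    refine (h p).congr ?_
    filter_upwards [hν] with x hx
    rw [Real.rpow_def_of_pos hx, mul_comm]
  have := differentiableOn_complexMGF (X := Real.log) (μ := ν)
  simpa [huniv, differentiableOn_univ] using this

lemma norm_cpow_ae {ν : Measure ℝ} (hν : ∀ᵐ x ∂ν, 0 < x) (q : ℂ) :
    ∀ᵐ (x : ℝ) ∂ν, ‖(x : ℂ) ^ q‖ = x ^ q.re := by
  filter_upwards [hν] with x hx
  exact Complex.norm_cpow_eq_rpow_re_of_pos hx q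

lemma integrable_cpow {ν : Measure ℝ} (hν : ∀ᵐ x ∂ν, 0 < x)
    (h : ∀ p : ℝ, Integrable (fun x : ℝ => x ^ p) ν) (q : ℂ) :
    Integrable (fun x : ℝ => (x : ℂ) ^ q) ν := by
  refine (h q.re).mono (by fun_prop : Measurable _).aestronglyMeasurable ?_
  filter_upwards [norm_cpow_ae hν q] with x hx
  rw [hx]
  exact le_abs_self _

/-- A negative power controls x ≤ 1, and an arbitrarily small increase of the exponential rate
controls x > 1. Mixed moments thus reduce to negative integer and exponential moments. -/
lemma rpow_mul_exp_le (p t : ℝ) {ε : ℝ} (hε : 0 < ε) :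
    ∃ (m : ℕ) (C : ℝ), 1 ≤ m ∧ ∀ x : ℝ, 0 < x →
      x ^ p * Real.exp (t * x) ≤ Real.exp |t| * x ^ (-(m : ℝ)) + C * Real.exp ((t + ε) * x) := by
  obtain ⟨m, hm⟩ := exists_nat_ge (max |p| 1)
  have hm1 : (1 : ℝ) ≤ m := (le_max_right _ _).trans hm
  have hmp : |p| ≤ m := (le_max_left _ _).trans hm
  rw [abs_le] at hmp
  refine ⟨m, m.factorial / ε ^ m, by exact_mod_cast hm1, fun x hx => ?_⟩
  rcases le_or_gt x 1 with h1 | h1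
  · have h2 : x ^ p ≤ x ^ (-(m : ℝ)) := Real.rpow_le_rpow_of_exponent_ge hx h1 hmp.1
    have h3 : Real.exp (t * x) ≤ Real.exp |t| := by
      rw [Real.exp_le_exp]
      calc t * x ≤ |t| * x := by gcongr; exact le_abs_self t
        _ ≤ |t| * 1 := by gcongr
        _ = |t| := mul_one _
    have h4 : x ^ p * Real.exp (t * x) ≤ x ^ (-(m : ℝ)) * Real.exp |t| := by gcongr
    have h5 : 0 ≤ m.factorial / ε ^ m * Real.exp ((t + ε) * x) := by positivity
    linarith
  · have h2 : x ^ p ≤ x ^ m := by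
      rw [← Real.rpow_natCast]
      exact Real.rpow_le_rpow_of_exponent_le h1.le hmp.2
    have h3 := Real.pow_div_factorial_le_exp (ε * x) (by positivity) m
    have h4 : x ^ m ≤ m.factorial / ε ^ m * Real.exp (ε * x) := by
      rw [div_le_iff₀ (by positivity), mul_pow] at h3
      rw [div_mul_eq_mul_div, le_div_iff₀ (by positivity)]
      linarith
    have h5 : x ^ p * Real.exp (t * x) ≤
        m.factorial / ε ^ m * Real.exp (ε * x) * Real.exp (t * x) := by
      gcongr
      exact h2.trans h4
    have h6 : Real.exp ((t + ε) * x) = Real.exp (ε * x) * Real.exp (t * x) := by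
      rw [← Real.exp_add]; ring_nf
    rw [h6]
    have h7 : 0 ≤ Real.exp |t| * x ^ (-(m : ℝ)) := by positivity
    linarith

/-- With y = √(2l) and r = e^{-2y}, y²/sinh² y = 4y² r/(1-r)², and r/(1-r)² = ∑ n rⁿ. The power
l^{1/2} is kept so that each term is of gamma-integral type in l. -/
lemma hasSum_inv_sinhFactor {l : ℝ} (hl : 0 < l) :
    HasSum (fun n : ℕ => 8 * l * (n * Real.exp (-(2 * √2 * n) * l ^ (1 / 2 : ℝ))))
      (sinhFactor l)⁻¹ := by
  set y := √(2 * l) with hy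
  have hy0 : 0 < y := Real.sqrt_pos.mpr (by linarith)
  have hy2 : y ^ 2 = 2 * l := Real.sq_sqrt (by linarith)
  have hyl : y = √2 * l ^ (1 / 2 : ℝ) := by
    rw [hy, Real.sqrt_mul zero_le_two, Real.sqrt_eq_rpow l]
  set r := Real.exp (-(2 * y)) with hr
  have hr1 : r < 1 := by rw [hr, Real.exp_lt_one_iff]; linarith
  have hr0 : 0 < r := Real.exp_pos _
  have h := (hasSum_coe_mul_geometric_of_norm_lt_one (r := r)
    (by rw [Real.norm_of_nonneg hr0.le]; exact hr1)).mul_left (8 * l)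
  have e : (sinhFactor l)⁻¹ = 8 * l * (r / (1 - r) ^ 2) := by
    have h1 : Real.exp y * Real.exp (-y) = 1 := by rw [← Real.exp_add]; simp
    have h2 : r = Real.exp (-y) ^ 2 := by rw [hr, ← Real.exp_nat_mul]; congr 1; push_cast; ring
    have h3 : Real.sinh y = (1 - r) / (2 * Real.exp (-y)) := by
      have := Real.exp_pos (-y)
      rw [Real.sinh_eq, h2]
      field_simp
      linear_combination h1
    have h4 : 1 - r ≠ 0 := by linarith
    have h5 := (Real.exp_pos (-y)).ne'
    rw [sinhFactor, ← hy, h3]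
    rw [show 8 * l = 4 * y ^ 2 by rw [hy2]; ring]
    rw [show 4 * y ^ 2 * (r / (1 - r) ^ 2) = 4 * y ^ 2 * (Real.exp (-y) ^ 2 / (1 - r) ^ 2) by
      rw [← h2]]
    field_simp
    norm_num
  rw [e]
  refine h.congr_fun fun n => ?_
  rw [hr, ← Real.exp_nat_mul, hyl]
  ring_nf

/-- The properties of the law of `S_2` that determine its Mellin transform. -/
structure IsS2Law (μ : Measure ℝ) : Prop where
  prob : IsProbabilityMeasure μ
  pos : ∀ᵐ x ∂μ, 0 < x
  laplace : ∀ q : ℝ, 0 < q → ∫ x, Real.exp (-q * x) ∂μ = (sinhFactor q)⁻¹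
  expMoment : ∀ t : ℝ, 0 ≤ t → t < Real.pi ^ 2 / 2 → Integrable (fun x => Real.exp (t * x)) μ

lemma IsGammaSeq.isS2Law {Ω : Type*} [MeasurableSpace Ω] {P : Measure Ω} [IsProbabilityMeasure P]
    {G : ℕ → Ω → ℝ} (hG : IsGammaSeq P G 2) : IsS2Law (P.map (S2 G)) where
  prob := Measure.isProbabilityMeasure_map hG.measurable_S2.aemeasurable
  pos := (ae_map_iff hG.measurable_S2.aemeasurable measurableSet_Ioi).mpr hG.ae_S2_pos
  laplace q hq := by
    rw [integral_map hG.measurable_S2.aemeasurable (by fun_prop), hG.integral_exp_S2 hq]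
  expMoment t ht0 ht := by
    rw [integrable_map_measure (by fun_prop) hG.measurable_S2.aemeasurable, S2_eq_gammaSum]
    have hpi := Real.pi_pos
    -- The largest weight is 2/π², at index 0, so t < π²/2 leaves the uniform gap κ.
    refine hG.integrable_exp_gammaSum two_pos (gammaWeight_pos le_rfl) (summable_gammaWeight le_rfl)
      (κ := 1 - t / (Real.pi ^ 2 / 2)) ht0 ?_ fun n => ?_
    · rw [sub_pos, div_lt_one (by positivity)]
      exact ht
    · rw [sub_sub_cancel, gammaWeight, add_zero, mul_one_div]
      refine div_le_div_of_nonneg_left ht0 (by positivity) ?_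
      have : (1 : ℝ) ≤ ((n : ℝ) + 1) ^ 2 := by
        have : (0 : ℝ) ≤ n := n.cast_nonneg
        nlinarith
      rw [thetaEig]
      nlinarith [sq_nonneg Real.pi]

namespace IsS2Law

variable {μ : Measure ℝ}

/-- Γ(s) E[S^{-s}] = ∫ l^{s-1} E[e^{-lS}] dl by Tonelli. In the expansion of the Laplace transform,
the n-th term integrates to a multiple of n · n^{-(2s+2)} = n^{-(2s+1)}. Working with nonnegative
integrals makes finiteness of negative moments part of the result. -/
lemma lintegral_rpow_neg (hμ : IsS2Law μ) {s : ℝ} (hs : 0 < s) :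
    ∫⁻ x, ENNReal.ofReal (x ^ (-s)) ∂μ = ENNReal.ofReal
      (2 * 8 ^ (-s) * Real.Gamma (2 * s + 2) / Real.Gamma s * ∑' n : ℕ, 1 / (n : ℝ) ^ (2 * s + 1)) := by
  have := hμ.prob
  have hΓ := Real.Gamma_pos_of_pos hs
  have hΓ2 := Real.Gamma_pos_of_pos (by linarith : 0 < 2 * s + 2)
  have hA : ∫⁻ x, ENNReal.ofReal (x ^ (-s)) * ENNReal.ofReal (Real.Gamma s) ∂μ =
      ∫⁻ l in Ioi (0 : ℝ), ∫⁻ x, ENNReal.ofReal (l ^ (s - 1) * Real.exp (-(x * l))) ∂μ := by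
    rw [lintegral_lintegral_swap (by fun_prop)]
    refine lintegral_congr_ae ?_
    filter_upwards [hμ.pos] with x hx
    rw [lintegral_ofReal_of_integral_eq _ (Real.integral_rpow_mul_exp_neg_mul_Ioi hs hx)
      (by positivity), ENNReal.ofReal_mul (by positivity), Real.rpow_neg hx.le,
      ← Real.inv_rpow hx.le, one_div]
    exact (ae_restrict_iff' measurableSet_Ioi).mpr (ae_of_all _ fun l hl =>
      mul_nonneg (Real.rpow_nonneg (le_of_lt hl) _) (Real.exp_pos _).le)
  have hB : ∀ l ∈ Ioi (0 : ℝ), ∫⁻ x, ENNReal.ofReal (l ^ (s - 1) * Real.exp (-(x * l))) ∂μ =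
      ∑' n : ℕ, ENNReal.ofReal (8 * n) *
        ENNReal.ofReal (l ^ s * Real.exp (-(2 * √2 * n) * l ^ (1 / 2 : ℝ))) := by
    intro l hl
    have hl : 0 < l := hl
    have hsum := hasSum_inv_sinhFactor hl
    have h1 : ∀ x : ℝ, ENNReal.ofReal (l ^ (s - 1) * Real.exp (-(x * l))) =
        ENNReal.ofReal (l ^ (s - 1)) * ENNReal.ofReal (Real.exp (-l * x)) := by
      intro x
      rw [ENNReal.ofReal_mul (by positivity)]
      ring_nf
    simp_rw [h1]
    rw [lintegral_const_mul _ (by fun_prop), lintegral_ofReal_of_integral_eq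
      (ae_of_all _ fun _ => (Real.exp_pos _).le) (hμ.laplace l hl)
      (inv_pos.mpr (sinhFactor_pos hl)).ne', ← hsum.tsum_eq, ENNReal.ofReal_tsum_of_nonneg
      (fun n => by positivity) hsum.summable, ← ENNReal.tsum_mul_left]
    congr 1
    ext n
    rw [← ENNReal.ofReal_mul (by positivity), ← ENNReal.ofReal_mul (by positivity)]
    congr 1
    have : l ^ s = l ^ (s - 1) * l := by
      rw [← Real.rpow_add_one hl.ne']; ring_nf
    rw [this]
    ring
  have hC : ∀ n : ℕ, ENNReal.ofReal (8 * n) * ∫⁻ l in Ioi (0 : ℝ),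
      ENNReal.ofReal (l ^ s * Real.exp (-(2 * √2 * n) * l ^ (1 / 2 : ℝ))) =
      ENNReal.ofReal (2 * 8 ^ (-s) * Real.Gamma (2 * s + 2) * (1 / (n : ℝ) ^ (2 * s + 1))) := by
    intro n
    rcases Nat.eq_zero_or_pos n with rfl | hn
    · have : 2 * s + 1 ≠ 0 := by linarith
      simp [Real.zero_rpow this]
    have hn' : (0 : ℝ) < n := by exact_mod_cast hn
    have h := integral_rpow_mul_exp_neg_mul_rpow (p := 1 / 2) (q := s) (b := 2 * √2 * n)
      (by norm_num) (by linarith) (by positivity)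
    have e1 : -(s + 1) / (1 / 2) = -(2 * s + 2) := by ring
    have e2 : (s + 1) / (1 / 2) = 2 * s + 2 := by ring
    rw [e1, e2] at h
    rw [lintegral_ofReal_of_integral_eq _ h (by positivity), ← ENNReal.ofReal_mul (by positivity)]
    · congr 1
      have h8 : (2 * √2 : ℝ) ^ (-(2 * s + 2)) = 8 ^ (-s) / 8 := by
        have : (2 * √2 : ℝ) = 8 ^ (1 / 2 : ℝ) := by
          rw [← Real.sqrt_eq_rpow, show (8 : ℝ) = 2 ^ 2 * 2 by norm_num,
            Real.sqrt_mul (by norm_num), Real.sqrt_sq zero_le_two]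
        rw [this, ← Real.rpow_mul (by norm_num), show (1 / 2 : ℝ) * -(2 * s + 2) = -s - 1 by ring,
          Real.rpow_sub_one (by norm_num)]
      have hnn : (n : ℝ) ^ (-(2 * s + 2)) = 1 / (n : ℝ) ^ (2 * s + 1) / n := by
        rw [show -(2 * s + 2) = -(2 * s + 1) - 1 by ring, Real.rpow_sub_one hn'.ne',
          Real.rpow_neg hn'.le, one_div]
      rw [Real.mul_rpow (by positivity) hn'.le, h8, hnn]
      field_simp
    · exact (ae_restrict_iff' measurableSet_Ioi).mpr (ae_of_all _ fun l hl =>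
        mul_nonneg (Real.rpow_nonneg (le_of_lt hl) _) (Real.exp_pos _).le)
  have hC' : ∀ n : ℕ, ∫⁻ l in Ioi (0 : ℝ), ENNReal.ofReal (8 * n) *
      ENNReal.ofReal (l ^ s * Real.exp (-(2 * √2 * n) * l ^ (1 / 2 : ℝ))) =
      ENNReal.ofReal (2 * 8 ^ (-s) * Real.Gamma (2 * s + 2) * (1 / (n : ℝ) ^ (2 * s + 1))) := by
    intro n
    rw [lintegral_const_mul _ (by fun_prop), hC n]
  rw [lintegral_mul_const _ (by fun_prop), setLIntegral_congr_fun measurableSet_Ioi hB,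
    lintegral_tsum fun n => by fun_prop] at hA
  simp_rw [hC'] at hA
  have hsummable : Summable fun n : ℕ => 1 / (n : ℝ) ^ (2 * s + 1) :=
    Real.summable_one_div_nat_rpow.mpr (by linarith)
  rw [← ENNReal.ofReal_tsum_of_nonneg (fun n => by positivity) (hsummable.mul_left _),
    tsum_mul_left] at hA
  have hΓ' : ENNReal.ofReal (Real.Gamma s) ≠ 0 := by simpa using hΓ
  rw [← ENNReal.mul_left_inj hΓ' ENNReal.ofReal_ne_top, hA, ← ENNReal.ofReal_mul' hΓ.le]
  congr 1
  field_simp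

lemma integrable_rpow_mul_exp (hμ : IsS2Law μ) (p : ℝ) {t : ℝ} (ht : t < Real.pi ^ 2 / 2) :
    Integrable (fun x => x ^ p * Real.exp (t * x)) μ := by
  have hpi : 0 < Real.pi ^ 2 / 2 := by positivity
  obtain ⟨t', h1, h2⟩ := exists_between (max_lt ht hpi)
  have ht' : t < t' := (le_max_left _ _).trans_lt h1
  have ht0 : 0 < t' := (le_max_right _ _).trans_lt h1
  obtain ⟨m, C, hm, hb⟩ := rpow_mul_exp_le p t (sub_pos.mpr ht')
  rw [add_sub_cancel] at hb
  have hneg : Integrable (fun x : ℝ => x ^ (-(m : ℝ))) μ := by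
    refine ⟨by fun_prop, ?_⟩
    rw [hasFiniteIntegral_iff_ofReal (by
      filter_upwards [hμ.pos] with x hx using Real.rpow_nonneg hx.le _),
      hμ.lintegral_rpow_neg (by exact_mod_cast hm)]
    exact ENNReal.ofReal_lt_top
  refine ((hneg.const_mul (Real.exp |t|)).add ((hμ.expMoment t' ht0.le h2).const_mul C)).mono
    (by fun_prop : Measurable _).aestronglyMeasurable ?_
  filter_upwards [hμ.pos] with x hx
  rw [Real.norm_of_nonneg (by positivity)]
  exact (hb x hx).trans (le_abs_self _)

lemma integrable_rpow (hμ : IsS2Law μ) (p : ℝ) : Integrable (fun x => x ^ p) μ := by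
  simpa using hμ.integrable_rpow_mul_exp p (t := 0) (by positivity)

end IsS2Law

/-! ### The ξ function and the Mellin transform of S_2 -/

lemma differentiable_xiR : Differentiable ℂ xiR := by
  have := differentiable_completedZeta₀
  unfold xiR
  fun_prop

lemma xiR_one_sub (s : ℂ) : xiR (1 - s) = xiR s := by
  rw [xiR, xiR, completedRiemannZeta₀_one_sub]
  ring

/-- Legendre duplication, bringing the computed moment to the gamma factor Γ((2s+1)/2) of ξ(2s+1).
-/
lemma Real.Gamma_two_mul_add_two_div_Gamma {s : ℝ} (hs : 0 < s) :
    2 * 8 ^ (-s) * Real.Gamma (2 * s + 2) / Real.Gamma s =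
      2 ^ (-s) * ((2 * s + 1) * (2 * s) * Real.Gamma (s + 1 / 2) / √Real.pi) := by
  have hΓ := (Real.Gamma_pos_of_pos hs).ne'
  have hpi : √Real.pi ≠ 0 := (Real.sqrt_pos.mpr Real.pi_pos).ne'
  have h1 := Real.Gamma_mul_Gamma_add_half s
  have h2 : Real.Gamma (2 * s + 2) = (2 * s + 1) * (2 * s * Real.Gamma (2 * s)) := by
    rw [← Real.Gamma_add_one (by positivity), ← Real.Gamma_add_one (by positivity)]
    ring_nf
  have h3 : (8 : ℝ) ^ (-s) = 2 ^ (-s) * (2 ^ (1 - 2 * s) / 2) := by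
    rw [show (8 : ℝ) = 2 ^ (3 : ℝ) by norm_num, ← Real.rpow_mul zero_le_two,
      ← Real.rpow_sub_one two_ne_zero, ← Real.rpow_add two_pos]
    ring_nf
  rw [h2, h3, div_eq_iff hΓ]
  have h4 : Real.Gamma (s + 1 / 2) / √Real.pi * Real.Gamma s =
      Real.Gamma (2 * s) * 2 ^ (1 - 2 * s) := by
    rw [div_mul_eq_mul_div, div_eq_iff hpi, mul_comm, h1]
  linear_combination -(2 ^ (-s) * ((2 * s + 1) * (2 * s))) * h4

/-- The functional equation moves -2s to 2s+1 > 1, where ζ is its Dirichlet series. -/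
lemma two_mul_xiR_neg {s : ℝ} (hs : 0 < s) :
    ((2 / Real.pi : ℝ) : ℂ) ^ ((-s : ℝ) : ℂ) * (2 * xiR (2 * ((-s : ℝ) : ℂ))) =
      ((2 * 8 ^ (-s) * Real.Gamma (2 * s + 2) / Real.Gamma s *
        ∑' n : ℕ, 1 / (n : ℝ) ^ (2 * s + 1) : ℝ) : ℂ) := by
  have hpi := Real.pi_pos
  have hz : riemannZeta ((2 * s + 1 : ℝ) : ℂ) = ((∑' n : ℕ, 1 / (n : ℝ) ^ (2 * s + 1) : ℝ) : ℂ) := by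
    rw [zeta_eq_tsum_one_div_nat_cpow (by rw [Complex.ofReal_re]; linarith), Complex.ofReal_tsum]
    congr 1
    ext n
    push_cast [Complex.ofReal_cpow (n.cast_nonneg)]
    rfl
  have h1 : (2 * ((-s : ℝ) : ℂ)) = 1 - ((2 * s + 1 : ℝ) : ℂ) := by push_cast; ring
  have h2 : ((2 * s + 1 : ℝ) : ℂ) ≠ 1 := by
    norm_cast
    linarith
  have h3 : ∀ n : ℕ, ((2 * s + 1 : ℝ) : ℂ) ≠ -(2 * n) := by
    intro n h
    have : (2 * s + 1 : ℝ) = -(2 * n) := by exact_mod_cast h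
    have hn : (0 : ℝ) ≤ n := n.cast_nonneg
    linarith
  rw [h1, xiR_one_sub, xiR_eq _ h2 h3, hz, Real.Gamma_two_mul_add_two_div_Gamma hs]
  have h4 : Complex.Gamma (((2 * s + 1 : ℝ) : ℂ) / 2) = (Real.Gamma (s + 1 / 2) : ℝ) := by
    rw [← Complex.Gamma_ofReal]
    congr 1
    push_cast
    ring
  have h5 : (Real.pi : ℂ) ^ (-((2 * s + 1 : ℝ) : ℂ) / 2) =
      ((Real.pi ^ (-s) / √Real.pi : ℝ) : ℂ) := by
    rw [Real.sqrt_eq_rpow, ← Real.rpow_sub hpi, Complex.ofReal_cpow hpi.le]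
    congr 1
    push_cast
    ring
  rw [h4, h5, ← Complex.ofReal_cpow (by positivity)]
  have h6 : (2 / Real.pi : ℝ) ^ (-s) * Real.pi ^ (-s) = 2 ^ (-s) := by
    rw [← Real.mul_rpow (by positivity) hpi.le, div_mul_cancel₀ _ hpi.ne']
  rw [← h6]
  push_cast
  ring

namespace IsS2Law

variable {μ : Measure ℝ}

lemma mellinE_eq (hμ : IsS2Law μ) (q : ℂ) :
    mellinE μ q = ((2 / Real.pi : ℝ) : ℂ) ^ q * (2 * xiR (2 * q)) := by
  have hpi : ((2 / Real.pi : ℝ) : ℂ) ≠ 0 := by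
    have := Real.pi_pos
    exact_mod_cast (by positivity : 2 / Real.pi ≠ 0)
  have hd : Differentiable ℂ fun q : ℂ => ((2 / Real.pi : ℝ) : ℂ) ^ q * (2 * xiR (2 * q)) := by
    intro q
    have := differentiable_xiR
    have h1 : DifferentiableAt ℂ (fun q : ℂ => ((2 / Real.pi : ℝ) : ℂ) ^ q) q :=
      differentiableAt_id.const_cpow (Or.inl hpi)
    fun_prop
  -- Any negative base point would do: the moments are known on the negative axis and both sides are
  -- entire.
  refine eqOn_of_eventually_eq_ofReal (x₀ := -2) isOpen_univ isPreconnected_univ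
    (differentiable_mellinE hμ.pos hμ.integrable_rpow).differentiableOn hd.differentiableOn
    (mem_univ _) ?_ (mem_univ q)
  filter_upwards [mem_nhdsWithin_of_mem_nhds (Iio_mem_nhds (by norm_num : (-2 : ℝ) < 0))]
    with x (hx : x < 0)
  obtain ⟨s, rfl⟩ : ∃ s, x = -s := ⟨-x, by simp⟩
  have hs : 0 < s := by linarith
  rw [two_mul_xiR_neg hs]
  have h := hμ.lintegral_rpow_neg hs
  have h0 : 0 ≤ᵐ[μ] fun x => x ^ (-s) := by
    filter_upwards [hμ.pos] with x hx using Real.rpow_nonneg hx.le _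
  rw [← ofReal_integral_eq_lintegral_ofReal (hμ.integrable_rpow _) h0,
    ENNReal.ofReal_eq_ofReal_iff (integral_nonneg_of_ae h0) ?_] at h
  · rw [← h, mellinE, ← integral_complex_ofReal]
    refine integral_congr_ae ?_
    filter_upwards [hμ.pos] with x hx
    rw [Complex.ofReal_cpow hx.le]
  · have := Real.Gamma_pos_of_pos hs
    have := Real.Gamma_pos_of_pos (by linarith : 0 < 2 * s + 2)
    exact mul_nonneg (by positivity) (tsum_nonneg fun n => by positivity)

lemma integrable_cpow_mul_exp (hμ : IsS2Law μ) (q : ℂ) {t : ℝ} (ht : t < Real.pi ^ 2 / 2) :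
    Integrable (fun x : ℝ => (x : ℂ) ^ q * (Real.exp (t * x) : ℂ)) μ := by
  refine (hμ.integrable_rpow_mul_exp q.re ht).mono
    (by fun_prop : Measurable _).aestronglyMeasurable ?_
  filter_upwards [norm_cpow_ae hμ.pos q] with x hx
  rw [norm_mul, hx, Complex.norm_real, Real.norm_of_nonneg (Real.exp_pos _).le]
  exact le_abs_self _

/-- Expand e^{-δx} and integrate termwise. Absolute convergence needs E[S^{Re q} e^{δS}] < ∞, which
is where δ < π²/2 enters. -/
lemma hasSum_xiTerm (hμ : IsS2Law μ) {δ : ℝ} (hδ : 0 < δ) (hδ' : δ < Real.pi ^ 2 / 2) (q : ℂ) :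
    HasSum (fun n => ((2 / Real.pi : ℝ) : ℂ) ^ q * xiTerm δ q n)
      (∫ x : ℝ, (x : ℂ) ^ q * (Real.exp (-δ * x) : ℂ) ∂μ) := by
  set F : ℕ → ℝ → ℂ := fun n x => (x : ℂ) ^ q * (((-δ * x) ^ n / n.factorial : ℝ) : ℂ) with hF
  have hFnorm : ∀ n, ∀ᵐ x ∂μ, ‖F n x‖ = x ^ q.re * ((δ * x) ^ n / n.factorial) := by
    intro n
    filter_upwards [norm_cpow_ae hμ.pos q, hμ.pos] with x hx hx0
    rw [hF, norm_mul, hx, Complex.norm_real, norm_div, norm_pow, norm_mul, norm_neg,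
      Real.norm_of_nonneg hδ.le, Real.norm_of_nonneg hx0.le,
      Real.norm_of_nonneg (by positivity : (0 : ℝ) ≤ n.factorial)]
  have hFq : ∀ n, ∀ᵐ x ∂μ, F n x = (((-δ) ^ n / n.factorial : ℝ) : ℂ) * (x : ℂ) ^ (q + n) := by
    intro n
    filter_upwards [hμ.pos] with x hx0
    rw [Complex.cpow_add _ _ (by exact_mod_cast hx0.ne'), Complex.cpow_natCast, hF]
    push_cast
    rw [mul_pow]
    ring
  have hFint : ∀ n, Integrable (F n) μ := fun n =>
    ((integrable_cpow hμ.pos hμ.integrable_rpow (q + n)).const_mul _).congr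
      ((hFq n).mono fun x hx => hx.symm)
  have hsum : Summable fun n => ∫ x, ‖F n x‖ ∂μ := by
    refine summable_of_sum_range_le (c := ∫ x, x ^ q.re * Real.exp (δ * x) ∂μ)
      (fun n => integral_nonneg fun x => norm_nonneg _) fun N => ?_
    rw [← integral_finsetSum _ fun n _ => (hFint n).norm]
    refine integral_mono_ae (integrable_finsetSum _ fun n _ => (hFint n).norm)
      (hμ.integrable_rpow_mul_exp q.re hδ') ?_
    filter_upwards [ae_all_iff.mpr hFnorm, hμ.pos] with x hx hx0
    simp_rw [hx, ← Finset.mul_sum]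
    gcongr
    exact Real.sum_le_exp_of_nonneg (by positivity) N
  have h := hasSum_integral_of_summable_integral_norm hFint hsum
  have e1 : ∀ n, ∫ x, F n x ∂μ = ((2 / Real.pi : ℝ) : ℂ) ^ q * xiTerm δ q n := by
    intro n
    have hpi : ((2 / Real.pi : ℝ) : ℂ) ≠ 0 := by
      have := Real.pi_pos
      exact_mod_cast (by positivity : 2 / Real.pi ≠ 0)
    rw [integral_congr_ae (hFq n), integral_const_mul]
    change _ * mellinE μ (q + n) = _
    rw [hμ.mellinE_eq, Complex.cpow_add _ _ hpi, Complex.cpow_natCast, xiTerm, mul_add 2 q]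
    have : ((-2 * δ / Real.pi : ℝ) : ℂ) = ((-δ : ℝ) : ℂ) * ((2 / Real.pi : ℝ) : ℂ) := by
      rw [← Complex.ofReal_mul]
      congr 1
      ring
    rw [this, mul_pow]
    push_cast
    ring
  simp_rw [e1] at h
  have e2 : ∫ x : ℝ, (x : ℂ) ^ q * (Real.exp (-δ * x) : ℂ) ∂μ = ∫ x, ∑' n, F n x ∂μ := by
    refine integral_congr_ae (ae_of_all _ fun x => ?_)
    have hx : HasSum (fun n : ℕ => (-δ * x) ^ n / n.factorial) (Real.exp (-δ * x)) := by
      rw [Real.exp_eq_exp_ℝ]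
      exact NormedSpace.expSeries_div_hasSum_exp _
    exact ((Complex.hasSum_ofReal.mpr hx).mul_left ((x : ℂ) ^ q)).tsum_eq.symm
  rw [e2]
  exact h

lemma summable_xiTerm (hμ : IsS2Law μ) {δ : ℝ} (hδ : 0 < δ) (hδ' : δ < Real.pi ^ 2 / 2) (q : ℂ) :
    Summable (xiTerm δ q) := by
  refine (summable_mul_left_iff ?_).mp (hμ.hasSum_xiTerm hδ hδ' q).summable
  have := Real.pi_pos
  rw [Complex.cpow_ne_zero_iff]
  exact Or.inl (by exact_mod_cast (by positivity : 2 / Real.pi ≠ 0))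

lemma integral_cpow_mul_exp (hμ : IsS2Law μ) {δ : ℝ} (hδ : 0 < δ) (hδ' : δ < Real.pi ^ 2 / 2)
    (q : ℂ) : ∫ x : ℝ, (x : ℂ) ^ q * (Real.exp (-δ * x) : ℂ) ∂μ =
      ((2 / Real.pi : ℝ) : ℂ) ^ q * ∑' n, xiTerm δ q n := by
  rw [← tsum_mul_left, (hμ.hasSum_xiTerm hδ hδ' q).tsum_eq]

/-- The factor c_δ is the inverse of the same integral at q = 0, so one dominated convergence
argument handles both factors. -/
lemma tendsto_integral_cpow_mul_exp (hμ : IsS2Law μ) (q : ℂ) :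
    Tendsto (fun δ : ℝ => (sinhFactor δ : ℂ) * ∫ x : ℝ, (x : ℂ) ^ q * (Real.exp (-δ * x) : ℂ) ∂μ)
      (𝓝[>] 0) (𝓝 (mellinE μ q)) := by
  have := hμ.prob
  have key : ∀ q : ℂ, Tendsto
      (fun δ : ℝ => ∫ x : ℝ, (x : ℂ) ^ q * (Real.exp (-δ * x) : ℂ) ∂μ)
      (𝓝[>] 0) (𝓝 (∫ x : ℝ, (x : ℂ) ^ q ∂μ)) := by
    intro q
    refine tendsto_integral_filter_of_dominated_convergence (fun x => x ^ q.re) ?_ ?_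
      (hμ.integrable_rpow _) ?_
    · exact .of_forall fun δ => (by fun_prop : Measurable _).aestronglyMeasurable
    · filter_upwards [self_mem_nhdsWithin] with δ (hδ : 0 < δ)
      filter_upwards [norm_cpow_ae hμ.pos q, hμ.pos] with x hx hx0
      rw [norm_mul, hx, Complex.norm_real, Real.norm_of_nonneg (Real.exp_pos _).le]
      refine mul_le_of_le_one_right (by positivity) (Real.exp_le_one_iff.mpr ?_)
      nlinarith
    · refine ae_of_all _ fun x => ?_
      have : Continuous fun δ : ℝ => (x : ℂ) ^ q * (Real.exp (-δ * x) : ℂ) := by fun_prop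
      have := (this.tendsto 0).mono_left (nhdsWithin_le_nhds (s := Ioi 0))
      simpa using this
  have h0 := (key 0).inv₀ (by simp)
  have h := h0.mul (key q)
  simp only [Complex.cpow_zero, one_mul, integral_const, probReal_univ, one_smul, inv_one] at h
  refine h.congr' ?_
  filter_upwards [self_mem_nhdsWithin] with δ (hδ : 0 < δ)
  rw [integral_complex_ofReal, hμ.laplace δ hδ, Complex.ofReal_inv, inv_inv]

end IsS2Law

/-! ### The law of `T(δ)` -/

/-- The measure with density `δ e^{-δx} c_δ μ((-∞, x))` on `(0, ∞)`. -/
noncomputable def lawT (μ : Measure ℝ) (δ : ℝ) : Measure ℝ :=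
  (volume.restrict (Ioi 0)).withDensity fun x =>
    ENNReal.ofReal (δ * Real.exp (-δ * x) * sinhFactor δ * μ.real (Iio x))

lemma lawT_compl_Ioi (μ : Measure ℝ) (δ : ℝ) : lawT μ δ (Ioi 0)ᶜ = 0 := by
  refine withDensity_absolutelyContinuous _ _ ?_
  rw [Measure.restrict_apply measurableSet_Ioi.compl, compl_inter_self, measure_empty]

lemma ae_lawT_pos (μ : Measure ℝ) (δ : ℝ) : ∀ᵐ x ∂(lawT μ δ), 0 < x := lawT_compl_Ioi μ δ

lemma measurable_real_Iio (μ : Measure ℝ) [IsFiniteMeasure μ] :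
    Measurable fun x => μ.real (Iio x) :=
  Monotone.measurable fun _ _ h => measureReal_mono (Iio_subset_Iio h)

lemma measurable_lawT_density (μ : Measure ℝ) [IsFiniteMeasure μ] (δ : ℝ) :
    Measurable fun x => ENNReal.ofReal (δ * Real.exp (-δ * x) * sinhFactor δ * μ.real (Iio x)) := by
  have := measurable_real_Iio μ
  fun_prop

section

variable {μ : Measure ℝ} {δ : ℝ} {E : Type*} [NormedAddCommGroup E] [NormedSpace ℝ E]

lemma integrable_lawT_iff [IsFiniteMeasure μ] (hδ : 0 < δ) {f : ℝ → E} :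
    Integrable f (lawT μ δ) ↔ IntegrableOn (fun x =>
      (δ * Real.exp (-δ * x) * sinhFactor δ * μ.real (Iio x)) • f x) (Ioi 0) := by
  have hs := sinhFactor_pos hδ
  rw [lawT, integrable_withDensity_iff_integrable_smul' (measurable_lawT_density μ δ)
    (ae_of_all _ fun _ => ENNReal.ofReal_lt_top)]
  refine integrable_congr (ae_of_all _ fun x => ?_)
  simp only
  rw [ENNReal.toReal_ofReal (by positivity)]

/-- Write μ((-∞, x)) as the integral of 1_{s<x} and apply Fubini. Identities for T then reduce to
inner integrals over (s, ∞). -/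
lemma integral_lawT [CompleteSpace E] [IsFiniteMeasure μ] (hμ : ∀ᵐ x ∂μ, 0 < x) (hδ : 0 < δ) {f : ℝ → E}
    (hfm : StronglyMeasurable f) (hf : Integrable f (lawT μ δ)) :
    ∫ x, f x ∂(lawT μ δ) =
      ∫ s, (∫ x in Ioi s, (δ * Real.exp (-δ * x) * sinhFactor δ) • f x) ∂μ := by
  have hs := sinhFactor_pos hδ
  set k : ℝ → ℝ := fun x => δ * Real.exp (-δ * x) * sinhFactor δ with hk
  have hk0 : ∀ x, 0 ≤ k x := fun x => by positivity
  have hkm : StronglyMeasurable k := (by fun_prop : Continuous k).stronglyMeasurable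
  set F : ℝ → ℝ → E := fun x s => (Iio x).indicator (fun _ => k x • f x) s with hF
  have hFm : StronglyMeasurable (Function.uncurry F) := by
    have h1 : StronglyMeasurable fun p : ℝ × ℝ => k p.1 • f p.1 :=
      (hkm.smul hfm).comp_measurable measurable_fst
    have := h1.indicator (measurableSet_lt measurable_snd measurable_fst)
    convert this using 1
    ext p
    simp only [Function.uncurry, hF, indicator_apply, mem_Iio, mem_ofPred_eq]
  have hF1 : ∀ x, ∫ s, F x s ∂μ = (k x * μ.real (Iio x)) • f x := by
    intro x
    rw [hF, integral_indicator measurableSet_Iio, setIntegral_const, smul_smul, mul_comm]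
  have hFn : ∀ x, ∫ s, ‖F x s‖ ∂μ = ‖(k x * μ.real (Iio x)) • f x‖ := by
    intro x
    have : ∀ s, ‖F x s‖ = (Iio x).indicator (fun _ => ‖k x • f x‖) s := fun s =>
      norm_indicator_eq_indicator_norm _ _
    simp_rw [this]
    rw [integral_indicator measurableSet_Iio, setIntegral_const, norm_smul, norm_smul,
      norm_mul (k x), Real.norm_of_nonneg (measureReal_nonneg (μ := μ)), smul_eq_mul]
    ring
  have hint := (integrable_lawT_iff hδ).mp hf
  have hFint : Integrable (Function.uncurry F) ((volume.restrict (Ioi (0 : ℝ))).prod μ) := by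
    refine (integrable_prod_iff hFm.aestronglyMeasurable).mpr ⟨ae_of_all _ fun x => ?_, ?_⟩
    · exact (integrable_const (k x • f x)).indicator measurableSet_Iio
    · simp only [Function.uncurry_apply_pair, hFn]
      exact hint.norm
  rw [lawT, integral_withDensity_eq_integral_toReal_smul (measurable_lawT_density μ δ)
    (ae_of_all _ fun _ => ENNReal.ofReal_lt_top)]
  calc _ = ∫ x in Ioi 0, ∫ s, F x s ∂μ := by
        refine integral_congr_ae (ae_of_all _ fun x => ?_)
        simp only
        rw [hF1, ENNReal.toReal_ofReal (mul_nonneg (hk0 x) measureReal_nonneg)]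
    _ = ∫ s, (∫ x in Ioi 0, F x s) ∂μ := integral_integral_swap hFint
    _ = _ := by
        refine integral_congr_ae ?_
        filter_upwards [hμ] with s hs0
        have : ∀ x, F x s = (Ioi s).indicator (fun x => k x • f x) x := by
          intro x
          simp only [hF, indicator_apply, mem_Iio, mem_Ioi]
        simp_rw [this]
        rw [integral_indicator measurableSet_Ioi, Measure.restrict_restrict measurableSet_Ioi,
          inter_eq_left.mpr (Ioi_subset_Ioi hs0.le)]

end

/-! ### Moments and Laplace transform of T(δ) -/

namespace IsS2Law

variable {μ : Measure ℝ} {δ : ℝ}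

/-- Markov's inequality for S^{-m}. The distribution function vanishes at 0 faster than any power,
which makes all negative moments of T finite. -/
lemma real_Iio_le (hμ : IsS2Law μ) {m x : ℝ} (hm : 0 ≤ m) (hx : 0 < x) :
    μ.real (Iio x) ≤ x ^ m * ∫ s, s ^ (-m) ∂μ := by
  have := hμ.prob
  rw [← integral_const_mul, ← integral_indicator_one measurableSet_Iio]
  refine integral_mono_ae ((integrable_const 1).indicator measurableSet_Iio)
    ((hμ.integrable_rpow _).const_mul _) ?_
  filter_upwards [hμ.pos] with s hs
  refine indicator_apply_le' (fun hsx => ?_) fun _ => by positivity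
  rw [Real.rpow_neg hs.le, ← div_eq_mul_inv, ← Real.div_rpow hx.le hs.le]
  exact Real.one_le_rpow ((one_le_div hs).mpr (le_of_lt hsx)) hm

lemma integrable_rpow_lawT (hμ : IsS2Law μ) (hδ : 0 < δ) (p : ℝ) :
    Integrable (fun x => x ^ p) (lawT μ δ) := by
  have := hμ.prob
  have hs := sinhFactor_pos hδ
  rw [integrable_lawT_iff hδ]
  obtain ⟨m, hm, hpm⟩ : ∃ m : ℝ, 0 ≤ m ∧ -1 < p + m :=
    ⟨max 0 (-p), le_max_left _ _, by linarith [le_max_right 0 (-p)]⟩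
  have hI : 0 ≤ ∫ s, s ^ (-m) ∂μ := integral_nonneg_of_ae (by
    filter_upwards [hμ.pos] with x hx using Real.rpow_nonneg hx.le _)
  have h1 : IntegrableOn (fun x => (δ * sinhFactor δ * ∫ s, s ^ (-m) ∂μ) *
      (x ^ (p + m) * Real.exp (-δ * x))) (Ioi 0) :=
    (by simpa using integrableOn_rpow_mul_exp_neg_mul_rpow (p := 1) hpm one_pos hδ :
      IntegrableOn (fun x : ℝ => x ^ (p + m) * Real.exp (-δ * x)) (Ioi 0) volume).const_mul _
  have hm1 := measurable_real_Iio μ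
  refine Integrable.mono h1 (Measurable.aestronglyMeasurable
    ((by fun_prop : Measurable fun x => δ * Real.exp (-δ * x) * sinhFactor δ * μ.real (Iio x)).mul
      (by fun_prop : Measurable fun x : ℝ => x ^ p))) ?_
  filter_upwards [ae_restrict_mem measurableSet_Ioi] with x (hx : 0 < x)
  rw [Real.norm_of_nonneg (smul_nonneg (by positivity) (by positivity)),
    Real.norm_of_nonneg (by positivity), smul_eq_mul, Real.rpow_add hx]
  calc δ * Real.exp (-δ * x) * sinhFactor δ * μ.real (Iio x) * x ^ p
      ≤ δ * Real.exp (-δ * x) * sinhFactor δ * (x ^ m * ∫ s, s ^ (-m) ∂μ) * x ^ p := by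
        gcongr
        exact hμ.real_Iio_le hm hx
    _ = _ := by ring

lemma isFiniteMeasure_lawT (hμ : IsS2Law μ) (hδ : 0 < δ) : IsFiniteMeasure (lawT μ δ) := by
  simpa [integrable_const_iff] using hμ.integrable_rpow_lawT hδ 0

lemma integrable_exp_lawT (hμ : IsS2Law μ) (hδ : 0 < δ) {n : ℝ} (hn : 0 ≤ n) :
    Integrable (fun x => Real.exp (-(n * x))) (lawT μ δ) := by
  have := hμ.isFiniteMeasure_lawT hδ
  refine Integrable.of_bound (by fun_prop : Measurable _).aestronglyMeasurable 1 ?_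
  filter_upwards [ae_lawT_pos μ δ] with x hx
  rw [Real.norm_of_nonneg (Real.exp_pos _).le, Real.exp_le_one_iff]
  nlinarith

lemma integral_exp_lawT (hμ : IsS2Law μ) (hδ : 0 < δ) {n : ℝ} (hn : 0 ≤ n) :
    ∫ x, Real.exp (-(n * x)) ∂(lawT μ δ) =
      δ / (n + δ) * (sinhFactor δ * ∫ s, Real.exp (-(n + δ) * s) ∂μ) := by
  have := hμ.prob
  rw [integral_lawT hμ.pos hδ (by fun_prop : Continuous fun x => Real.exp (-(n * x))).stronglyMeasurable
    (hμ.integrable_exp_lawT hδ hn), ← integral_const_mul, ← integral_const_mul]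
  refine integral_congr_ae (ae_of_all _ fun s => ?_)
  have h : ∀ x, (δ * Real.exp (-δ * x) * sinhFactor δ) • Real.exp (-(n * x)) =
      δ * sinhFactor δ * Real.exp (-(n + δ) * x) := by
    intro x
    rw [smul_eq_mul, show -(n + δ) * x = -δ * x + -(n * x) by ring, Real.exp_add]
    ring
  simp_rw [h]
  rw [integral_const_mul, integral_exp_mul_Ioi (by linarith)]
  have : n + δ ≠ 0 := by linarith
  field_simp

lemma isProbabilityMeasure_lawT (hμ : IsS2Law μ) (hδ : 0 < δ) :
    IsProbabilityMeasure (lawT μ δ) := by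
  have := hμ.isFiniteMeasure_lawT hδ
  have hs := (sinhFactor_pos hδ).ne'
  have h := hμ.integral_exp_lawT hδ le_rfl
  have h2 := hμ.laplace δ hδ
  rw [zero_add, h2, div_self hδ.ne', mul_inv_cancel₀ hs] at h
  simp only [zero_mul, neg_zero, Real.exp_zero, integral_const, smul_eq_mul, mul_one] at h
  constructor
  rw [← ENNReal.ofReal_toReal (measure_ne_top (lawT μ δ) univ), ← measureReal_def, h,
    ENNReal.ofReal_one]

lemma integrable_cpow_lawT (hμ : IsS2Law μ) (hδ : 0 < δ) (q : ℂ) :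
    Integrable (fun x : ℝ => (x : ℂ) ^ q) (lawT μ δ) :=
  integrable_cpow (ae_lawT_pos μ δ) (hμ.integrable_rpow_lawT hδ) q

lemma differentiable_mellinE_lawT (hμ : IsS2Law μ) (hδ : 0 < δ) :
    Differentiable ℂ (mellinE (lawT μ δ)) :=
  differentiable_mellinE (ae_lawT_pos μ δ) (hμ.integrable_rpow_lawT hδ)

/-- δ e^{-δx}(x^q - (q/δ) x^{q-1}) is the derivative of -x^q e^{-δx}, so the inner integral over (s,
∞) is s^q e^{-δs}, up to the factor c_δ. -/
lemma mellinE_lawT_sub (hμ : IsS2Law μ) (hδ : 0 < δ) (q : ℂ) :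
    mellinE (lawT μ δ) q - q / δ * mellinE (lawT μ δ) (q - 1) =
      (sinhFactor δ : ℂ) * ∫ x : ℝ, (x : ℂ) ^ q * (Real.exp (-δ * x) : ℂ) ∂μ := by
  have := hμ.prob
  have hδ' : (δ : ℂ) ≠ 0 := by exact_mod_cast hδ.ne'
  have h1 := hμ.integrable_cpow_lawT hδ q
  have h2 := (hμ.integrable_cpow_lawT hδ (q - 1)).const_mul (q / δ)
  rw [mellinE, mellinE, ← integral_const_mul, ← integral_sub h1 h2,
    integral_lawT hμ.pos hδ (f := fun x : ℝ => (x : ℂ) ^ q - q / δ * (x : ℂ) ^ (q - 1))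
      (by fun_prop : Measurable _).stronglyMeasurable (h1.sub h2), ← integral_const_mul]
  refine integral_congr_ae ?_
  filter_upwards [hμ.pos] with s hs
  set g : ℝ → ℂ := fun x => -((sinhFactor δ : ℂ) * ((x : ℂ) ^ q * (Real.exp (-δ * x) : ℂ))) with hg
  have hderiv : ∀ x ∈ Ici s, HasDerivAt g
      ((δ * Real.exp (-δ * x) * sinhFactor δ) • ((x : ℂ) ^ q - q / δ * (x : ℂ) ^ (q - 1))) x := by
    intro x hx
    have hx0 : 0 < x := hs.trans_le hx
    have d1 : HasDerivAt (fun x : ℝ => (x : ℂ) ^ q) (q * (x : ℂ) ^ (q - 1)) x := by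
      have := (hasDerivAt_id (x : ℂ)).cpow_const (c := q) (Or.inl (by simpa using hx0))
      simpa using this.comp_ofReal
    have d2 : HasDerivAt (fun x : ℝ => ((Real.exp (-δ * x) : ℝ) : ℂ))
        ((Real.exp (-δ * x) * -δ : ℝ) : ℂ) x := by
      have := ((hasDerivAt_id x).const_mul (-δ)).exp
      simpa using this.ofReal_comp
    have d := ((d1.mul d2).const_mul (sinhFactor δ : ℂ)).neg
    refine HasDerivAt.congr_deriv d ?_
    rw [Complex.real_smul]
    push_cast
    field_simp
    ring
  have hlim : Tendsto g atTop (𝓝 0) := by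
    have h3 := tendsto_rpow_mul_exp_neg_mul_atTop_nhds_zero q.re δ hδ
    have h4 : Tendsto (fun x : ℝ => (x : ℂ) ^ q * (Real.exp (-δ * x) : ℂ)) atTop (𝓝 0) := by
      rw [tendsto_zero_iff_norm_tendsto_zero]
      refine h3.congr' ?_
      filter_upwards [eventually_gt_atTop 0] with x hx
      rw [norm_mul, Complex.norm_cpow_eq_rpow_re_of_pos hx, Complex.norm_real,
        Real.norm_of_nonneg (Real.exp_pos _).le]
    have h5 := (h4.const_mul (sinhFactor δ : ℂ)).neg
    rwa [mul_zero, neg_zero] at h5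
  have hint : IntegrableOn (fun x : ℝ =>
      (δ * Real.exp (-δ * x) * sinhFactor δ) • ((x : ℂ) ^ q - q / δ * (x : ℂ) ^ (q - 1)))
      (Ioi s) := by
    have hp : ∀ q : ℂ, IntegrableOn (fun x : ℝ => (x : ℂ) ^ q * (Real.exp (-δ * x) : ℂ))
        (Ioi s) := by
      intro q
      -- Half of the exponential absorbs the power, leaving a constant on (s, ∞). The other half
      -- remains as an integrable majorant.
      obtain ⟨m, C, -, hb⟩ := rpow_mul_exp_le q.re (-(δ / 2)) (half_pos hδ)
      rw [neg_add_eq_sub] at hb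
      refine Integrable.mono (((integrableOn_exp_neg_mul (half_pos hδ)).mono_set
        (Ioi_subset_Ioi hs.le)).const_mul (Real.exp |-(δ / 2)| * s ^ (-(m : ℝ)) + C))
        (by fun_prop : Measurable _).aestronglyMeasurable ?_
      filter_upwards [ae_restrict_mem measurableSet_Ioi] with x (hx : s < x)
      have hx0 := hs.trans hx
      rw [norm_mul, Complex.norm_cpow_eq_rpow_re_of_pos hx0, Complex.norm_real,
        Real.norm_of_nonneg (Real.exp_pos _).le]
      refine le_trans ?_ (le_abs_self _)
      have h3 : Real.exp (-δ * x) = Real.exp (-(δ / 2) * x) * Real.exp (-(δ / 2) * x) := by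
        rw [← Real.exp_add]; ring_nf
      have h4 := hb x hx0
      rw [sub_self, zero_mul, Real.exp_zero, mul_one] at h4
      have h5 : x ^ (-(m : ℝ)) ≤ s ^ (-(m : ℝ)) :=
        Real.rpow_le_rpow_of_nonpos hs hx.le (by simp)
      rw [h3, ← mul_assoc]
      gcongr
      exact h4.trans (by gcongr)
    have := ((hp q).const_mul (δ * sinhFactor δ : ℂ)).sub
      ((hp (q - 1)).const_mul (sinhFactor δ * q : ℂ))
    refine this.congr (ae_of_all _ fun x => ?_)
    simp only [Pi.sub_apply, Complex.real_smul]
    push_cast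
    field_simp
  rw [integral_Ioi_of_hasDerivAt_of_tendsto' hderiv hint hlim, hg, zero_sub, neg_neg]

end IsS2Law

/-! ### Identification of T(δ) -/

lemma ae_powerLaw_mem {δ : ℝ} : ∀ᵐ x ∂(powerLaw δ), x ∈ Ioo (0 : ℝ) 1 :=
  (withDensity_absolutelyContinuous _ _).ae_le (ae_restrict_mem measurableSet_Ioo)

lemma integral_exp_map_neg_log_powerLaw {δ n : ℝ} (hδ : 0 < δ) (hn : 0 ≤ n) :
    ∫ x, Real.exp (-(n * x)) ∂((powerLaw δ).map fun x => -Real.log x) = δ / (n + δ) := by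
  rw [integral_map (by fun_prop) (by fun_prop)]
  have h := (powerLaw_cpow hδ (q := n) (by simp; linarith)).2
  have h1 : ∫ x : ℝ, (x : ℂ) ^ (n : ℂ) ∂(powerLaw δ) =
      ((∫ x : ℝ, Real.exp (-(n * -Real.log x)) ∂(powerLaw δ) : ℝ) : ℂ) := by
    rw [← integral_complex_ofReal]
    refine integral_congr_ae ?_
    filter_upwards [ae_powerLaw_mem] with x hx
    rw [← Complex.ofReal_cpow hx.1.le, Real.rpow_def_of_pos hx.1]
    ring_nf
  rw [h1] at h
  exact_mod_cast h

namespace IsGammaSeq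

variable {Ω : Type*} [MeasurableSpace Ω] {P : Measure Ω} [IsProbabilityMeasure P]
  {G : ℕ → Ω → ℝ}

lemma integral_exp_lawT_eq (hG : IsGammaSeq P G 2) {δ n : ℝ} (hδ : 0 < δ) (hn : 0 ≤ n) :
    ∫ x, Real.exp (-(n * x)) ∂(lawT (P.map (S2 G)) δ) =
      δ / (n + δ) * ∫ ω, Real.exp (-n * S2δ G δ ω) ∂P := by
  rw [hG.isS2Law.integral_exp_lawT hδ hn, hG.integral_exp_S2δ hδ hn,
    integral_map hG.measurable_S2.aemeasurable (by fun_prop)]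

/-- Both sides have the Laplace transform δ/(n+δ) · E[e^{-nS_2(δ)}], the first factor coming from
-log β_00(δ). -/
lemma lawT_eq_conv (hG : IsGammaSeq P G 2) {δ : ℝ} (hδ : 0 < δ) :
    lawT (P.map (S2 G)) δ =
      (P.map (S2δ G δ)).conv ((powerLaw δ).map fun x => -Real.log x) := by
  have hm := hG.measurable_S2δ δ
  have h1 := hG.isS2Law.isProbabilityMeasure_lawT hδ
  have h2 := Measure.isProbabilityMeasure_map (μ := P) hm.aemeasurable
  have h3 := isProbabilityMeasure_powerLaw hδ
  have h4 : IsProbabilityMeasure ((powerLaw δ).map fun x => -Real.log x) :=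
    Measure.isProbabilityMeasure_map (by fun_prop)
  refine eq_of_integral_exp_neg_eq ?_ (conv_Iio_zero ?_ ?_) fun n => ?_
  · exact measure_mono_null (fun x (hx : x < 0) => not_lt.mpr hx.le) (lawT_compl_Ioi _ δ)
  · rw [S2δ_eq_gammaSum]
    exact hG.map_Iio_zero two_pos (gammaWeight_pos hδ.le) (summable_gammaWeight hδ.le)
  · rw [Measure.map_apply (by fun_prop) measurableSet_Iio]
    refine measure_mono_null (fun x hx => ?_) (ae_iff.mp (ae_powerLaw_mem (δ := δ)))
    simp only [mem_preimage, mem_Iio, Left.neg_neg_iff] at hx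
    intro hx'
    exact absurd (Real.log_neg hx'.1 hx'.2) hx.not_gt
  · have hn : (0 : ℝ) ≤ n := n.cast_nonneg
    rw [hG.integral_exp_lawT_eq hδ hn, integral_exp_neg_conv,
      integral_exp_map_neg_log_powerLaw hδ hn, integral_map hm.aemeasurable (by fun_prop), mul_comm]
    simp only [neg_mul]

/-- Every admissible sequence β_M(δ) has moments converging to those of e^{-X} with X of law `lawT`.
Uniqueness of weak limits and injectivity of x ↦ e^{-x} then leave no other candidate. -/
lemma isLawT_iff (hG : IsGammaSeq P G 2) {δ : ℝ} (hδ : 0 < δ) (τ : ProbabilityMeasure ℝ) :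
    IsLawT δ τ ↔ (τ : Measure ℝ) = lawT (P.map (S2 G)) δ := by
  have hIio : ∀ {ρ : Measure ℝ}, ρ (Ioi 0)ᶜ = 0 → ρ (Iio 0) = 0 := fun h =>
    measure_mono_null (fun x (hx : x < 0) => not_lt.mpr hx.le) h
  have hIcc : ∀ {β : ℕ → ProbabilityMeasure ℝ}, (∀ M, 1 ≤ M → IsBetaM M δ (β M)) →
      ∀ᶠ M in atTop, (β M : Measure ℝ) (Icc 0 1)ᶜ = 0 := by
    intro β hβ
    filter_upwards [eventually_ge_atTop 1] with M hM
    exact measure_mono_null (compl_subset_compl.mpr Ioc_subset_Icc_self) (hβ M hM).1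
  have hmom : ∀ {τ : ProbabilityMeasure ℝ}, (τ : Measure ℝ) = lawT (P.map (S2 G)) δ →
      ∀ {β : ℕ → ProbabilityMeasure ℝ}, (∀ M, 1 ≤ M → IsBetaM M δ (β M)) →
        Tendsto β atTop (𝓝 (expNegLaw τ)) := by
    intro τ hτ β hβ
    refine tendsto_of_tendsto_moments (hIcc hβ) ?_ fun n => ?_
    · refine map_exp_neg_compl_Icc (hIio ?_)
      rw [hτ]
      exact lawT_compl_Ioi _ δ
    · have hn : (0 : ℝ) ≤ n := n.cast_nonneg
      have e : ∫ x, x ^ n ∂(expNegLaw τ : Measure ℝ) = δ / (n + δ) *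
          ∫ ω, Real.exp (-n * S2δ G δ ω) ∂P := by
        rw [← hG.integral_exp_lawT_eq hδ hn, ← hτ]
        change ∫ x, x ^ n ∂((τ : Measure ℝ).map fun x => Real.exp (-x)) = _
        rw [integral_map (by fun_prop) (by fun_prop)]
        refine integral_congr_ae (ae_of_all _ fun x => ?_)
        simp only
        rw [← Real.exp_nat_mul]
        ring_nf
      have h := tendsto_integral_pow_betaM hδ hβ n
      rw [← hG.integral_exp_S2δ_eq_exp hδ hn] at h
      rw [e]
      convert h using 3
      have : (n : ℝ) + δ ≠ 0 := by linarith
      field_simp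
      ring
  have hex : ∃ β : ℕ → ProbabilityMeasure ℝ, ∀ M, 1 ≤ M → IsBetaM M δ (β M) := by
    have : ∀ M : ℕ, ∃ β : ProbabilityMeasure ℝ, 1 ≤ M → IsBetaM M δ β := by
      intro M
      by_cases hM : 1 ≤ M
      · obtain ⟨β, hβ, -⟩ := existsUnique_isBetaM hM hδ
        exact ⟨β, fun _ => hβ⟩
      -- Filler for M = 0, which is unconstrained and irrelevant to the limit.
      · exact ⟨⟨Measure.dirac 0, inferInstance⟩, fun h => absurd h hM⟩
    choose β hβ using this
    exact ⟨β, hβ⟩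
  constructor
  · rintro ⟨-, β, hβ, hlim⟩
    have h1 := hG.isS2Law.isProbabilityMeasure_lawT hδ
    have h2 := tendsto_nhds_unique hlim
      (hmom (τ := ⟨lawT (P.map (S2 G)) δ, h1⟩) rfl hβ)
    exact eq_of_map_exp_neg_eq (congrArg Subtype.val h2)
  · intro h
    obtain ⟨β, hβ⟩ := hex
    refine ⟨?_, β, hβ, hmom h hβ⟩
    rw [h]
    exact lawT_compl_Ioi _ δ

lemma map_S2δ_add_neg_log (hG : IsGammaSeq P G 2) {δ : ℝ} (hδ : 0 < δ) {B : Ω → ℝ}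
    (hB : Measurable B) (hlaw : P.map B = powerLaw δ) (hind : IndepFun B (fun ω n => G n ω) P) :
    P.map (fun ω => S2δ G δ ω + -Real.log (B ω)) = lawT (P.map (S2 G)) δ := by
  -- S_2(δ) is a measurable functional of the whole sequence, so independence of B from the sequence
  -- passes to it.
  have hψ : Measurable fun g : ℕ → ℝ => ∑' n, g n / (Real.pi ^ 2 * ((n : ℝ) + 1) ^ 2 / 2 + δ) :=
    Measurable.tsum fun n => (measurable_pi_apply n).div_const _
  have h := (hind.comp (by fun_prop : Measurable fun x => -Real.log x) hψ).symm
  have h2 : IndepFun (S2δ G δ) (fun ω => -Real.log (B ω)) P := h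
  have h3 := h2.map_add_eq_map_conv_map₀ (hG.measurable_S2δ δ).aemeasurable (by fun_prop)
  rw [hG.lawT_eq_conv hδ, ← hlaw, Measure.map_map (by fun_prop) hB]
  exact h3

lemma integrable_cpow_map_S2δ (hG : IsGammaSeq P G 2) {δ : ℝ} (hδ : 0 < δ) (q : ℂ) :
    Integrable (fun x : ℝ => (x : ℂ) ^ q) (P.map (S2δ G δ)) := by
  have hs := sinhFactor_pos hδ
  rw [hG.map_S2δ hδ, integrable_withDensity_iff_integrable_smul' (by fun_prop)
    (ae_of_all _ fun _ => ENNReal.ofReal_lt_top)]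
  refine ((hG.isS2Law.integrable_cpow_mul_exp q (t := -δ)
    (by have := Real.pi_pos; linarith [(by positivity : 0 < Real.pi ^ 2 / 2)])).const_mul
    (sinhFactor δ : ℂ)).congr (ae_of_all _ fun x => ?_)
  simp only
  rw [ENNReal.toReal_ofReal (by positivity), Complex.real_smul]
  push_cast
  ring

lemma mellinE_map_S2δ (hG : IsGammaSeq P G 2) {δ : ℝ} (hδ : 0 < δ) (q : ℂ) :
    mellinE (P.map (S2δ G δ)) q = (sinhFactor δ : ℂ) *
      ∫ x : ℝ, (x : ℂ) ^ q * (Real.exp (-δ * x) : ℂ) ∂(P.map (S2 G)) := by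
  have hs := sinhFactor_pos hδ
  rw [hG.map_S2δ hδ, mellinE, integral_withDensity_eq_integral_toReal_smul (by fun_prop)
    (ae_of_all _ fun _ => ENNReal.ofReal_lt_top), ← integral_const_mul]
  refine integral_congr_ae (ae_of_all _ fun x => ?_)
  simp only
  rw [ENNReal.toReal_ofReal (by positivity), Complex.real_smul]
  push_cast
  ring

end IsGammaSeq

/-! ### Assembly of the theorem -/

theorem mainTheorem11 {Ω : Type*} [MeasurableSpace Ω] (P : Measure Ω) [IsProbabilityMeasure P]
    (G : ℕ → Ω → ℝ) (hGm : ∀ n, Measurable (G n)) (hGind : iIndepFun G P)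
    (hGlaw : ∀ n, P.map (G n) = gammaMeasure 2 1) :
    -- `β_M(δ)` is well defined, and `β_{0,0}(δ)` has density `δ x^{δ-1}` on `(0, 1)`
    (∀ δ : ℝ, 0 < δ →
      (∀ M : ℕ, 1 ≤ M → ∃! μ : ProbabilityMeasure ℝ, IsBetaM M δ μ) ∧
      ∀ μ : ProbabilityMeasure ℝ, IsBeta00 δ μ ↔
        (μ : Measure ℝ) = (volume.restrict (Ioo 0 1)).withDensity
          (fun x => ENNReal.ofReal (δ * x ^ (δ - 1)))) ∧
    -- the auxiliary distributions `S_2(δ)`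
    (∀ δ : ℝ, 0 < δ →
      (∀ᵐ ω ∂P, Summable (fun n : ℕ => G n ω / (Real.pi ^ 2 * ((n : ℝ) + 1) ^ 2 / 2 + δ)) ∧
        0 < S2δ G δ ω) ∧
      AEMeasurable (S2δ G δ) P ∧
      IsInfDivisible (P.map (S2δ G δ)) ∧
      P.map (S2δ G δ) ≪ volume ∧
      (∀ q : ℝ, 0 < q →
        ∫ ω, Real.exp (-q * S2δ G δ ω) ∂P =
          sinhFactor δ * ∫ ω, Real.exp (-(q + δ) * S2 G ω) ∂P ∧
        IntegrableOn (fun t : ℝ => (Real.exp (-q * t) - 1) * Real.exp (-δ * t) *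
          (thetaJ (Real.pi * t / 2) - 1) / t) (Ioi 0) ∧
        ∫ ω, Real.exp (-q * S2δ G δ ω) ∂P =
          Real.exp (∫ t in Ioi (0 : ℝ), (Real.exp (-q * t) - 1) * Real.exp (-δ * t) *
            (thetaJ (Real.pi * t / 2) - 1) / t)) ∧
      (δ < Real.pi ^ 2 / 2 → ∀ q : ℂ,
        Integrable (fun x : ℝ => (x : ℂ) ^ q) (P.map (S2δ G δ)) ∧
        Summable (xiTerm δ q) ∧
        mellinE (P.map (S2δ G δ)) q =
          (sinhFactor δ : ℂ) * ((2 / Real.pi : ℝ) : ℂ) ^ q * ∑' n, xiTerm δ q n)) ∧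
    -- the densities of `S_2` and `S_2(δ)`
    ((∀ᵐ ω ∂P, Summable (fun n : ℕ => G n ω / ((n : ℝ) + 1) ^ 2) ∧ 0 < S2 G ω) ∧
      AEMeasurable (S2 G) P ∧
      ∃ f : ℝ → ℝ, Measurable f ∧ (∀ x, 0 ≤ f x) ∧
        P.map (S2 G) = (volume.restrict (Ioi 0)).withDensity (fun x => ENNReal.ofReal (f x)) ∧
        ∀ δ : ℝ, 0 < δ →
          P.map (S2δ G δ) = (volume.restrict (Ioi 0)).withDensity
            (fun x => ENNReal.ofReal (sinhFactor δ * Real.exp (-δ * x) * f x))) ∧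
    -- the limit distributions `T(δ)`
    ∃ T : ℝ → ProbabilityMeasure ℝ,
      (∀ δ : ℝ, 0 < δ →
        (∀ τ : ProbabilityMeasure ℝ, IsLawT δ τ ↔ τ = T δ) ∧
        (∀ B : Ω → ℝ, Measurable B →
          (∃ μ : ProbabilityMeasure ℝ, IsBeta00 δ μ ∧ P.map B = (μ : Measure ℝ)) →
          IndepFun B (fun ω n => G n ω) P →
          P.map (fun ω => S2δ G δ ω + -Real.log (B ω)) = (T δ : Measure ℝ)) ∧
        (T δ : Measure ℝ) = (volume.restrict (Ioi 0)).withDensity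
          (fun x => ENNReal.ofReal
            (δ * Real.exp (-δ * x) * sinhFactor δ * P.real {ω | S2 G ω < x})) ∧
        (∀ q : ℂ, Integrable (fun x : ℝ => (x : ℂ) ^ q) (T δ : Measure ℝ)) ∧
        Differentiable ℂ (mellinE (T δ : Measure ℝ)) ∧
        (δ < Real.pi ^ 2 / 2 → ∀ q : ℂ,
          Summable (xiTerm δ q) ∧
          mellinE (T δ : Measure ℝ) q - q / δ * mellinE (T δ : Measure ℝ) (q - 1) =
            (sinhFactor δ : ℂ) * ((2 / Real.pi : ℝ) : ℂ) ^ q * ∑' n, xiTerm δ q n)) ∧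
      ∀ q : ℂ, Tendsto
        (fun δ : ℝ => mellinE (T δ : Measure ℝ) q - q / δ * mellinE (T δ : Measure ℝ) (q - 1))
        (𝓝[>] 0) (𝓝 (((2 / Real.pi : ℝ) : ℂ) ^ q * (2 * xiR (2 * q)))) := by
  have hG : IsGammaSeq P G 2 := ⟨hGm, hGind, hGlaw⟩
  have hS := hG.isS2Law
  refine ⟨fun δ hδ => ⟨fun M hM => existsUnique_isBetaM hM hδ, isBeta00_iff hδ⟩, fun δ hδ => ?_,
    ⟨?_, hG.measurable_S2.aemeasurable, ?_⟩, ?_⟩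
  · refine ⟨?_, (hG.measurable_S2δ δ).aemeasurable, ?_, ?_, fun q hq => ⟨?_, ?_, ?_⟩,
      fun hδ' q => ⟨hG.integrable_cpow_map_S2δ hδ q, hS.summable_xiTerm hδ hδ' q, ?_⟩⟩
    · filter_upwards [hG.ae_summable_S2δ hδ,
        hG.ae_gammaSum_pos two_pos (gammaWeight_pos hδ.le) (summable_gammaWeight hδ.le)] with ω h1 h2
      rw [S2δ_eq_gammaSum]
      exact ⟨h1, h2⟩
    · rw [S2δ_eq_gammaSum]
      exact hG.isInfDivisible_map two_pos (gammaWeight_pos hδ.le) (summable_gammaWeight hδ.le)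
    · rw [S2δ_eq_gammaSum]
      exact hG.absolutelyContinuous_map two_pos (gammaWeight_pos hδ.le) (summable_gammaWeight hδ.le)
    · exact hG.integral_exp_S2δ hδ hq.le
    · simp_rw [mul_assoc _ (Real.exp _) (_ - _)]
      exact integrableOn_frullani hq.le (integrableOn_exp_mul_thetaJ_sub_one hδ)
    · simp_rw [mul_assoc _ (Real.exp _) (_ - _)]
      exact hG.integral_exp_S2δ_eq_exp hδ hq.le
    · rw [hG.mellinE_map_S2δ hδ, hS.integral_cpow_mul_exp hδ hδ', mul_assoc]
  · filter_upwards [hG.ae_summable_S2, hG.ae_S2_pos] with ω h1 h2 using ⟨h1, h2⟩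
  · obtain ⟨f, hfm, hf0, hf⟩ := hG.exists_density_S2
    refine ⟨f, hfm, hf0, hf, fun δ hδ => ?_⟩
    rw [hG.map_S2δ hδ, hf, ← withDensity_mul _ (by fun_prop) (by fun_prop)]
    congr 1
    ext x
    have := sinhFactor_pos hδ
    rw [Pi.mul_apply, ← ENNReal.ofReal_mul (hf0 x), mul_comm]
  · have hIio : ∀ x, (P.map (S2 G)).real (Iio x) = P.real {ω | S2 G ω < x} := fun x =>
      map_measureReal_apply hG.measurable_S2 measurableSet_Iio
    obtain ⟨T, hT⟩ : ∃ T : ℝ → ProbabilityMeasure ℝ,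
        ∀ δ, 0 < δ → (T δ : Measure ℝ) = lawT (P.map (S2 G)) δ := by
      have : ∀ δ : ℝ, ∃ τ : ProbabilityMeasure ℝ,
          0 < δ → (τ : Measure ℝ) = lawT (P.map (S2 G)) δ := by
        intro δ
        by_cases hδ : 0 < δ
        · exact ⟨⟨_, hS.isProbabilityMeasure_lawT hδ⟩, fun _ => rfl⟩
        -- Filler for δ ≤ 0: every later claim, including the one-sided limit, involves only δ > 0.
        · exact ⟨⟨Measure.dirac 0, inferInstance⟩, fun h => absurd h hδ⟩
      choose T hT using this
      exact ⟨T, hT⟩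
    refine ⟨T, fun δ hδ => ⟨fun τ => ?_, ?_, ?_, ?_, ?_, fun hδ' q => ⟨?_, ?_⟩⟩, fun q => ?_⟩
    · rw [hG.isLawT_iff hδ, ← hT δ hδ]
      exact Subtype.ext_iff.symm
    · rintro B hB ⟨μ, hμ, hBμ⟩ hind
      rw [hT δ hδ]
      exact hG.map_S2δ_add_neg_log hδ hB (hBμ.trans ((isBeta00_iff hδ μ).mp hμ)) hind
    · simp only [hT δ hδ, lawT, hIio]
    · rw [hT δ hδ]
      exact hS.integrable_cpow_lawT hδ
    · rw [hT δ hδ]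
      exact hS.differentiable_mellinE_lawT hδ
    · exact hS.summable_xiTerm hδ hδ' q
    · rw [hT δ hδ, hS.mellinE_lawT_sub hδ, hS.integral_cpow_mul_exp hδ hδ', mul_assoc]
    · rw [← hS.mellinE_eq]
      refine (hS.tendsto_integral_cpow_mul_exp q).congr' ?_
      filter_upwards [self_mem_nhdsWithin] with δ (hδ : 0 < δ)
      rw [hT δ hδ, hS.mellinE_lawT_sub hδ]
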